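/- A finite semigroup $S$ is called *$0$-simple* if it has a zero element $0$ and $SsS=S$ for every $s\in S\setminus\{0\}$. For a class $\mathbf V$ of semigroups, let $\mathrm{CSM}(\mathbf V)$ be the following problem (a promise problem: only encodings of instances with $S\in\mathbf V$ are valid inputs): given the Cayley table of a finite semigroup $S\in\mathbf V$, a subset $X\subseteq S$ and an element $t\in S$, decide whether $t$ belongs to the subsemigroup of $S$ generated by $X$. Here the elements of a semigroup with $N$ elements are numbered $0,\dots,N-1$ and each is written with $\lceil\log_2 N\rceil$ bits; an input consists of the multiplication table ($N^2$ such entries), the characteristic vector of $X$ ($N$ bits) and the element $t$. **Theorem.** Let $\mathbf V$ be any class of semigroups which contains all finite $0$-simple semigroups. Then $\mathrm{CSM}(\mathbf V)$ is $\mathsf{NL}$-complete, both under $\mathsf{AC}^0$ many-one reductions and under logarithmic-space many-one reductions. That is: 1. there is a nondeterministic logarithmic-space Turing machine which, on every valid input $(S,X,t)$ with $S\in\mathbf V$, accepts if and only if $t$ is in the subsemigroup generated by $X$; 2. for every language $A\subseteq\{0,1\}^*$ in $\mathsf{NL}$ there is a function $f$, computed by a family of unbounded fan-in Boolean circuits of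 constant depth and polynomial size (one circuit per input length), which maps words in $A$ to valid inputs of $\mathrm{CSM}(\mathbf V)$ with answer "yes" and words outside $A$ to valid inputs with answer "no"; and there is also such a function that is computed by a deterministic logarithmic-space transducer. -/

import Mathlib

namespace CayleyNL

/-! ### Turing machines with a read-only input tape and space-bounded work tapes -/

/-- What the input head sees: one of the two end markers or an input bit. -/
inductive InputSym where
  | leftEnd : InputSym
  | rightEnd : InputSym
  | bit (b : Bool) : InputSym

/-- Head movements. -/
inductive Move where
  | left : Move
  | stay : Move
  | right : Move

/-- Move a head on the cells `0, 1, 2, …`; a left move from cell `0` has no effect. -/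
def Move.apply : Move → ℕ → ℕ
  | .left, p => p - 1
  | .stay, p => p
  | .right, p => p + 1

/-- What one transition does: the new state, the movement of the input head, the symbol written
and the movement made on every work tape, and the word appended to the (write-only, one-way)
output tape. Acceptors ignore the output. -/
structure Action (State Sym : Type) (k : ℕ) where
  state : State
  inMove : Move
  write : Fin k → Sym
  move : Fin k → Move
  out : List Bool

/-- A nondeterministic multitape Turing machine with a two-way read-only input tape over `Bool`
with end markers, `tapes` one-way infinite work tapes and a write-only output tape. -/
structure Machine where
  State : Type
  Sym : Type
  finite_state : Finite State
  finite_sym : Finite Sym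
  tapes : ℕ
  blank : Sym
  start : State
  accept : State
  /-- The possible actions, given the state, the scanned input symbol and the scanned work
  symbols. All `out` words come from a finite set. -/
  trans : State → InputSym → (Fin tapes → Sym) → Set (Action State Sym tapes)
  finite_trans : ∀ q a s, (trans q a s).Finite

namespace Machine

variable (M : Machine)

/-- Configurations (without the content of the input tape and of the output tape). -/
structure Cfg where
  state : M.State
  inPos : ℕ
  tape : Fin M.tapes → ℕ → M.Sym
  head : Fin M.tapes → ℕ

/-- The input tape: cell `0` holds the left end marker, cells `1, …, n` the input word and
cell `n + 1` the right end marker. -/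
def readInput (w : List Bool) : ℕ → InputSym
  | 0 => .leftEnd
  | p + 1 => match w[p]? with
    | some b => .bit b
    | none => .rightEnd

/-- The initial configuration: all work tapes are blank, all heads are at cell `0`. -/
def init : M.Cfg where
  state := M.start
  inPos := 0
  tape := fun _ _ => M.blank
  head := fun _ => 0

variable {M}

/-- The actions available in a configuration on input `w`. -/
def Cfg.actions (w : List Bool) (c : M.Cfg) : Set (Action M.State M.Sym M.tapes) :=
  M.trans c.state (readInput w c.inPos) (fun i => c.tape i (c.head i))

/-- The configuration after an action; the input head never leaves the cells `0, …, n + 1`. -/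
def Cfg.perform (w : List Bool) (c : M.Cfg) (a : Action M.State M.Sym M.tapes) : M.Cfg where
  state := a.state
  inPos := min (a.inMove.apply c.inPos) (w.length + 1)
  tape := fun i => Function.update (c.tape i) (c.head i) (a.write i)
  head := fun i => (a.move i).apply (c.head i)

variable (M)

/-- `M.Run w c o c'`: on input `w` there is a (finite) computation from `c` to `c'` which writes
the word `o` on the output tape. -/
inductive Run (w : List Bool) : M.Cfg → List Bool → M.Cfg → Prop
  | refl (c : M.Cfg) : Run w c [] c
  | step {c c' : M.Cfg} {o : List Bool} (h : Run w c o c')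
      (a : Action M.State M.Sym M.tapes) (ha : a ∈ c'.actions w) :
      Run w c (o ++ a.out) (c'.perform w a)

/-- Some computation of `M` on input `w` reaches the accepting state. -/
def Accepts (w : List Bool) : Prop :=
  ∃ o c, M.Run w M.init o c ∧ c.state = M.accept

/-- On every input of length `n`, no computation of `M` ever leaves the first `O(log n)` cells of
the work tapes. -/
def LogSpace : Prop :=
  ∃ K : ℕ, ∀ w o c, M.Run w M.init o c → ∀ i, c.head i < K * (Nat.log 2 w.length + 1)

/-- There is at most one action in every situation. -/
def Deterministic : Prop :=
  ∀ q a s, (M.trans q a s).Subsingleton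

/-- On every input `w`, `M` has a computation which halts with `f w` on the output tape. -/
def Computes (f : List Bool → List Bool) : Prop :=
  ∀ w, ∃ c, M.Run w M.init (f w) c ∧ c.actions w = ∅

end Machine

/-- The class `NL` of languages. -/
def NL : Set (Set (List Bool)) :=
  {A | ∃ M : Machine, M.LogSpace ∧ ∀ w, w ∈ A ↔ M.Accepts w}

/-- Functions computed by deterministic logarithmic-space transducers. -/
def LogSpaceComputable (f : List Bool → List Bool) : Prop :=
  ∃ M : Machine, M.Deterministic ∧ M.LogSpace ∧ M.Computes f

/-! ### Unbounded fan-in Boolean circuits -/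

/-- A wire entering gate number `g`, or an output wire if `g` is the number of gates: it comes from
one of the `n` inputs or from a gate with a smaller number, and passes through a NOT gate if the
second component is `true`. -/
abbrev Wire (n g : ℕ) : Type := (Fin n ⊕ Fin g) × Bool

/-- A Boolean circuit with `n` inputs, whose AND and OR gates have unbounded fan-in and are
numbered in a topological order. NOT gates sit on the wires. -/
structure Circuit (n : ℕ) where
  gates : ℕ
  isAnd : Fin gates → Bool
  wires : (g : Fin gates) → Finset (Wire n g)
  outputs : List (Wire n gates)

namespace Circuit

variable {n : ℕ} (C : Circuit n)

/-- The value of gate `g` on input `x`. -/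
def gateVal (x : Fin n → Bool) (g : ℕ) (hg : g < C.gates) : Bool :=
  let val : Wire n g → Bool := fun l => match l with
    | (.inl i, b) => xor (x i) b
    | (.inr h, b) => xor (gateVal x h (h.2.trans hg)) b
  if C.isAnd ⟨g, hg⟩ = true then decide (∀ l ∈ C.wires ⟨g, hg⟩, val l = true)
  else decide (∃ l ∈ C.wires ⟨g, hg⟩, val l = true)
termination_by g
decreasing_by exact h.2

/-- The length of a longest path from an input to gate `g`, counting AND and OR gates only. -/
def gateDepth (g : ℕ) (hg : g < C.gates) : ℕ :=
  1 + (C.wires ⟨g, hg⟩).sup fun l => match l with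
    | (.inl _, _) => 0
    | (.inr h, _) => gateDepth h (h.2.trans hg)
termination_by g
decreasing_by exact h.2

/-- The word computed by the circuit. -/
def eval (x : Fin n → Bool) : List Bool :=
  C.outputs.map fun l => match l with
    | (.inl i, b) => xor (x i) b
    | (.inr g, b) => xor (C.gateVal x g g.2) b

/-- The size: the number of AND and OR gates plus the number of outputs. -/
def size : ℕ := C.gates + C.outputs.length

end Circuit

/-- Functions computed by a family of unbounded fan-in circuits of constant depth and
polynomial size, one circuit for every input length. -/
def AC0Computable (f : List Bool → List Bool) : Prop :=
  ∃ (C : (n : ℕ) → Circuit n) (d : ℕ) (p : Polynomial ℕ),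
    (∀ n, (C n).size ≤ p.eval n) ∧
    (∀ n g (hg : g < (C n).gates), (C n).gateDepth g hg ≤ d) ∧
    ∀ w : List Bool, f w = (C w.length).eval w.get

/-! ### Promise problems and completeness -/

/-- A decision problem whose inputs are restricted to the encodings of valid instances: `yes` and
`no` are the sets of encodings of the valid instances with the respective answer. -/
structure PromiseProblem where
  yes : Set (List Bool)
  no : Set (List Bool)

/-- Some language in `NL` contains all yes-instances and no no-instance, that is, some
nondeterministic logarithmic-space machine answers correctly on all valid instances. -/
def InNL (P : PromiseProblem) : Prop :=
  ∃ A ∈ NL, P.yes ⊆ A ∧ Disjoint P.no A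

/-- Every language in `NL` is many-one reducible to `P` by a function from the class `F`. -/
def NLHard (F : (List Bool → List Bool) → Prop) (P : PromiseProblem) : Prop :=
  ∀ A ∈ NL, ∃ f, F f ∧ (∀ w ∈ A, f w ∈ P.yes) ∧ (∀ w ∉ A, f w ∈ P.no)

/-- `P` is `NL`-complete under many-one reductions from the class `F`. -/
def NLComplete (F : (List Bool → List Bool) → Prop) (P : PromiseProblem) : Prop :=
  InNL P ∧ NLHard F P

/-! ### Cayley semigroup membership -/

/-- `S` has a zero element `z`, and `S s S = S` for all `s ≠ z`. -/
def IsZeroSimple (S : Type) [Semigroup S] : Prop :=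
  ∃ z : S, (∀ s : S, z * s = z ∧ s * z = z) ∧
    ∀ s : S, s ≠ z → ∀ u : S, ∃ a b : S, a * s * b = u

/-- The `⌈log₂ N⌉` binary digits of `i < N`, the least significant one first. -/
def encodeElement {N : ℕ} (i : Fin N) : List Bool :=
  List.ofFn fun b : Fin (Nat.clog 2 N) => Nat.testBit i b

/-- A semigroup `S` in the class `V`, a numbering of its elements by `0, …, N - 1`, a subset `X`
and an element `t`. -/
structure MembershipInstance (V : (S : Type) → [Semigroup S] → Prop) where
  S : Type
  [semigroup : Semigroup S]
  mem_class : V S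
  N : ℕ
  num : S ≃ Fin N
  X : Set S
  t : S

attribute [instance] MembershipInstance.semigroup

open Classical in
/-- The multiplication table, row by row, with `N²` entries of `⌈log₂ N⌉` bits each, followed by
the characteristic vector of `X` and by the number of `t`. -/
noncomputable def MembershipInstance.encode {V : (S : Type) → [Semigroup S] → Prop}
    (I : MembershipInstance V) : List Bool :=
  ((List.finRange I.N).flatMap fun i => (List.finRange I.N).flatMap fun j =>
      encodeElement (I.num (I.num.symm i * I.num.symm j))) ++
    (List.finRange I.N).map (fun i => decide (I.num.symm i ∈ I.X)) ++
    encodeElement (I.num I.t)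

/-- The Cayley semigroup membership problem for the class `V`: given the Cayley table of a finite
semigroup `S` in `V`, a subset `X` and an element `t` of `S`, is `t` in the subsemigroup of `S`
generated by `X`? -/
def CSM (V : (S : Type) → [Semigroup S] → Prop) : PromiseProblem where
  yes := {w | ∃ I : MembershipInstance V, I.t ∈ Subsemigroup.closure I.X ∧ I.encode = w}
  no := {w | ∃ I : MembershipInstance V, I.t ∉ Subsemigroup.closure I.X ∧ I.encode = w}

end CayleyNL

/-! Upper bound. Every product of generators can be bracketed to the left. Hence `t` lies in the
subsemigroup generated by `X` if and only if `t` is reachable from some generator by repeated right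
multiplication with generators (`mem_closure_iff_reflTransGen`). A nondeterministic machine guesses
such a walk, storing only a constant number of element numbers and looking up each product in the
table (`encode_mem_searchLanguage`). This works for every class of semigroups.

Hardness. On an input `w`, a log-space machine has polynomially many configurations, and it accepts
if and only if there is a path from the initial configuration to an additional sink entered from
accepting configurations (`ConfigGraph.accepts_iff`). Let `m` be the number of nodes. The Brandt
semigroup over the trivial group consists of a zero and the pairs `(a, b)` of nodes, with `(a, b)(b,
d) = (a, d)` and all other products zero. It is 0-simple. A pair `(a, b)` is a product of edges if
and only if there is a nonempty path from `a` to `b` (`Brandt.pair_mem_closure_iff`). So the edges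
are the generators, and the pair (initial configuration, sink) is the target.

In the encoding of this instance, the multiplication table and the target depend only on the length
of `w`. Whether `(x, y)` is an edge depends only on the input cell scanned in `x`. Every output bit
is therefore a constant or a literal, and the reduction is in AC⁰ with no real computation
(`reduction_AC0Computable`).

The log-space claims require actual machines, which are obtained in layers. Arithmetic expressions
with bounded sums have polynomially bounded values. They compile to register programs with
polynomially bounded registers, these to tape programs in which registers are binary counters, and
these to Turing machines whose states are continuations. Two semantics are carried through the
layers: `Prog.Exec` shows that a wanted computation exists, and `Prog.wlp` shows that all
computations, terminating or not, respect the space bound and that terminating ones are sound. It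
then remains to write the search graph and the bits of the reduction with bounded sums (`Definable`,
`DefinablePred`). -/

namespace CayleyNL

/-! ### Structured programs -/

/-- Structured nondeterministic programs over atomic commands `A` and tests `T`. -/
inductive Prog (A T : Type) where
  | skip : Prog A T
  | fail : Prog A T
  | act (a : A) : Prog A T
  | seq (P Q : Prog A T) : Prog A T
  | branch (t : T) (P Q : Prog A T) : Prog A T
  | loop (t : T) (P : Prog A T) : Prog A T
  | choice (P Q : Prog A T) : Prog A T

/-- An interpretation of atomic commands and tests over a state space `σ`. The predicate `ok`
singles out the states which respect a resource bound. -/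
structure Sem (A T σ : Type) where
  step : A → σ → σ
  out : A → σ → List Bool
  test : T → σ → Prop
  ok : σ → Prop

namespace Prog

variable {A T A' T' σ τ : Type}

/-- Terminating executions all of whose intermediate states respect the resource bound. -/
inductive Exec (S : Sem A T σ) : Prog A T → σ → List Bool → σ → Prop
  | skip (s) : Exec S skip s [] s
  | act (a s) (h : S.ok (S.step a s)) : Exec S (act a) s (S.out a s) (S.step a s)
  | seq {P Q s o s₁ o' s₂} (h₁ : Exec S P s o s₁) (h₂ : Exec S Q s₁ o' s₂) :
      Exec S (seq P Q) s (o ++ o') s₂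
  | branch_true {t P Q s o s'} (ht : S.test t s) (h : Exec S P s o s') :
      Exec S (branch t P Q) s o s'
  | branch_false {t P Q s o s'} (ht : ¬ S.test t s) (h : Exec S Q s o s') :
      Exec S (branch t P Q) s o s'
  | loop_true {t P s o s₁ o' s₂} (ht : S.test t s) (h₁ : Exec S P s o s₁)
      (h₂ : Exec S (loop t P) s₁ o' s₂) : Exec S (loop t P) s (o ++ o') s₂
  | loop_false {t P s} (ht : ¬ S.test t s) : Exec S (loop t P) s [] s
  | choice_left {P Q s o s'} (h : Exec S P s o s') : Exec S (choice P Q) s o s'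
  | choice_right {P Q s o s'} (h : Exec S Q s o s') : Exec S (choice P Q) s o s'

/-- The weakest precondition under which all executions respect the resource bound and all
terminating ones establish `Q`. -/
def wlp (S : Sem A T σ) : Prog A T → (σ → Prop) → σ → Prop
  | skip, Q, s => Q s
  | fail, _, _ => True
  | act a, Q, s => S.ok (S.step a s) ∧ Q (S.step a s)
  | seq P R, Q, s => wlp S P (wlp S R Q) s
  | branch t P R, Q, s => (S.test t s → wlp S P Q s) ∧ (¬ S.test t s → wlp S R Q s)
  | loop t P, Q, s => ∃ I : σ → Prop, I s ∧
      ∀ s', I s' → (S.test t s' → wlp S P I s') ∧ (¬ S.test t s' → Q s')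
  | choice P R, Q, s => wlp S P Q s ∧ wlp S R Q s

theorem wlp_mono (S : Sem A T σ) (P : Prog A T) {Q Q' : σ → Prop} (h : ∀ s, Q s → Q' s) {s : σ}
    (hP : wlp S P Q s) : wlp S P Q' s := by
  induction P generalizing Q Q' s with
  | skip => exact h _ hP
  | fail => trivial
  | act a => exact ⟨hP.1, h _ hP.2⟩
  | seq P R ihP ihR => exact ihP (fun s hs => ihR h hs) hP
  | branch t P R ihP ihR => exact ⟨fun ht => ihP h (hP.1 ht), fun ht => ihR h (hP.2 ht)⟩
  | loop t P ihP =>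
    obtain ⟨I, hI, hs⟩ := hP
    exact ⟨I, hI, fun s' hs' => ⟨(hs s' hs').1, fun ht => h _ ((hs s' hs').2 ht)⟩⟩
  | choice P R ihP ihR => exact ⟨ihP h hP.1, ihR h hP.2⟩

/-- The existentially quantified invariant makes the loop clause a greatest fixed point, so it can
be unfolded. Conversely, the unfolded condition, taken as a predicate on states, is itself an
invariant. -/
theorem wlp_loop_iff (S : Sem A T σ) (t : T) (P : Prog A T) (Q : σ → Prop) (s : σ) :
    wlp S (loop t P) Q s ↔
      (S.test t s → wlp S P (wlp S (loop t P) Q) s) ∧ (¬ S.test t s → Q s) := by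
  constructor
  · rintro ⟨I, hI, h⟩
    exact ⟨fun ht => wlp_mono S P (fun s' hs' => ⟨I, hs', h⟩) ((h s hI).1 ht), (h s hI).2⟩
  · rintro h
    refine ⟨fun s => (S.test t s → wlp S P (wlp S (loop t P) Q) s) ∧ (¬ S.test t s → Q s), h, ?_⟩
    intro s' hs'
    refine ⟨fun ht => wlp_mono S P ?_ (hs'.1 ht), hs'.2⟩
    rintro s'' ⟨I, hI, h⟩
    exact ⟨fun ht => wlp_mono S P (fun s' hs' => ⟨I, hs', h⟩) ((h s'' hI).1 ht), (h s'' hI).2⟩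

/-- Programs without nondeterministic choices. -/
def Det : Prog A T → Prop
  | skip => True
  | fail => True
  | act _ => True
  | seq P Q => Det P ∧ Det Q
  | branch _ P Q => Det P ∧ Det Q
  | loop _ P => Det P
  | choice _ _ => False

/-- Without choices, a terminating execution is the only one, so a single execution within the bound
controls them all. Deterministic subroutines thus need only be specified by `Exec`. -/
theorem wlp_of_exec {S : Sem A T σ} {P : Prog A T} {s s' : σ} {o : List Bool}
    (h : Exec S P s o s') (hd : P.Det) {Q : σ → Prop} (hQ : Q s') : wlp S P Q s := by
  induction h generalizing Q with
  | skip s => exact hQ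
  | act a s h => exact ⟨h, hQ⟩
  | seq h₁ h₂ ih₁ ih₂ => exact ih₁ hd.1 (ih₂ hd.2 hQ)
  | branch_true ht h ih => exact ⟨fun _ => ih hd.1 hQ, fun h => absurd ht h⟩
  | branch_false ht h ih => exact ⟨fun h => absurd h ht, fun _ => ih hd.2 hQ⟩
  | loop_true ht h₁ h₂ ih₁ ih₂ =>
    rw [wlp_loop_iff]
    exact ⟨fun _ => ih₁ hd (ih₂ hd hQ), fun h => absurd ht h⟩
  | loop_false ht =>
    rw [wlp_loop_iff]
    exact ⟨fun h => absurd h ht, fun _ => hQ⟩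
  | choice_left h ih => exact hd.elim
  | choice_right h ih => exact hd.elim

/-- All atomic commands of the program satisfy `pA` and all its tests satisfy `pT`. -/
def All (pA : A → Prop) (pT : T → Prop) : Prog A T → Prop
  | skip => True
  | fail => True
  | act a => pA a
  | seq P Q => All pA pT P ∧ All pA pT Q
  | branch t P Q => pT t ∧ All pA pT P ∧ All pA pT Q
  | loop t P => pT t ∧ All pA pT P
  | choice P Q => All pA pT P ∧ All pA pT Q

/-- Replace atomic commands by programs and translate the tests. -/
def bind (f : A → Prog A' T') (g : T → T') : Prog A T → Prog A' T'
  | skip => skip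
  | fail => fail
  | act a => f a
  | seq P Q => seq (bind f g P) (bind f g Q)
  | branch t P Q => branch (g t) (bind f g P) (bind f g Q)
  | loop t P => loop (g t) (bind f g P)
  | choice P Q => choice (bind f g P) (bind f g Q)

theorem Det.bind {f : A → Prog A' T'} {g : T → T'} (hf : ∀ a, (f a).Det) {P : Prog A T}
    (hP : P.Det) : (P.bind f g).Det := by
  induction P with
  | skip => trivial
  | fail => trivial
  | act a => exact hf a
  | seq P Q ihP ihQ => exact ⟨ihP hP.1, ihQ hP.2⟩
  | branch t P Q ihP ihQ => exact ⟨ihP hP.1, ihQ hP.2⟩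
  | loop t P ih => exact ih hP
  | choice P Q => exact hP.elim

theorem Exec.ok {S : Sem A T σ} {P : Prog A T} {s s' : σ} {o : List Bool}
    (h : Exec S P s o s') (hs : S.ok s) : S.ok s' := by
  induction h with
  | skip s => exact hs
  | act a s h => exact h
  | seq h₁ h₂ ih₁ ih₂ => exact ih₂ (ih₁ hs)
  | branch_true ht h ih => exact ih hs
  | branch_false ht h ih => exact ih hs
  | loop_true ht h₁ h₂ ih₁ ih₂ => exact ih₂ (ih₁ hs)
  | loop_false ht => exact hs
  | choice_left h ih => exact ih hs
  | choice_right h ih => exact ih hs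

/-- `f` and `g` implement, on the states `e s`, the atomic commands in `pA` and the tests in
`pT`. -/
structure Implements (S : Sem A T σ) (S' : Sem A' T' τ) (e : σ → τ) (pA : A → Prop) (pT : T → Prop)
    (f : A → Prog A' T') (g : T → T') : Prop where
  exec : ∀ a s, pA a → S.ok s → S.ok (S.step a s) →
    Exec S' (f a) (e s) (S.out a s) (e (S.step a s))
  test : ∀ t s, pT t → (S'.test (g t) (e s) ↔ S.test t s)
  det : ∀ a, (f a).Det

variable {S : Sem A T σ} {S' : Sem A' T' τ} {e : σ → τ} {pA : A → Prop} {pT : T → Prop}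
  {f : A → Prog A' T'} {g : T → T'}

theorem Implements.bind_exec (H : Implements S S' e pA pT f g) {P : Prog A T} {s s' : σ}
    {o : List Bool} (h : Exec S P s o s') (hs : S.ok s) (hP : P.All pA pT) :
    Exec S' (P.bind f g) (e s) o (e s') := by
  induction h with
  | skip s => exact .skip _
  | act a s h => exact H.exec a s hP hs h
  | seq h₁ h₂ ih₁ ih₂ => exact .seq (ih₁ hs hP.1) (ih₂ (h₁.ok hs) hP.2)
  | branch_true ht h ih => exact .branch_true ((H.test _ _ hP.1).2 ht) (ih hs hP.2.1)
  | branch_false ht h ih => exact .branch_false (fun h => ht ((H.test _ _ hP.1).1 h)) (ih hs hP.2.2)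
  | loop_true ht h₁ h₂ ih₁ ih₂ =>
    exact .loop_true ((H.test _ _ hP.1).2 ht) (ih₁ hs hP.2) (ih₂ (h₁.ok hs) hP)
  | loop_false ht => exact .loop_false (fun h => ht ((H.test _ _ hP.1).1 h))
  | choice_left h ih => exact .choice_left (ih hs hP.1)
  | choice_right h ih => exact .choice_right (ih hs hP.2)

/-- The invariant of a translated loop is the image under `e` of the original invariant.
Intermediate states inside a translated command need no invariant, because each such command is
deterministic and ends in a state of the form `e s`. -/
theorem Implements.bind_wlp (H : Implements S S' e pA pT f g) {P : Prog A T} {s : σ}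
    {Q : σ → Prop} {Q' : τ → Prop} (h : wlp S P Q s) (hs : S.ok s) (hP : P.All pA pT)
    (hQ : ∀ s, S.ok s → Q s → Q' (e s)) : wlp S' (P.bind f g) Q' (e s) := by
  induction P generalizing s Q Q' with
  | skip => exact hQ s hs h
  | fail => trivial
  | act a => exact wlp_of_exec (H.exec a s hP hs h.1) (H.det a) (hQ _ h.1 h.2)
  | seq P R ihP ihR =>
    exact ihP h hs hP.1 (fun s' hs' h' => ihR h' hs' hP.2 hQ)
  | branch t P R ihP ihR =>
    exact ⟨fun ht => ihP (h.1 ((H.test _ _ hP.1).1 ht)) hs hP.2.1 hQ,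
      fun ht => ihR (h.2 fun h => ht ((H.test _ _ hP.1).2 h)) hs hP.2.2 hQ⟩
  | loop t P ih =>
    obtain ⟨I, hI, h⟩ := h
    refine ⟨fun m => ∃ s, m = e s ∧ S.ok s ∧ I s, ⟨s, rfl, hs, hI⟩, ?_⟩
    rintro _ ⟨s, rfl, hs, hI⟩
    refine ⟨fun ht => ih ((h s hI).1 ((H.test _ _ hP.1).1 ht)) hs hP.2 ?_,
      fun ht => hQ s hs ((h s hI).2 fun h => ht ((H.test _ _ hP.1).2 h))⟩
    exact fun s' hs' hI' => ⟨s', rfl, hs', hI'⟩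
  | choice P R ihP ihR => exact ⟨ihP h.1 hs hP.1 hQ, ihR h.2 hs hP.2 hQ⟩

/-! ### Compilation to Turing machines -/

/-- The continuations reachable from `P :: K` before `K` is reached. -/
def conts : Prog A T → List (Prog A T) → Set (List (Prog A T))
  | skip, K => {skip :: K}
  | fail, K => {fail :: K}
  | act a, K => {act a :: K}
  | seq P Q, K => {seq P Q :: K} ∪ conts P (Q :: K) ∪ conts Q K
  | branch t P Q, K => {branch t P Q :: K} ∪ conts P K ∪ conts Q K
  | loop t P, K => {loop t P :: K} ∪ conts P (loop t P :: K)
  | choice P Q, K => {choice P Q :: K} ∪ conts P K ∪ conts Q K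

theorem finite_conts (P : Prog A T) (K : List (Prog A T)) : (conts P K).Finite := by
  induction P generalizing K with
  | skip | fail | act => exact Set.finite_singleton _
  | seq P Q ihP ihQ => exact ((Set.finite_singleton _).union (ihP _)).union (ihQ _)
  | branch t P Q ihP ihQ => exact ((Set.finite_singleton _).union (ihP _)).union (ihQ _)
  | loop t P ih => exact (Set.finite_singleton _).union (ih _)
  | choice P Q ihP ihQ => exact ((Set.finite_singleton _).union (ihP _)).union (ihQ _)

theorem mem_conts_self (P : Prog A T) (K : List (Prog A T)) : P :: K ∈ conts P K := by
  cases P <;> simp [conts]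

/-- The control flow between continuations. -/
inductive Next : List (Prog A T) → List (Prog A T) → Prop
  | skip {K} : Next (skip :: K) K
  | act {a K} : Next (act a :: K) K
  | seq {P Q K} : Next (seq P Q :: K) (P :: Q :: K)
  | branch_left {t P Q K} : Next (branch t P Q :: K) (P :: K)
  | branch_right {t P Q K} : Next (branch t P Q :: K) (Q :: K)
  | loop_true {t P K} : Next (loop t P :: K) (P :: loop t P :: K)
  | loop_false {t P K} : Next (loop t P :: K) K
  | choice_left {P Q K} : Next (choice P Q :: K) (P :: K)
  | choice_right {P Q K} : Next (choice P Q :: K) (Q :: K)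

/-- Control flow leaves `conts P K` only by falling through to `K`. Together with `finite_conts`,
this lets continuations serve as the finitely many states of a machine. -/
theorem next_mem_conts {P : Prog A T} {K L L' : List (Prog A T)} (h : L ∈ conts P K)
    (hn : Next L L') : L' ∈ conts P K ∨ L' = K := by
  induction P generalizing K with
  | skip => obtain rfl : L = _ := h; cases hn; exact .inr rfl
  | fail => obtain rfl : L = _ := h; cases hn
  | act => obtain rfl : L = _ := h; cases hn; exact .inr rfl
  | seq P Q ihP ihQ =>
    rcases h with (rfl | h) | h
    · cases hn
      exact .inl (.inl (.inr (mem_conts_self _ _)))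
    · rcases ihP h with h | rfl
      · exact .inl (.inl (.inr h))
      · exact .inl (.inr (mem_conts_self _ _))
    · exact (ihQ h).imp_left .inr
  | branch t P Q ihP ihQ =>
    rcases h with (rfl | h) | h
    · cases hn
      · exact .inl (.inl (.inr (mem_conts_self _ _)))
      · exact .inl (.inr (mem_conts_self _ _))
    · exact (ihP h).imp_left fun h => .inl (.inr h)
    · exact (ihQ h).imp_left .inr
  | loop t P ih =>
    rcases h with rfl | h
    · cases hn
      · exact .inl (.inr (mem_conts_self _ _))
      · exact .inr rfl
    · rcases ih h with h | rfl
      · exact .inl (.inr h)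
      · exact .inl (mem_conts_self _ _)
  | choice P Q ihP ihQ =>
    rcases h with (rfl | h) | h
    · cases hn
      · exact .inl (.inl (.inr (mem_conts_self _ _)))
      · exact .inl (.inr (mem_conts_self _ _))
    · exact (ihP h).imp_left fun h => .inl (.inr h)
    · exact (ihQ h).imp_left .inr

end Prog

/-- An atomic command of a Turing machine program: an action without a control state which
depends on the scanned symbols. -/
abbrev TapeCmd (Sym : Type) (k : ℕ) : Type := InputSym → (Fin k → Sym) → Action Unit Sym k

/-- A test of the scanned symbols. -/
abbrev TapeTest (Sym : Type) (k : ℕ) : Type := InputSym → (Fin k → Sym) → Prop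

/-- The contents of the work tapes and the positions of all heads. -/
@[ext]
structure Mem (Sym : Type) (k : ℕ) where
  inPos : ℕ
  tape : Fin k → ℕ → Sym
  head : Fin k → ℕ

namespace Mem

variable {Sym : Type} {k : ℕ}

/-- The effect of an action. -/
def perform {State : Type} (w : List Bool) (m : Mem Sym k) (a : Action State Sym k) :
    Mem Sym k where
  inPos := min (a.inMove.apply m.inPos) (w.length + 1)
  tape := fun i => Function.update (m.tape i) (m.head i) (a.write i)
  head := fun i => (a.move i).apply (m.head i)

/-- The scanned input symbol. -/
def input (w : List Bool) (m : Mem Sym k) : InputSym := Machine.readInput w m.inPos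

/-- The scanned work symbols. -/
def scan (m : Mem Sym k) : Fin k → Sym := fun i => m.tape i (m.head i)

end Mem

/-- Turing machine programs on input `w`, where the work heads have to stay on the first `b`
cells. -/
def tapeSem (Sym : Type) (k : ℕ) (w : List Bool) (b : ℕ) :
    Sem (TapeCmd Sym k) (TapeTest Sym k) (Mem Sym k) where
  step a m := m.perform w (a (m.input w) m.scan)
  out a m := (a (m.input w) m.scan).out
  test t m := t (m.input w) m.scan
  ok m := ∀ i, m.head i < b

/-- Turing machine programs. -/
abbrev TapeProg (Sym : Type) (k : ℕ) : Type := Prog (TapeCmd Sym k) (TapeTest Sym k)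

namespace TapeProg

variable {Sym : Type} {k : ℕ}

open Prog

/-- The action which changes the control state only. -/
def stay {State : Type} (q : State) (s : Fin k → Sym) : Action State Sym k :=
  ⟨q, .stay, s, fun _ => .stay, []⟩

/-- A tape command together with a new control state. -/
def go {State : Type} (q : State) (a : Action Unit Sym k) : Action State Sym k :=
  ⟨q, a.inMove, a.write, a.move, a.out⟩

/-- The actions of the machine that runs the programs on the stack one after another. -/
def next (c : InputSym) (s : Fin k → Sym) :
    List (TapeProg Sym k) → Set (Action (List (TapeProg Sym k)) Sym k)
  | [] => ∅
  | skip :: K => {stay K s}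
  | fail :: _ => ∅
  | act a :: K => {go K (a c s)}
  | seq P Q :: K => {stay (P :: Q :: K) s}
  | branch t P Q :: K => {x | (t c s ∧ x = stay (P :: K) s) ∨ (¬ t c s ∧ x = stay (Q :: K) s)}
  | loop t P :: K => {x | (t c s ∧ x = stay (P :: loop t P :: K) s) ∨ (¬ t c s ∧ x = stay K s)}
  | choice P Q :: K => {stay (P :: K) s, stay (Q :: K) s}

theorem finite_next (c : InputSym) (s : Fin k → Sym) (K : List (TapeProg Sym k)) :
    (next c s K).Finite := by
  have h2 : ∀ x y : Action (List (TapeProg Sym k)) Sym k, ∀ p q : Prop,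
      {z | (p ∧ z = x) ∨ (q ∧ z = y)}.Finite := fun x y p q =>
    (Set.toFinite {x, y}).subset (by rintro z (⟨-, rfl⟩ | ⟨-, rfl⟩) <;> simp)
  match K with
  | [] | fail :: _ => exact Set.finite_empty
  | skip :: K | act a :: K | seq P Q :: K => exact Set.finite_singleton _
  | branch t P Q :: K | loop t P :: K => exact h2 _ _ _ _
  | choice P Q :: K => exact (Set.finite_singleton _).insert _

/-- The control states of the machine for `P`. -/
abbrev Control (P : TapeProg Sym k) : Type := {K // K ∈ conts P [] ∪ {[]}}

/-- Forget that the new continuation is one of the control states. -/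
def forget {P : TapeProg Sym k} (a : Action (Control P) Sym k) :
    Action (List (TapeProg Sym k)) Sym k :=
  ⟨a.state.1, a.inMove, a.write, a.move, a.out⟩

theorem forget_injective {P : TapeProg Sym k} :
    Function.Injective (forget : Action (Control P) Sym k → _) := by
  rintro ⟨⟨q, hq⟩, _, _, _, _⟩ ⟨⟨q', hq'⟩, _, _, _, _⟩ h
  simp only [forget, Action.mk.injEq] at h
  obtain ⟨rfl, rfl, rfl, rfl, rfl⟩ := h
  rfl

/-- The Turing machine which runs the program `P` and accepts when `P` terminates. -/
noncomputable def machine [Finite Sym] (blank : Sym) (P : TapeProg Sym k) : Machine where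
  State := Control P
  Sym := Sym
  finite_state := ((finite_conts P []).union (Set.finite_singleton _)).to_subtype
  finite_sym := inferInstance
  tapes := k
  blank := blank
  start := ⟨[P], .inl (mem_conts_self _ _)⟩
  accept := ⟨[], .inr rfl⟩
  -- Actions whose continuation is not a control state are discarded here; by `next_mem_conts` there
  -- are none.
  trans q c s := forget ⁻¹' next c s q.1
  finite_trans q c s := (finite_next c s q.1).preimage forget_injective.injOn

theorem perform_stay {State : Type} {w : List Bool} (m : Mem Sym k) (q : State)
    (hm : m.inPos ≤ w.length + 1) :
    m.perform w (stay q m.scan) = m := by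
  simp [Mem.perform, stay, Mem.scan, Move.apply, hm]

/-- `wlp` for continuations. -/
def wlps (S : Sem (TapeCmd Sym k) (TapeTest Sym k) (Mem Sym k)) (Q : Mem Sym k → Prop) :
    List (TapeProg Sym k) → Mem Sym k → Prop
  | [] => Q
  | P :: K => wlp S P (wlps S Q K)

theorem wlps_next {w : List Bool} {b : ℕ} {Q : Mem Sym k → Prop} {K : List (TapeProg Sym k)} {m : Mem Sym k}
    (hm : m.inPos ≤ w.length + 1) (hok : ∀ i, m.head i < b)
    (h : wlps (tapeSem Sym k w b) Q K m) {a : Action (List (TapeProg Sym k)) Sym k}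
    (ha : a ∈ next (m.input w) m.scan K) :
    wlps (tapeSem Sym k w b) Q a.state (m.perform w a) ∧ ∀ i, (m.perform w a).head i < b := by
  match K, ha with
  | skip :: K, ha =>
    obtain rfl : a = _ := ha
    rw [perform_stay m _ hm]
    exact ⟨h, hok⟩
  | act a :: K, ha =>
    obtain rfl := ha
    exact ⟨h.2, h.1⟩
  | seq P Q :: K, ha =>
    obtain rfl : a = _ := ha
    rw [perform_stay m _ hm]
    exact ⟨h, hok⟩
  | branch t P Q :: K, ha =>
    rcases ha with ⟨ht, rfl⟩ | ⟨ht, rfl⟩ <;> rw [perform_stay m _ hm]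
    · exact ⟨h.1 ht, hok⟩
    · exact ⟨h.2 ht, hok⟩
  | loop t P :: K, ha =>
    have h' := (wlp_loop_iff _ _ _ _ _).1 h
    rcases ha with ⟨ht, rfl⟩ | ⟨ht, rfl⟩ <;> rw [perform_stay m _ hm]
    · exact ⟨h'.1 ht, hok⟩
    · exact ⟨h'.2 ht, hok⟩
  | choice P Q :: K, ha =>
    rcases ha with rfl | rfl <;> rw [perform_stay m _ hm]
    · exact ⟨h.1, hok⟩
    · exact ⟨h.2, hok⟩

section

variable [Finite Sym] {blank : Sym} {P : TapeProg Sym k} {w : List Bool} {b : ℕ}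

/-- The memory part of a configuration. -/
def mem (c : (machine blank P).Cfg) : Mem Sym k := ⟨c.inPos, c.tape, c.head⟩

/-- The configuration with a given continuation and memory. -/
def cfg (K : Control P) (m : Mem Sym k) : (machine blank P).Cfg := ⟨K, m.inPos, m.tape, m.head⟩

/-- The initial memory. -/
def initMem (blank : Sym) : Mem Sym k := ⟨0, fun _ _ => blank, fun _ => 0⟩

/-- The invariant of all computations: the memory satisfies the weakest precondition of the
remaining stack. It yields the space bound at every configuration and the postcondition once the
stack is empty. -/
theorem run_wlps {Q : Mem Sym k → Prop} (hb : 0 < b)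
    (h : wlp (tapeSem Sym k w b) P Q (initMem blank)) {o : List Bool} {c : (machine blank P).Cfg}
    (hr : (machine blank P).Run w (machine blank P).init o c) :
    wlps (tapeSem Sym k w b) Q c.state.1 (mem c) ∧ (∀ i, c.head i < b) ∧
      c.inPos ≤ w.length + 1 := by
  generalize hc : (machine blank P).init = c₀ at hr
  induction hr with
  | refl => subst hc; exact ⟨h, fun i => hb, Nat.zero_le _⟩
  | @step c' o hr a ha ih =>
    obtain ⟨h1, h2, h3⟩ := ih
    obtain ⟨h4, h5⟩ := wlps_next (m := mem c') h3 h2 h1 ha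
    exact ⟨h4, h5, min_le_right _ _⟩

theorem exec_run {R : TapeProg Sym k} {m m' : Mem Sym k} {o : List Bool}
    (h : Exec (tapeSem Sym k w b) R m o m') (hm : m.inPos ≤ w.length + 1) (K : List (TapeProg Sym k))
    (hR : R :: K ∈ conts P [] ∪ {[]}) :
    m'.inPos ≤ w.length + 1 ∧ ∃ hK : K ∈ conts P [] ∪ {[]}, ∀ c₀ o₀,
      (machine blank P).Run w c₀ o₀ (cfg ⟨_, hR⟩ m) →
      (machine blank P).Run w c₀ (o₀ ++ o) (cfg ⟨K, hK⟩ m') := by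
  have key : ∀ {L L' : List (TapeProg Sym k)} (_ : Next L L') (_ : L ∈ conts P [] ∪ {[]}),
      L' ∈ conts P [] ∪ {[]} := by
    intro L L' hn hL
    rcases hL with hL | hL
    · exact next_mem_conts hL hn
    · obtain rfl : L = [] := hL
      cases hn
  -- Control steps leave the memory unchanged and write nothing.
  have jump : ∀ {L L' : List (TapeProg Sym k)} {m : Mem Sym k} (_ : m.inPos ≤ w.length + 1)
      (_ : stay L' m.scan ∈ next (m.input w) m.scan L)
      (hL : L ∈ conts P [] ∪ {[]}) (hL' : L' ∈ conts P [] ∪ {[]}), ∀ c₀ o₀,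
      (machine blank P).Run w c₀ o₀ (cfg ⟨_, hL⟩ m) →
      (machine blank P).Run w c₀ o₀ (cfg ⟨L', hL'⟩ m) := by
    intro L L' m hm hn hL hL' c₀ o₀ hr
    have h : (machine blank P).Run w c₀ (o₀ ++ [])
        (cfg ⟨L', hL'⟩ (m.perform w (stay (⟨L', hL'⟩ : Control P) m.scan))) :=
      Machine.Run.step hr (stay (⟨L', hL'⟩ : Control P) m.scan) hn
    rwa [perform_stay _ _ hm, List.append_nil] at h
  induction h generalizing K with
  | skip s =>
    have hK := key .skip hR
    exact ⟨hm, hK, fun c₀ o₀ hr => by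
      rw [List.append_nil]; exact jump hm (by simp [next]) hR hK c₀ o₀ hr⟩
  | act a s h =>
    have hK := key .act hR
    refine ⟨min_le_right _ _, hK, fun c₀ o₀ hr => ?_⟩
    exact Machine.Run.step hr (go (⟨K, hK⟩ : Control P) (a (s.input w) s.scan)) rfl
  | @seq P₁ P₂ s o s₁ o' s₂ h₁ h₂ ih₁ ih₂ =>
    have hK := key .seq hR
    obtain ⟨hm₁, hK₁, hr₁⟩ := ih₁ hm _ hK
    obtain ⟨hm₂, hK₂, hr₂⟩ := ih₂ hm₁ _ hK₁
    refine ⟨hm₂, hK₂, fun c₀ o₀ hr => ?_⟩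
    rw [← List.append_assoc]
    exact hr₂ _ _ (hr₁ _ _ (jump hm (by simp [next]) hR hK c₀ o₀ hr))
  | @branch_true t P₁ P₂ s o s' ht h ih =>
    have hK := key .branch_left hR
    obtain ⟨hm₁, hK₁, hr₁⟩ := ih hm _ hK
    exact ⟨hm₁, hK₁, fun c₀ o₀ hr => hr₁ _ _ (jump hm (by exact Or.inl ⟨ht, rfl⟩) hR hK c₀ o₀ hr)⟩
  | @branch_false t P₁ P₂ s o s' ht h ih =>
    have hK := key .branch_right hR
    obtain ⟨hm₁, hK₁, hr₁⟩ := ih hm _ hK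
    exact ⟨hm₁, hK₁, fun c₀ o₀ hr => hr₁ _ _ (jump hm (by exact Or.inr ⟨ht, rfl⟩) hR hK c₀ o₀ hr)⟩
  | @loop_true t P₁ s o s₁ o' s₂ ht h₁ h₂ ih₁ ih₂ =>
    have hK := key .loop_true hR
    obtain ⟨hm₁, hK₁, hr₁⟩ := ih₁ hm _ hK
    obtain ⟨hm₂, hK₂, hr₂⟩ := ih₂ hm₁ _ hK₁
    refine ⟨hm₂, hK₂, fun c₀ o₀ hr => ?_⟩
    rw [← List.append_assoc]
    exact hr₂ _ _ (hr₁ _ _ (jump hm (by exact Or.inl ⟨ht, rfl⟩) hR hK c₀ o₀ hr))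
  | @loop_false t P₁ s ht =>
    have hK := key .loop_false hR
    exact ⟨hm, hK, fun c₀ o₀ hr => by
      rw [List.append_nil]; exact jump hm (by exact Or.inr ⟨ht, rfl⟩) hR hK c₀ o₀ hr⟩
  | @choice_left P₁ P₂ s o s' h ih =>
    have hK := key .choice_left hR
    obtain ⟨hm₁, hK₁, hr₁⟩ := ih hm _ hK
    exact ⟨hm₁, hK₁, fun c₀ o₀ hr => hr₁ _ _ (jump hm (by exact Or.inl rfl) hR hK c₀ o₀ hr)⟩
  | @choice_right P₁ P₂ s o s' h ih =>
    have hK := key .choice_right hR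
    obtain ⟨hm₁, hK₁, hr₁⟩ := ih hm _ hK
    exact ⟨hm₁, hK₁, fun c₀ o₀ hr => hr₁ _ _ (jump hm (by exact Or.inr rfl) hR hK c₀ o₀ hr)⟩

theorem exec_run_init {m : Mem Sym k} {o : List Bool}
    (h : Exec (tapeSem Sym k w b) P (initMem blank) o m) :
    (machine blank P).Run w (machine blank P).init o (cfg ⟨[], .inr rfl⟩ m) := by
  obtain ⟨-, _, hr⟩ := exec_run (blank := blank) (P := P) h (Nat.zero_le _) []
    (.inl (mem_conts_self _ _))
  exact hr _ _ (.refl _)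

/-- Safe programs give logarithmic-space machines. -/
theorem machine_logSpace (K : ℕ)
    (h : ∀ w : List Bool, 0 < K * (Nat.log 2 w.length + 1) ∧
      ∃ Q, wlp (tapeSem Sym k w (K * (Nat.log 2 w.length + 1))) P Q (initMem blank)) :
    (machine blank P).LogSpace := by
  refine ⟨K, fun w o c hr i => ?_⟩
  obtain ⟨hb, Q, hQ⟩ := h w
  exact (run_wlps hb hQ hr).2.1 i

/-- Soundness comes from `wlp`, since every computation that reaches the empty stack satisfies `Q`.
Completeness comes from one execution. -/
theorem machine_accepts (hb : 0 < b) {Q : Prop}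
    (h : wlp (tapeSem Sym k w b) P (fun _ => Q) (initMem blank))
    (h' : Q → ∃ o m, Exec (tapeSem Sym k w b) P (initMem blank) o m) :
    (machine blank P).Accepts w ↔ Q := by
  constructor
  · rintro ⟨o, c, hr, hc⟩
    have := (run_wlps hb h hr).1
    rw [hc] at this
    exact this
  · intro hQ
    obtain ⟨o, m, hm⟩ := h' hQ
    exact ⟨o, _, exec_run_init hm, rfl⟩

theorem det_conts {A T : Type} {P : Prog A T} (hP : P.Det) {K : List (Prog A T)}
    (hK : ∀ R ∈ K, R.Det) :
    ∀ L ∈ conts P K, ∀ R ∈ L, R.Det := by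
  induction P generalizing K with
  | skip | fail | act => rintro L rfl; simpa [Det] using hK
  | seq P Q ihP ihQ =>
    rintro L ((rfl | h) | h)
    · simpa [hP] using hK
    · exact ihP hP.1 (by simpa [hP.2] using hK) L h
    · exact ihQ hP.2 hK L h
  | branch t P Q ihP ihQ =>
    rintro L ((rfl | h) | h)
    · simpa [hP] using hK
    · exact ihP hP.1 hK L h
    · exact ihQ hP.2 hK L h
  | loop t P ih =>
    rintro L (rfl | h)
    · simpa [hP] using hK
    · exact ih hP (by simpa [hP] using hK) L h
  | choice => exact hP.elim

theorem machine_deterministic (hP : P.Det) : (machine blank P).Deterministic := by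
  rintro ⟨L, hL⟩ c s a ha a' ha'
  have hdet : ∀ R ∈ L, R.Det := by
    rcases hL with hL | hL
    · exact det_conts hP (by simp) L hL
    · obtain rfl : L = [] := hL
      simp
  have heq : ∀ x ∈ next c s L, ∀ y ∈ next c s L, x = y := by
    match L, hdet with
    | [], _ | fail :: _, _ => exact fun x hx => hx.elim
    | skip :: K, _ | act a :: K, _ | seq P Q :: K, _ => rintro x rfl y rfl; rfl
    | branch t P Q :: K, _ =>
      rintro x (⟨h, rfl⟩ | ⟨h, rfl⟩) y (⟨h', rfl⟩ | ⟨h', rfl⟩) <;> first | rfl | contradiction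
    | loop t P :: K, _ =>
      rintro x (⟨h, rfl⟩ | ⟨h, rfl⟩) y (⟨h', rfl⟩ | ⟨h', rfl⟩) <;> first | rfl | contradiction
    | choice P Q :: K, hd => exact (hd _ List.mem_cons_self).elim
  exact forget_injective (heq _ ha _ ha')

/-- Deterministic programs which terminate within logarithmic space give transducers. -/
theorem logSpaceComputable (hP : P.Det) (f : List Bool → List Bool) (K : ℕ)
    (h : ∀ w : List Bool, 0 < K * (Nat.log 2 w.length + 1) ∧
      ∃ m, Exec (tapeSem Sym k w (K * (Nat.log 2 w.length + 1))) P (initMem blank) (f w) m) :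
    LogSpaceComputable f := by
  refine ⟨machine blank P, machine_deterministic hP, machine_logSpace K fun w => ?_, fun w => ?_⟩
  · obtain ⟨hb, m, hm⟩ := h w
    exact ⟨hb, fun _ => True, wlp_of_exec hm hP trivial⟩
  · obtain ⟨hb, m, hm⟩ := h w
    refine ⟨_, exec_run_init hm, ?_⟩
    ext a
    simp only [Set.mem_empty_iff_false, iff_false]
    exact fun ha => ha

end

end TapeProg

end CayleyNL

namespace CayleyNL

/-! ### Register programs -/

/-- Commands on registers and on the input head. -/
inductive RegCmd where
  | inc (r : ℕ) : RegCmd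
  | dec (r : ℕ) : RegCmd
  | left : RegCmd
  | right : RegCmd
  | out (b : Bool) : RegCmd

/-- Tests of registers and of the scanned input symbol. -/
inductive RegTest where
  | nonzero (r : ℕ) : RegTest
  | notLeftEnd : RegTest
  | notRightEnd : RegTest
  | isOne : RegTest

/-- Register contents and the position of the input head. -/
structure RegState where
  reg : ℕ → ℕ
  pos : ℕ

/-- Register programs on input `w` with register contents at most `B`. -/
def regSem (w : List Bool) (B : ℕ) : Sem RegCmd RegTest RegState where
  step
    | .inc r, s => ⟨Function.update s.reg r (s.reg r + 1), s.pos⟩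
    | .dec r, s => ⟨Function.update s.reg r (s.reg r - 1), s.pos⟩
    | .left, s => ⟨s.reg, s.pos - 1⟩
    | .right, s => ⟨s.reg, min (s.pos + 1) (w.length + 1)⟩
    | .out _, s => s
  out
    | .out b, _ => [b]
    | _, _ => []
  test
    | .nonzero r, s => s.reg r ≠ 0
    | .notLeftEnd, s => Machine.readInput w s.pos ≠ .leftEnd
    | .notRightEnd, s => Machine.readInput w s.pos ≠ .rightEnd
    | .isOne, s => Machine.readInput w s.pos = .bit true
  ok s := (∀ r, s.reg r ≤ B) ∧ s.pos ≤ w.length + 1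

abbrev RegProg : Type := Prog RegCmd RegTest

/-- The command uses registers below `k` only. -/
def RegCmd.Below (k : ℕ) : RegCmd → Prop
  | .inc r => r < k
  | .dec r => r < k
  | _ => True

/-- The test uses registers below `k` only. -/
def RegTest.Below (k : ℕ) : RegTest → Prop
  | .nonzero r => r < k
  | _ => True

theorem RegCmd.exists_below (a : RegCmd) : ∃ k, ∀ l, k ≤ l → a.Below l := by
  cases a with
  | inc r => exact ⟨r + 1, fun l h => h⟩
  | dec r => exact ⟨r + 1, fun l h => h⟩
  | left | right | out => exact ⟨0, fun _ _ => trivial⟩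

theorem RegTest.exists_below (t : RegTest) : ∃ k, ∀ l, k ≤ l → t.Below l := by
  cases t with
  | nonzero r => exact ⟨r + 1, fun l h => h⟩
  | _ => exact ⟨0, fun _ _ => trivial⟩

/-- A program mentions finitely many registers, so a fixed number of tapes can hold them. -/
theorem RegProg.exists_below (P : RegProg) :
    ∃ k, ∀ l, k ≤ l → P.All (RegCmd.Below l) (RegTest.Below l) := by
  induction P with
  | skip | fail => exact ⟨0, fun _ _ => trivial⟩
  | act a => exact a.exists_below
  | seq P Q ihP ihQ | choice P Q ihP ihQ =>
    obtain ⟨k, hk⟩ := ihP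
    obtain ⟨l, hl⟩ := ihQ
    exact ⟨max k l, fun m hm => ⟨hk m (le_of_max_le_left hm), hl m (le_of_max_le_right hm)⟩⟩
  | branch t P Q ihP ihQ =>
    obtain ⟨j, hj⟩ := t.exists_below
    obtain ⟨k, hk⟩ := ihP
    obtain ⟨l, hl⟩ := ihQ
    exact ⟨max j (max k l), fun m hm => ⟨hj m (by omega), hk m (by omega), hl m (by omega)⟩⟩
  | loop t P ih =>
    obtain ⟨j, hj⟩ := t.exists_below
    obtain ⟨k, hk⟩ := ih
    exact ⟨max j k, fun m hm => ⟨hj m (by omega), hk m (by omega)⟩⟩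

/-! ### Registers on tapes -/

/-- Tape symbols: blank, the mark at the left end, and the two digits. -/
abbrev Cell : Type := Option (Option Bool)

namespace Cell

abbrev blank : Cell := none
abbrev mark : Cell := some none
abbrev one : Cell := some (some false)
abbrev two : Cell := some (some true)

end Cell

/-- The bijective binary representation, least significant digit first. -/
def bijDigits : ℕ → List Cell
  | 0 => []
  | v + 1 => (if v % 2 = 0 then Cell.one else Cell.two) :: bijDigits (v / 2)
decreasing_by omega

@[simp] theorem bijDigits_zero : bijDigits 0 = [] := by rw [bijDigits]

theorem bijDigits_odd (u : ℕ) : bijDigits (2 * u + 1) = Cell.one :: bijDigits u := by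
  rw [bijDigits]; simp

theorem bijDigits_even (u : ℕ) : bijDigits (2 * u + 2) = Cell.two :: bijDigits u := by
  rw [bijDigits, if_neg (by omega), show (2 * u + 1) / 2 = u by omega]

theorem bij_cases (v : ℕ) : v = 0 ∨ ∃ u < v, v = 2 * u + 1 ∨ v = 2 * u + 2 := by
  rcases Nat.eq_zero_or_pos v with h | h
  · exact .inl h
  · exact .inr ⟨(v - 1) / 2, by omega, by omega⟩

/-- The least number with `ℓ` digits has all digits equal to one and is `2 ^ ℓ - 1`. -/
theorem two_pow_length_bijDigits (v : ℕ) : 2 ^ (bijDigits v).length ≤ v + 1 := by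
  induction v using Nat.strong_induction_on with
  | _ v ih =>
    rcases bij_cases v with rfl | ⟨u, hu, rfl | rfl⟩
    · simp
    · have := ih u hu
      rw [bijDigits_odd, List.length_cons, pow_succ]; omega
    · have := ih u hu
      rw [bijDigits_even, List.length_cons, pow_succ]; omega

theorem mark_notMem_bijDigits (v : ℕ) : Cell.mark ∉ bijDigits v := by
  induction v using Nat.strong_induction_on with
  | _ v ih =>
    rcases bij_cases v with rfl | ⟨u, hu, rfl | rfl⟩
    · simp
    · simpa [bijDigits_odd] using ih u hu
    · simpa [bijDigits_even] using ih u hu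

/-- The tape whose first cells contain a given list. -/
def listTape (l : List Cell) : ℕ → Cell := fun j => l.getD j Cell.blank

theorem listTape_at (pre : List Cell) (x : Cell) (l : List Cell) :
    listTape (pre ++ x :: l) pre.length = x := by simp [listTape]

theorem listTape_end (pre : List Cell) : listTape pre pre.length = Cell.blank := by
  simp [listTape]

theorem update_listTape (pre : List Cell) (x y : Cell) (l : List Cell) :
    Function.update (listTape (pre ++ x :: l)) pre.length y = listTape (pre ++ y :: l) := by
  funext j
  rcases lt_trichotomy j pre.length with h | rfl | h
  · simp [listTape, h.ne, List.getElem?_append_left h]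
  · simp [listTape]
  · obtain ⟨i, rfl⟩ := Nat.exists_eq_add_of_lt h
    simp [listTape, h.ne', List.getElem?_append_right h.le, show pre.length + i + 1 - pre.length = i + 1 by omega]

theorem update_listTape_end (pre : List Cell) (y : Cell) :
    Function.update (listTape pre) pre.length y = listTape (pre ++ [y]) := by
  funext j
  rcases lt_trichotomy j pre.length with h | rfl | h
  · simp [listTape, h.ne, List.getElem?_append_left h]
  · simp [listTape]
  · obtain ⟨i, rfl⟩ := Nat.exists_eq_add_of_lt h
    simp [listTape, h.ne', List.getElem?_eq_none h.le]

theorem update_listTape_erase (pre : List Cell) (x : Cell) :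
    Function.update (listTape (pre ++ [x])) pre.length Cell.blank = listTape pre := by
  funext j
  rcases lt_trichotomy j pre.length with h | rfl | h
  · simp [listTape, h.ne, List.getElem?_append_left h]
  · simp [listTape]
  · obtain ⟨i, rfl⟩ := Nat.exists_eq_add_of_lt h
    simp [listTape, h.ne', List.getElem?_eq_none h.le]

/-- Keeps a loop and the program after it together in inductions, because the place where a carry or
a rewind stops is only found by running the loop. -/
theorem Prog.Exec.seq_loop_true {A T σ : Type} {S : Sem A T σ} {t : T} {P Q : Prog A T}
    {s s₁ s₂ : σ} (ht : S.test t s) (h₁ : Exec S P s [] s₁)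
    (h₂ : Exec S (.seq (.loop t P) Q) s₁ [] s₂) : Exec S (.seq (.loop t P) Q) s [] s₂ := by
  generalize ho : ([] : List Bool) = o at h₂
  cases h₂ with
  | seq h h' => exact .seq (.loop_true (o := []) ht h₁ h) h'

theorem Prog.Exec.seq_nil {A T σ : Type} {S : Sem A T σ} {P Q : Prog A T}
    {s s₁ s₂ : σ} {o : List Bool} (h₁ : Exec S P s [] s₁) (h₂ : Exec S Q s₁ o s₂) :
    Exec S (.seq P Q) s o s₂ :=
  .seq (o := []) h₁ h₂

section TapePrograms

open Prog

variable {k : ℕ}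

/-- Replace the contents and the head position of one tape. -/
def Mem.setTape (m : Mem Cell k) (r : Fin k) (T : ℕ → Cell) (h : ℕ) : Mem Cell k where
  inPos := m.inPos
  tape := Function.update m.tape r T
  head := Function.update m.head r h

/-- Rewrite the scanned symbol of one tape and move its head. -/
def tapeAct (r : Fin k) (g : Cell → Cell) (mv : Move) : TapeCmd Cell k := fun _ s =>
  ⟨(), .stay, Function.update s r (g (s r)), Function.update (fun _ => .stay) r mv, []⟩

/-- Move the head of a tape to the cell next to the mark. -/
def rewindProg (r : Fin k) : TapeProg Cell k :=
  .seq (.loop (fun _ s => s r ≠ Cell.mark) (.act (tapeAct r id .left))) (.act (tapeAct r id .right))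

/-- Increment a number in bijective binary representation. -/
def incProg (r : Fin k) : TapeProg Cell k :=
  .seq (.seq (.loop (fun _ s => s r = Cell.two) (.act (tapeAct r (fun _ => Cell.one) .right)))
    (.branch (fun _ s => s r = Cell.one) (.act (tapeAct r (fun _ => Cell.two) .stay))
      (.act (tapeAct r (fun _ => Cell.one) .stay)))) (rewindProg r)

/-- Decrement a nonzero number in bijective binary representation. -/
def decProg (r : Fin k) : TapeProg Cell k :=
  .seq (.seq (.loop (fun _ s => s r = Cell.one) (.act (tapeAct r (fun _ => Cell.two) .right)))
    (.branch (fun _ s => s r = Cell.two) (.act (tapeAct r (fun _ => Cell.one) .stay))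
      (.seq (.act (tapeAct r id .left)) (.act (tapeAct r (fun _ => Cell.blank) .stay)))))
    (rewindProg r)

variable {w : List Bool} {b : ℕ} {m : Mem Cell k} {r : Fin k}

theorem exec_tapeAct (hm : m.inPos ≤ w.length + 1) (hb : ∀ i, m.head i < b)
    {T T' : ℕ → Cell} {h h' : ℕ} {g : Cell → Cell} {mv : Move} (hh : h' < b)
    (hT : Function.update T h (g (T h)) = T') (hmv : mv.apply h = h') :
    Exec (tapeSem Cell k w b) (.act (tapeAct r g mv)) (m.setTape r T h) [] (m.setTape r T' h') := by
  subst hT hmv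
  have e : (tapeSem Cell k w b).step (tapeAct r g mv) (m.setTape r T h) =
      m.setTape r (Function.update T h (g (T h))) (mv.apply h) := by
    refine Mem.ext ?_ ?_ ?_
    · simp [tapeSem, Mem.perform, tapeAct, Mem.setTape, Move.apply, hm]
    · funext i
      rcases eq_or_ne i r with rfl | hi
      · simp [tapeSem, Mem.perform, tapeAct, Mem.setTape, Mem.scan]
      · simp [tapeSem, Mem.perform, tapeAct, Mem.setTape, Mem.scan, hi]
    · funext i
      rcases eq_or_ne i r with rfl | hi
      · simp [tapeSem, Mem.perform, tapeAct, Mem.setTape]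
      · simp [tapeSem, Mem.perform, tapeAct, Mem.setTape, hi, Move.apply]
  rw [← e]
  refine Exec.act (S := tapeSem Cell k w b) _ _ ?_
  rw [e]
  intro i
  rcases eq_or_ne i r with rfl | hi
  · simpa [Mem.setTape] using hh
  · simpa [Mem.setTape, hi] using hb i

theorem scan_setTape (m : Mem Cell k) (r : Fin k) (T : ℕ → Cell) (h : ℕ) :
    (m.setTape r T h).scan r = T h := by simp [Mem.setTape, Mem.scan]

theorem exec_rewindProg (hm : m.inPos ≤ w.length + 1) (hb : ∀ i, m.head i < b) (h1 : 1 < b)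
    {T : ℕ → Cell} (hT0 : T 0 = Cell.mark) (hT : ∀ j, T (j + 1) ≠ Cell.mark) (h : ℕ) (hh : h < b) :
    Exec (tapeSem Cell k w b) (rewindProg r) (m.setTape r T h) [] (m.setTape r T 1) := by
  induction h with
  | zero =>
    refine .seq_nil (.loop_false ?_)
      (exec_tapeAct hm hb h1 (Function.update_eq_self _ _) rfl)
    show ¬ (m.setTape r T 0).scan r ≠ _
    rw [scan_setTape]; simpa using hT0
  | succ h ih =>
    refine .seq_loop_true ?_
      (exec_tapeAct hm hb (h' := h) (by omega) (Function.update_eq_self _ _) rfl) (ih (by omega))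
    show (m.setTape r T _).scan r ≠ _
    rw [scan_setTape]; exact hT h

theorem listTape_mark_ne (v j : ℕ) : listTape (Cell.mark :: bijDigits v) (j + 1) ≠ Cell.mark := by
  simp only [listTape, List.getD_cons_succ]
  rw [List.getD_eq_getElem?_getD]
  intro h
  rcases lt_or_ge j (bijDigits v).length with hj | hj
  · rw [List.getElem?_eq_getElem hj, Option.getD_some] at h
    exact mark_notMem_bijDigits v (h ▸ List.getElem_mem hj)
  · rw [List.getElem?_eq_none hj] at h
    cases h

theorem exec_rewind_bijDigits (hm : m.inPos ≤ w.length + 1) (hb : ∀ i, m.head i < b) (h1 : 1 < b)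
    (v h : ℕ) (hh : h < b) :
    Exec (tapeSem Cell k w b) (rewindProg r) (m.setTape r (listTape (Cell.mark :: bijDigits v)) h) []
      (m.setTape r (listTape (Cell.mark :: bijDigits v)) 1) :=
  exec_rewindProg hm hb h1 rfl (listTape_mark_ne v) h hh

/-- The carry turns initial twos into ones. It stops at a one, which becomes a two, or at the blank
after the number, where a new one is written. -/
theorem exec_incProg (hm : m.inPos ≤ w.length + 1) (hb : ∀ i, m.head i < b) (v : ℕ)
    (hv : 1 + (bijDigits v).length < b) :
    Exec (tapeSem Cell k w b) (incProg r)
      (m.setTape r (listTape (Cell.mark :: bijDigits v)) 1) []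
      (m.setTape r (listTape (Cell.mark :: bijDigits (v + 1))) 1) := by
  -- `pre` holds the mark and the digits already passed. The final head position stays unspecified
  -- because the head is rewound afterwards.
  have key : ∀ (v : ℕ) (pre : List Cell), pre.length + (bijDigits v).length < b → ∃ h < b,
      Exec (tapeSem Cell k w b) (.seq (.loop (fun _ s => s r = Cell.two)
          (.act (tapeAct r (fun _ => Cell.one) .right)))
        (.branch (fun _ s => s r = Cell.one) (.act (tapeAct r (fun _ => Cell.two) .stay))
          (.act (tapeAct r (fun _ => Cell.one) .stay))))
        (m.setTape r (listTape (pre ++ bijDigits v)) pre.length) []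
        (m.setTape r (listTape (pre ++ bijDigits (v + 1))) h) := by
    intro v
    induction v using Nat.strong_induction_on with
    | _ v ih =>
      intro pre hpre
      rcases bij_cases v with rfl | ⟨u, hu, rfl | rfl⟩
      · simp only [bijDigits_zero, List.length_nil, List.append_nil] at hpre ⊢
        refine ⟨pre.length, hpre, .seq_nil (.loop_false ?_) (.branch_false ?_
          (exec_tapeAct hm hb hpre ?_ rfl))⟩
        · show ¬ (m.setTape r _ _).scan r = _
          rw [scan_setTape, listTape_end]; simp
        · show ¬ (m.setTape r _ _).scan r = _
          rw [scan_setTape, listTape_end]; simp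
        · rw [update_listTape_end, show 0 + 1 = 2 * 0 + 1 from rfl, bijDigits_odd, bijDigits_zero]
      · rw [bijDigits_odd] at hpre ⊢
        refine ⟨pre.length, by omega, .seq_nil (.loop_false ?_) (.branch_true ?_
          (exec_tapeAct hm hb (by omega) ?_ rfl))⟩
        · show ¬ (m.setTape r _ _).scan r = _
          rw [scan_setTape, listTape_at]; simp
        · show (m.setTape r _ _).scan r = _
          rw [scan_setTape, listTape_at]
        · rw [update_listTape, bijDigits_even]
      · rw [bijDigits_even] at hpre ⊢
        obtain ⟨h, hh, hex⟩ := ih u hu (pre ++ [Cell.one]) (by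
          simp only [List.length_append, List.length_cons, List.length_nil] at hpre ⊢; omega)
        refine ⟨h, hh, .seq_loop_true ?_ (exec_tapeAct hm hb ?_ (update_listTape _ _ _ _) rfl) ?_⟩
        · show (m.setTape r _ _).scan r = _
          rw [scan_setTape, listTape_at]
        · simp only [List.length_cons, Move.apply] at hpre ⊢; omega
        · rw [show 2 * u + 2 + 1 = 2 * (u + 1) + 1 by ring, bijDigits_odd]
          simpa [Move.apply] using hex
  obtain ⟨h, hh, hex⟩ := key v [Cell.mark] hv
  exact .seq_nil hex (exec_rewind_bijDigits hm hb (by omega) _ _ hh)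

/-- The borrow turns initial ones into twos and stops at a two, which becomes a one. If it meets the
blank instead, all digits were ones and the number becomes one digit shorter. -/
theorem exec_decProg (hm : m.inPos ≤ w.length + 1) (hb : ∀ i, m.head i < b) (v : ℕ)
    (hv : 1 + (bijDigits (v + 1)).length < b) :
    Exec (tapeSem Cell k w b) (decProg r)
      (m.setTape r (listTape (Cell.mark :: bijDigits (v + 1))) 1) []
      (m.setTape r (listTape (Cell.mark :: bijDigits v)) 1) := by
  have key : ∀ (v : ℕ), v ≠ 0 → ∀ (pre : List Cell), pre.length + (bijDigits v).length < b →
      ∃ h < b, Exec (tapeSem Cell k w b) (.seq (.loop (fun _ s => s r = Cell.one)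
          (.act (tapeAct r (fun _ => Cell.two) .right)))
        (.branch (fun _ s => s r = Cell.two) (.act (tapeAct r (fun _ => Cell.one) .stay))
          (.seq (.act (tapeAct r id .left)) (.act (tapeAct r (fun _ => Cell.blank) .stay)))))
        (m.setTape r (listTape (pre ++ bijDigits v)) pre.length) []
        (m.setTape r (listTape (pre ++ bijDigits (v - 1))) h) := by
    intro v
    induction v using Nat.strong_induction_on with
    | _ v ih =>
      intro hv0 pre hpre
      rcases bij_cases v with rfl | ⟨u, hu, rfl | rfl⟩
      · exact absurd rfl hv0
      · rw [bijDigits_odd] at hpre ⊢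
        -- For `u = 0` this is the last digit. The head has just turned it into a two and moved past
        -- it, so it steps back and erases it.
        rcases Nat.eq_zero_or_pos u with rfl | hu0
        · simp only [bijDigits_zero, List.length_cons, List.length_nil] at hpre ⊢
          refine ⟨pre.length, by omega, .seq_loop_true ?_
            (exec_tapeAct hm hb ?_ (update_listTape _ _ _ _) rfl) (.seq_nil (.loop_false ?_)
            (.branch_false ?_ (.seq_nil (exec_tapeAct (h' := pre.length) hm hb (by omega)
              (Function.update_eq_self _ _) ?_)
              (exec_tapeAct hm hb (by omega) ?_ rfl))))⟩
          · show (m.setTape r _ _).scan r = _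
            rw [scan_setTape, listTape_at]
          · simp only [Move.apply]; omega
          · show ¬ (m.setTape r _ _).scan r = _
            rw [scan_setTape]; simp [listTape, Move.apply]
          · show ¬ (m.setTape r _ _).scan r = _
            rw [scan_setTape]; simp [listTape, Move.apply]
          · simp [Move.apply]
          · rw [update_listTape_erase]; simp
        · obtain ⟨h, hh, hex⟩ := ih u hu hu0.ne' (pre ++ [Cell.two]) (by
            simp only [List.length_append, List.length_cons, List.length_nil] at hpre ⊢; omega)
          refine ⟨h, hh, .seq_loop_true ?_ (exec_tapeAct hm hb ?_ (update_listTape _ _ _ _) rfl) ?_⟩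
          · show (m.setTape r _ _).scan r = _
            rw [scan_setTape, listTape_at]
          · simp only [List.length_cons, Move.apply] at hpre ⊢; omega
          · obtain ⟨u, rfl⟩ := Nat.exists_eq_succ_of_ne_zero hu0.ne'
            rw [show 2 * (u + 1) + 1 - 1 = 2 * u + 2 by omega, bijDigits_even]
            simpa [Move.apply] using hex
      · rw [bijDigits_even] at hpre ⊢
        refine ⟨pre.length, by omega, .seq_nil (.loop_false ?_) (.branch_true ?_
          (exec_tapeAct hm hb (by omega) ?_ rfl))⟩
        · show ¬ (m.setTape r _ _).scan r = _
          rw [scan_setTape, listTape_at]; simp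
        · show (m.setTape r _ _).scan r = _
          rw [scan_setTape, listTape_at]
        · rw [update_listTape, show 2 * u + 2 - 1 = 2 * u + 1 by omega, bijDigits_odd]
  obtain ⟨h, hh, hex⟩ := key (v + 1) (by omega) [Cell.mark] hv
  exact .seq_nil hex (exec_rewind_bijDigits hm hb (by omega) _ _ hh)

/-! ### Simulation of register programs by tape programs -/

/-- The tapes which represent the registers. -/
def regMem (k : ℕ) (s : RegState) : Mem Cell k where
  inPos := s.pos
  tape i := listTape (Cell.mark :: bijDigits (s.reg i))
  head _ := 1

/-- The Turing machine program for a register command. -/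
def tapeCmd (k : ℕ) : RegCmd → TapeProg Cell k
  | .inc r => if h : r < k then incProg ⟨r, h⟩ else .skip
  | .dec r => if h : r < k then
      .branch (fun _ s => s ⟨r, h⟩ = Cell.blank) .skip (decProg ⟨r, h⟩) else .skip
  | .left => .act fun _ s => ⟨(), .left, s, fun _ => .stay, []⟩
  | .right => .act fun _ s => ⟨(), .right, s, fun _ => .stay, []⟩
  | .out b => .act fun _ s => ⟨(), .stay, s, fun _ => .stay, [b]⟩

/-- The Turing machine test for a register test. -/
def tapeTest (k : ℕ) : RegTest → TapeTest Cell k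
  | .nonzero r => fun _ s => ∀ h : r < k, s ⟨r, h⟩ ≠ Cell.blank
  | .notLeftEnd => fun c _ => c ≠ .leftEnd
  | .notRightEnd => fun c _ => c ≠ .rightEnd
  | .isOne => fun c _ => c = .bit true

/-- In bijective binary, zero is the empty word and is represented in no other way. With the head
resting next to the mark, the zero test is a look at the scanned cell. -/
theorem scan_regMem (s : RegState) (i : Fin k) :
    (regMem k s).scan i = Cell.blank ↔ s.reg i = 0 := by
  simp only [regMem, Mem.scan, listTape, List.getD_cons_succ]
  rcases bij_cases (s.reg i) with h | ⟨u, hu, h | h⟩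
  · simp [h]
  · simp [h, bijDigits_odd]
  · simp [h, bijDigits_even]

theorem setTape_regMem (s : RegState) (i : Fin k) (v : ℕ) :
    (regMem k s).setTape i (listTape (Cell.mark :: bijDigits v)) 1 =
      regMem k ⟨Function.update s.reg i v, s.pos⟩ := by
  refine Mem.ext rfl ?_ ?_ <;> funext j <;> rcases eq_or_ne j i with rfl | hj
  · simp [Mem.setTape, regMem]
  · simp [Mem.setTape, regMem, hj, Fin.val_ne_of_ne hj]
  · simp [Mem.setTape, regMem]
  · simp [Mem.setTape, regMem]

theorem length_bijDigits_le {v B : ℕ} (h : v ≤ B) :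
    (bijDigits v).length ≤ Nat.log 2 (B + 1) :=
  Nat.le_log_of_pow_le (by norm_num) ((two_pow_length_bijDigits v).trans (by omega))

/-- A register of value at most `B` occupies at most `Nat.log 2 (B + 1)` cells after the mark, and a
carry looks one cell further; this gives the condition on `b`. -/
theorem implements_tapeCmd (k : ℕ) (w : List Bool) (B b : ℕ) (hb : 1 + Nat.log 2 (B + 1) < b) :
    Implements (regSem w B) (tapeSem Cell k w b) (regMem k) (RegCmd.Below k) (RegTest.Below k)
      (tapeCmd k) (tapeTest k) where
  exec := by
    intro a s ha hs hs'
    have hhead : ∀ i, (regMem k s).head i < b := fun i => by simp only [regMem]; omega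
    have hpos : (regMem k s).inPos ≤ w.length + 1 := hs.2
    have simple : ∀ (mv : Move) (o : List Bool),
        Exec (tapeSem Cell k w b) (.act fun _ s => ⟨(), mv, s, fun _ => .stay, o⟩) (regMem k s) o
          (regMem k ⟨s.reg, min (mv.apply s.pos) (w.length + 1)⟩) := by
      intro mv o
      have e : (tapeSem Cell k w b).step (fun _ s => ⟨(), mv, s, fun _ => .stay, o⟩) (regMem k s) =
          regMem k ⟨s.reg, min (mv.apply s.pos) (w.length + 1)⟩ := by
        refine Mem.ext rfl ?_ ?_ <;> funext i
        · simp [tapeSem, Mem.perform, regMem, Mem.scan]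
        · simp [tapeSem, Mem.perform, regMem, Move.apply]
      rw [← e]
      refine Exec.act (S := tapeSem Cell k w b) _ _ ?_
      rw [e]
      exact hhead
    cases a with
    | inc r =>
      have hr : r < k := ha
      have := exec_incProg (r := ⟨r, hr⟩) (m := regMem k s) hpos hhead (s.reg r)
        (by have := length_bijDigits_le (hs.1 r); omega)
      rw [setTape_regMem, setTape_regMem] at this
      simpa [tapeCmd, hr, regSem] using this
    | dec r =>
      have hr : r < k := ha
      simp only [tapeCmd, hr, regSem, dite_true]
      rcases Nat.eq_zero_or_pos (s.reg r) with h0 | h0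
      · have e : Function.update s.reg r (s.reg r - 1) = s.reg := by
          rw [h0, Nat.zero_sub, ← h0, Function.update_eq_self]
        rw [e]
        exact .branch_true ((scan_regMem s ⟨r, hr⟩).2 h0) (.skip _)
      · obtain ⟨v, hv⟩ := Nat.exists_eq_succ_of_ne_zero h0.ne'
        have := exec_decProg (r := ⟨r, hr⟩) (m := regMem k s) hpos hhead v
          (by have := length_bijDigits_le (hs.1 r); rw [hv, Nat.succ_eq_add_one] at this; omega)
        rw [setTape_regMem, setTape_regMem, ← Nat.succ_eq_add_one, ← hv] at this
        rw [show s.reg r - 1 = v by omega]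
        refine .branch_false (fun h => h0.ne' ((scan_regMem s ⟨r, hr⟩).1 h)) ?_
        simpa using this
    | left =>
      have := simple .left []
      rwa [min_eq_left (by have := hs.2; simp only [Move.apply]; omega)] at this
    | right => exact simple .right []
    | out x =>
      have := simple .stay [x]
      rwa [min_eq_left (show Move.stay.apply s.pos ≤ _ from hs.2)] at this
  test := by
    intro t s ht
    cases t with
    | nonzero r =>
      have hr : r < k := ht
      show (∀ h : r < k, (regMem k s).scan ⟨r, h⟩ ≠ Cell.blank) ↔ s.reg r ≠ 0
      have := scan_regMem s ⟨r, hr⟩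
      simp only [ne_eq, this, hr, forall_true_left]
    | _ => exact Iff.rfl
  det := by
    intro a
    cases a with
    | inc r =>
      simp only [tapeCmd]
      split <;> simp [incProg, rewindProg, Det]
    | dec r =>
      simp only [tapeCmd]
      split <;> simp [decProg, rewindProg, Det]
    | left | right | out => trivial

/-- Set up the tapes for the registers and run a register program. -/
def tapeProg (k : ℕ) (P : RegProg) : TapeProg Cell k :=
  .seq (.act fun _ _ => ⟨(), .stay, fun _ => Cell.mark, fun _ => .right, []⟩)
    (P.bind (tapeCmd k) (tapeTest k))

theorem exec_init (k : ℕ) (w : List Bool) {b : ℕ} (hb : 1 < b) :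
    Exec (tapeSem Cell k w b)
      (.act fun _ _ => ⟨(), .stay, fun _ => Cell.mark, fun _ => .right, []⟩)
      (TapeProg.initMem Cell.blank) [] (regMem k ⟨fun _ => 0, 0⟩) := by
  have e : (tapeSem Cell k w b).step
      (fun _ _ => ⟨(), .stay, fun _ => Cell.mark, fun _ => .right, []⟩)
      (TapeProg.initMem Cell.blank) = regMem k ⟨fun _ => 0, 0⟩ := by
    refine Mem.ext ?_ ?_ ?_
    · simp [tapeSem, Mem.perform, regMem, TapeProg.initMem, Move.apply]
    · funext i j
      cases j with
      | zero => simp [tapeSem, Mem.perform, regMem, TapeProg.initMem, listTape]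
      | succ j => simp [tapeSem, Mem.perform, regMem, TapeProg.initMem, listTape]
    · funext i
      simp [tapeSem, Mem.perform, regMem, TapeProg.initMem, Move.apply]
  rw [← e]
  refine Exec.act (S := tapeSem Cell k w b) _ _ ?_
  rw [e]
  exact fun i => hb

/-- Uses `n + 2 ≤ 2 ^ (Nat.log 2 n + 2)`; one more factor `n + 2` absorbs the added one. The base `n
+ 2` keeps polynomial bounds meaningful for empty and one-letter inputs. -/
theorem log_bound (n c : ℕ) :
    1 + Nat.log 2 ((n + 2) ^ c + 1) < (2 * (c + 1) + 2) * (Nat.log 2 n + 1) := by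
  have h1 : n + 2 ≤ 2 ^ (Nat.log 2 n + 2) := by
    have := Nat.lt_pow_succ_log_self (b := 2) (by norm_num) n
    rw [pow_succ]; omega
  have h2 : (n + 2) ^ c + 1 ≤ (n + 2) ^ (c + 1) := by
    have : 1 ≤ (n + 2) ^ c := Nat.one_le_pow _ _ (by omega)
    rw [pow_succ]; nlinarith
  have h3 : Nat.log 2 ((n + 2) ^ c + 1) ≤ (Nat.log 2 n + 2) * (c + 1) := by
    have : (n + 2) ^ c + 1 ≤ 2 ^ ((Nat.log 2 n + 2) * (c + 1)) := by
      rw [pow_mul]; exact h2.trans (Nat.pow_le_pow_left h1 _)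
    exact (Nat.log_mono_right this).trans (Nat.log_pow (by norm_num) _).le
  nlinarith

/-- Deterministic register programs with polynomially bounded registers compute
logarithmic-space functions. -/
theorem RegProg.logSpaceComputable {P : RegProg} (hP : P.Det) (f : List Bool → List Bool) (c : ℕ)
    (h : ∀ w : List Bool, ∃ s,
      Exec (regSem w ((w.length + 2) ^ c)) P ⟨fun _ => 0, 0⟩ (f w) s) :
    LogSpaceComputable f := by
  obtain ⟨k, hk⟩ := P.exists_below
  -- Determinism of the translation does not depend on the input or the bounds, so any admissible
  -- parameters serve to extract it.
  refine TapeProg.logSpaceComputable (k := k) (blank := Cell.blank) (P := tapeProg k P)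
    ⟨trivial, hP.bind (implements_tapeCmd k [] _ _ (log_bound 0 0)).det⟩ f
    (2 * (c + 1) + 2) fun w => ?_
  have hb := log_bound w.length c
  refine ⟨by omega, ?_⟩
  obtain ⟨s, hs⟩ := h w
  exact ⟨regMem k s, .seq_nil (exec_init k w (by omega))
    ((implements_tapeCmd k w _ _ hb).bind_exec hs ⟨by simp, by simp⟩ (hk k le_rfl))⟩

/-- Nondeterministic register programs with polynomially bounded registers decide languages in
`NL`. -/
theorem RegProg.mem_NL (P : RegProg) (A : Set (List Bool)) (c : ℕ)
    (h : ∀ w : List Bool,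
      wlp (regSem w ((w.length + 2) ^ c)) P (fun _ => w ∈ A) ⟨fun _ => 0, 0⟩)
    (h' : ∀ w ∈ A, ∃ o s, Exec (regSem w ((w.length + 2) ^ c)) P ⟨fun _ => 0, 0⟩ o s) :
    A ∈ NL := by
  obtain ⟨k, hk⟩ := P.exists_below
  have safe : ∀ w : List Bool, wlp (tapeSem Cell k w ((2 * (c + 1) + 2) *
      (Nat.log 2 w.length + 1))) (tapeProg k P) (fun _ => w ∈ A) (TapeProg.initMem Cell.blank) := by
    intro w
    have hb := log_bound w.length c
    exact wlp_of_exec (exec_init k w (by omega)) trivial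
      ((implements_tapeCmd k w _ _ hb).bind_wlp (h w) ⟨by simp, by simp⟩ (hk k le_rfl)
        fun _ _ h => h)
  refine ⟨TapeProg.machine Cell.blank (tapeProg k P),
    TapeProg.machine_logSpace (2 * (c + 1) + 2) fun w => ⟨?_, _, safe w⟩, fun w => ?_⟩
  · have hb := log_bound w.length c
    omega
  · have hb := log_bound w.length c
    refine (TapeProg.machine_accepts (by omega) (safe w) fun hw => ?_).symm
    obtain ⟨o, s, hs⟩ := h' w hw
    exact ⟨o, _, .seq_nil (exec_init k w (by omega))
      ((implements_tapeCmd k w _ _ hb).bind_exec hs ⟨by simp, by simp⟩ (hk k le_rfl))⟩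

end TapePrograms

end CayleyNL

namespace CayleyNL

open Prog Function

/-! ### Specifications of register programs -/

/-- From registers `f`, wherever the input head is, the program `P` can terminate with registers
`f'` after writing `o`. -/
def Trans (w : List Bool) (B : ℕ) (P : RegProg) (f : ℕ → ℕ) (o : List Bool) (f' : ℕ → ℕ) : Prop :=
  ∀ p ≤ w.length + 1, ∃ p' ≤ w.length + 1, Exec (regSem w B) P ⟨f, p⟩ o ⟨f', p'⟩

theorem readInput_ne_leftEnd {w : List Bool} {p : ℕ} :
    Machine.readInput w p ≠ .leftEnd ↔ p ≠ 0 := by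
  cases p with
  | zero => simp [Machine.readInput]
  | succ p => simp only [Machine.readInput]; split <;> simp

theorem readInput_succ_of_lt {w : List Bool} {p : ℕ} (h : p < w.length) :
    Machine.readInput w (p + 1) = .bit w[p] := by
  simp [Machine.readInput, List.getElem?_eq_getElem h]

theorem readInput_succ_of_ge {w : List Bool} {p : ℕ} (h : w.length ≤ p) :
    Machine.readInput w (p + 1) = .rightEnd := by
  simp [Machine.readInput, List.getElem?_eq_none h]

theorem readInput_ne_rightEnd {w : List Bool} {p : ℕ} :
    Machine.readInput w p ≠ .rightEnd ↔ p ≤ w.length := by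
  cases p with
  | zero => simp [Machine.readInput]
  | succ p =>
    rcases lt_or_ge p w.length with h | h
    · simp [readInput_succ_of_lt h]; omega
    · simp [readInput_succ_of_ge h]; omega

section Trans

variable {w : List Bool} {B : ℕ} {P Q : RegProg} {f f' f'' : ℕ → ℕ} {o o' : List Bool}

theorem Trans.seq (h : Trans w B P f o f') (h' : Trans w B Q f' o' f'') :
    Trans w B (.seq P Q) f (o ++ o') f'' := by
  intro p hp
  obtain ⟨p', hp', h1⟩ := h p hp
  obtain ⟨p'', hp'', h2⟩ := h' p' hp'
  exact ⟨p'', hp'', .seq h1 h2⟩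

theorem Trans.seq_nil (h : Trans w B P f [] f') (h' : Trans w B Q f' o f'') :
    Trans w B (.seq P Q) f o f'' := Trans.seq (o := []) h h'

theorem Trans.skip : Trans w B .skip f [] f := fun p hp => ⟨p, hp, .skip _⟩

theorem forall_update_le {r v : ℕ} (hf : ∀ r, f r ≤ B) (hv : v ≤ B) (r' : ℕ) :
    update f r v r' ≤ B := by
  rw [update_apply]; split_ifs; exacts [hv, hf _]

theorem exec_inc {r p : ℕ} (hf : ∀ r, f r ≤ B) (hr : f r + 1 ≤ B) (hp : p ≤ w.length + 1) :
    Exec (regSem w B) (.act (.inc r)) ⟨f, p⟩ [] ⟨update f r (f r + 1), p⟩ :=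
  Exec.act (S := regSem w B) (.inc r) ⟨f, p⟩ ⟨forall_update_le hf hr, hp⟩

theorem exec_right {p : ℕ} (hf : ∀ r, f r ≤ B) :
    Exec (regSem w B) (.act .right) ⟨f, p⟩ [] ⟨f, min (p + 1) (w.length + 1)⟩ :=
  Exec.act (S := regSem w B) .right ⟨f, p⟩ ⟨hf, min_le_right _ _⟩

theorem Trans.inc (hf : ∀ r, f r ≤ B) {r : ℕ} (hr : f r + 1 ≤ B) :
    Trans w B (.act (.inc r)) f [] (update f r (f r + 1)) := fun p hp =>
  ⟨p, hp, exec_inc hf hr hp⟩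

theorem Trans.dec (hf : ∀ r, f r ≤ B) (r : ℕ) :
    Trans w B (.act (.dec r)) f [] (update f r (f r - 1)) := fun p hp =>
  ⟨p, hp, Exec.act (S := regSem w B) (.dec r) ⟨f, p⟩
    ⟨forall_update_le hf ((Nat.sub_le _ _).trans (hf r)), hp⟩⟩

theorem Trans.out (hf : ∀ r, f r ≤ B) (b : Bool) : Trans w B (.act (.out b)) f [b] f :=
  fun p hp => ⟨p, hp, Exec.act (S := regSem w B) (.out b) ⟨f, p⟩ ⟨hf, hp⟩⟩

theorem Trans.branch_true {r : ℕ} (hr : f r ≠ 0) (h : Trans w B P f o f') :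
    Trans w B (.branch (.nonzero r) P Q) f o f' := fun p hp => by
  obtain ⟨p', hp', h1⟩ := h p hp
  exact ⟨p', hp', .branch_true hr h1⟩

theorem Trans.branch_false {r : ℕ} (hr : f r = 0) (h : Trans w B Q f o f') :
    Trans w B (.branch (.nonzero r) P Q) f o f' := fun p hp => by
  obtain ⟨p', hp', h1⟩ := h p hp
  exact ⟨p', hp', .branch_false (fun h => h hr) h1⟩

theorem Trans.choice_left (h : Trans w B P f o f') : Trans w B (.choice P Q) f o f' :=
  fun p hp => by
    obtain ⟨p', hp', h1⟩ := h p hp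
    exact ⟨p', hp', .choice_left h1⟩

theorem Trans.choice_right (h : Trans w B Q f o f') : Trans w B (.choice P Q) f o f' :=
  fun p hp => by
    obtain ⟨p', hp', h1⟩ := h p hp
    exact ⟨p', hp', .choice_right h1⟩

theorem Trans.loop_true {r : ℕ} (hr : f r ≠ 0) (h : Trans w B P f [] f')
    (h' : Trans w B (.loop (.nonzero r) P) f' o f'') :
    Trans w B (.loop (.nonzero r) P) f o f'' := fun p hp => by
  obtain ⟨p', hp', h1⟩ := h p hp
  obtain ⟨p'', hp'', h2⟩ := h' p' hp'
  exact ⟨p'', hp'', .loop_true (o := []) hr h1 h2⟩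

theorem Trans.loop_false {r : ℕ} (hr : f r = 0) : Trans w B (.loop (.nonzero r) P) f [] f :=
  fun p hp => ⟨p, hp, .loop_false fun h => h hr⟩

/-- A loop which counts the register `r` down to zero. -/
theorem Trans.countdown {r : ℕ} (g : ℕ → ℕ → ℕ) (outs : ℕ → List Bool) (n : ℕ)
    (hg : ∀ i ≤ n, g i r = i) (h0 : outs 0 = [])
    (h : ∀ i < n, ∃ o, Trans w B P (g (i + 1)) o (g i) ∧ outs (i + 1) = o ++ outs i) :
    Trans w B (.loop (.nonzero r) P) (g n) (outs n) (g 0) := by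
  induction n with
  | zero =>
    exact fun p hp => ⟨p, hp, h0 ▸ .loop_false (fun h => h (hg 0 le_rfl))⟩
  | succ n ih =>
    intro p hp
    obtain ⟨o, ho, e⟩ := h n (by omega)
    obtain ⟨p', hp', h1⟩ := ho p hp
    obtain ⟨p'', hp'', h2⟩ := ih (fun i hi => hg i (by omega)) (fun i hi => h i (by omega)) p' hp'
    refine ⟨p'', hp'', e ▸ .loop_true ?_ h1 h2⟩
    show g (n + 1) r ≠ 0
    rw [hg _ le_rfl]; omega

theorem Trans.countdown_nil {r : ℕ} (g : ℕ → ℕ → ℕ) (n : ℕ) (hg : ∀ i ≤ n, g i r = i)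
    (h : ∀ i < n, Trans w B P (g (i + 1)) [] (g i)) :
    Trans w B (.loop (.nonzero r) P) (g n) [] (g 0) :=
  Trans.countdown g (fun _ => []) n hg rfl fun i hi => ⟨[], h i hi, rfl⟩

theorem Trans.congr (h : Trans w B P f o f') (e : f' = f'') : Trans w B P f o f'' := e ▸ h

/-- Set register `a` to zero. -/
def clear (a : ℕ) : RegProg := .loop (.nonzero a) (.act (.dec a))

theorem trans_clear (hf : ∀ r, f r ≤ B) (a : ℕ) : Trans w B (clear a) f [] (update f a 0) := by
  have := Trans.countdown_nil (w := w) (B := B) (P := .act (.dec a)) (r := a)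
    (fun i => update f a i) (f a) (by simp) (fun i hi => ?_)
  · simpa [clear] using this
  · refine (Trans.dec (forall_update_le hf (hi.trans_le (hf a))) a).congr ?_
    simp

/-- Add register `a` to register `b` and set `a` to zero. -/
def addTo (a b : ℕ) : RegProg := .loop (.nonzero a) (.seq (.act (.dec a)) (.act (.inc b)))

theorem trans_addTo (hf : ∀ r, f r ≤ B) {a b : ℕ} (hab : a ≠ b) (h : f b + f a ≤ B) :
    Trans w B (addTo a b) f [] (update (update f a 0) b (f b + f a)) := by
  -- The registers when `i` rounds remain: `f a - i` units have already been moved.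
  have := Trans.countdown_nil (w := w) (B := B) (P := .seq (.act (.dec a)) (.act (.inc b))) (r := a)
    (fun i => update (update f a i) b (f b + (f a - i))) (f a) (by simp [hab]) (fun i hi => ?_)
  · simpa [addTo] using this
  · have h1 := forall_update_le (r := b) (v := f b + (f a - (i + 1)))
      (forall_update_le (r := a) (v := i + 1) hf (hi.trans_le (hf a))) (by omega)
    refine (Trans.dec h1 a).seq_nil ((Trans.inc (r := b) (forall_update_le h1 ?_) ?_).congr ?_)
    · exact (Nat.sub_le _ _).trans (h1 a)
    · simp [hab.symm]; omega
    · funext r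
      simp only [update_apply]
      split_ifs <;> omega

/-- Subtract register `a` from register `b` and set `a` to zero. -/
def subFrom (a b : ℕ) : RegProg := .loop (.nonzero a) (.seq (.act (.dec a)) (.act (.dec b)))

theorem trans_subFrom (hf : ∀ r, f r ≤ B) {a b : ℕ} (hab : a ≠ b) :
    Trans w B (subFrom a b) f [] (update (update f a 0) b (f b - f a)) := by
  have := Trans.countdown_nil (w := w) (B := B) (P := .seq (.act (.dec a)) (.act (.dec b))) (r := a)
    (fun i => update (update f a i) b (f b - (f a - i))) (f a) (by simp [hab]) (fun i hi => ?_)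
  · simpa [subFrom] using this
  · have h1 := forall_update_le (r := b) (v := f b - (f a - (i + 1)))
      (forall_update_le (r := a) (v := i + 1) hf (hi.trans_le (hf a)))
      ((Nat.sub_le _ _).trans (hf b))
    refine (Trans.dec h1 a).seq_nil ((Trans.dec (forall_update_le h1 ?_) b).congr ?_)
    · exact (Nat.sub_le _ _).trans (h1 a)
    · funext r
      simp only [update_apply]
      split_ifs <;> omega

/-- Copy register `r` to register `d`, with the help of register `t`. -/
def copy (r d t : ℕ) : RegProg :=
  .seq (.loop (.nonzero r) (.seq (.act (.dec r)) (.seq (.act (.inc d)) (.act (.inc t)))))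
    (addTo t r)

theorem trans_copy (hf : ∀ r, f r ≤ B) {r d t : ℕ} (hrd : r ≠ d) (hrt : r ≠ t) (hdt : d ≠ t)
    (hd : f d = 0) (ht : f t = 0) : Trans w B (copy r d t) f [] (update f d (f r)) := by
  have hr := hf r
  have := Trans.countdown_nil (w := w) (B := B)
    (P := .seq (.act (.dec r)) (.seq (.act (.inc d)) (.act (.inc t)))) (r := r)
    (fun i => update (update (update f r i) d (f r - i)) t (f r - i)) (f r) (by simp [hrd, hrt])
    (fun i hi => ?_)
  · simp only [Nat.sub_self, update_eq_self, Nat.sub_zero] at this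
    have e : update (update f d 0) t 0 = f := by
      have h0 : update f d 0 = f := update_eq_self_iff.2 hd.symm
      rw [h0]; exact update_eq_self_iff.2 ht.symm
    rw [e] at this
    refine this.seq_nil ((trans_addTo ?_ hrt.symm ?_).congr ?_)
    · exact forall_update_le (forall_update_le (forall_update_le hf (Nat.zero_le _)) hr) hr
    · simp [hrd, hrt, hr]
    · funext x
      simp only [update_apply]
      split_ifs <;> simp_all
  · have h1 : ∀ x, update (update (update f r (i + 1)) d (f r - (i + 1))) t (f r - (i + 1)) x ≤ B :=
      forall_update_le (forall_update_le (forall_update_le hf (by omega)) (by omega)) (by omega)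
    have h2 := forall_update_le (r := r) h1 ((Nat.sub_le _ 1).trans (h1 r))
    have e2 : update (update (update (update f r (i + 1)) d (f r - (i + 1))) t (f r - (i + 1))) r
        (update (update (update f r (i + 1)) d (f r - (i + 1))) t (f r - (i + 1)) r - 1) d + 1
          = f r - i := by
      simp only [update_apply]
      split_ifs <;> omega
    refine (Trans.dec h1 r).seq_nil ((Trans.inc h2 (e2 ▸ by omega)).seq_nil
      ((Trans.inc (forall_update_le h2 (e2 ▸ by omega)) ?_).congr ?_))
    · simp only [update_apply]
      split_ifs <;> omega
    · funext x
      simp only [update_apply]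
      split_ifs <;> omega

/-- Move the input head to the left end. -/
def headHome : RegProg := .loop .notLeftEnd (.act .left)

theorem exec_headHome (hf : ∀ r, f r ≤ B) (p : ℕ) (hp : p ≤ w.length + 1) :
    Exec (regSem w B) headHome ⟨f, p⟩ [] ⟨f, 0⟩ := by
  induction p with
  | zero => exact .loop_false fun h => readInput_ne_leftEnd.1 h rfl
  | succ p ih =>
    refine .loop_true (o := []) (readInput_ne_leftEnd.2 p.succ_ne_zero) ?_ (ih (by omega))
    exact Exec.act (S := regSem w B) .left ⟨f, p + 1⟩ ⟨hf, by simp [regSem]; omega⟩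

/-- Store the number of possible head positions to the right of the left end. -/
def measure (d : ℕ) : RegProg :=
  .seq headHome (.loop .notRightEnd (.seq (.act .right) (.act (.inc d))))

theorem trans_measure (hf : ∀ r, f r ≤ B) {d : ℕ} (hd : f d = 0) (hB : w.length + 1 ≤ B) :
    Trans w B (measure d) f [] (update f d (w.length + 1)) := by
  have key : ∀ i ≤ w.length + 1, Exec (regSem w B)
      (.loop .notRightEnd (.seq (.act .right) (.act (.inc d))))
      ⟨update f d (w.length + 1 - i), w.length + 1 - i⟩ []
      ⟨update f d (w.length + 1), w.length + 1⟩ := by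
    intro i
    induction i with
    | zero => exact fun _ => .loop_false fun h => by simpa using readInput_ne_rightEnd.1 h
    | succ i ih =>
      intro hi
      refine .loop_true (o := []) (readInput_ne_rightEnd.2 (show w.length + 1 - (i + 1) ≤ _ by omega))
        ?_ (ih (by omega))
      have h1 := exec_right (w := w) (p := w.length + 1 - (i + 1))
        (forall_update_le (r := d) (v := w.length + 1 - (i + 1)) hf (by omega))
      rw [min_eq_left (by omega), show w.length + 1 - (i + 1) + 1 = w.length + 1 - i by omega] at h1
      have h2 := exec_inc (w := w) (r := d) (p := w.length + 1 - i)
        (forall_update_le (r := d) (v := w.length + 1 - (i + 1)) hf (by omega))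
        (by rw [update_self]; omega) (by omega)
      rw [update_self, update_idem,
        show w.length + 1 - (i + 1) + 1 = w.length + 1 - i by omega] at h2
      exact .seq_nil h1 h2
  refine fun p hp => ⟨w.length + 1, le_rfl, .seq_nil (exec_headHome hf p hp) ?_⟩
  have := key (w.length + 1) le_rfl
  rwa [Nat.sub_self, ← hd, update_eq_self, hd] at this

/-- Replace the number `p` in register `d` by the input bit at position `p`. -/
def readBit (d : ℕ) : RegProg :=
  .seq headHome (.seq (.loop (.nonzero d) (.seq (.act (.dec d)) (.act .right)))
    (.branch .isOne (.act (.inc d)) .skip))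

theorem trans_readBit (hf : ∀ r, f r ≤ B) (d : ℕ) (hB : 1 ≤ B) [Decidable (Machine.readInput w (f d) = .bit true)] :
    Trans w B (readBit d) f []
      (update f d (if Machine.readInput w (f d) = .bit true then 1 else 0)) := by
  have key : ∀ i p, i ≤ B → p ≤ w.length + 1 → Exec (regSem w B)
      (.loop (.nonzero d) (.seq (.act (.dec d)) (.act .right))) ⟨update f d i, p⟩ []
      ⟨update f d 0, min (p + i) (w.length + 1)⟩ := by
    intro i
    induction i with
    | zero =>
      intro p _ hp
      rw [Nat.add_zero, min_eq_left hp]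
      exact .loop_false fun h => h (by simp)
    | succ i ih =>
      intro p hi hp
      have h1 := Exec.act (S := regSem w B) (.dec d) ⟨update f d (i + 1), p⟩
        ⟨forall_update_le (forall_update_le hf hi) ((Nat.sub_le _ _).trans (by simpa using hi)), hp⟩
      have h2 := exec_right (w := w) (p := p) (forall_update_le (r := d) (v := i) hf (by omega))
      have e : (regSem w B).step (.dec d) ⟨update f d (i + 1), p⟩ = ⟨update f d i, p⟩ := by
        simp [regSem]
      rw [e] at h1
      refine .loop_true (o := []) (by simp [regSem]) (.seq_nil h1 h2) ?_
      have := ih (min (p + 1) (w.length + 1)) (by omega) (min_le_right _ _)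
      rwa [show min (min (p + 1) (w.length + 1) + i) (w.length + 1) =
        min (p + (i + 1)) (w.length + 1) by omega] at this
  -- All positions beyond the input word read as the right end marker, so stopping the head there
  -- does not change the symbol read.
  have hread : ∀ p, Machine.readInput w (min p (w.length + 1)) = Machine.readInput w p := by
    intro p
    rcases le_total p (w.length + 1) with h | h
    · rw [min_eq_left h]
    · rw [min_eq_right h, readInput_succ_of_ge le_rfl]
      obtain ⟨q, rfl⟩ : ∃ q, p = q + 1 := ⟨p - 1, by omega⟩
      rw [readInput_succ_of_ge (by omega)]
  refine fun p hp => ⟨min (0 + f d) (w.length + 1), min_le_right _ _,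
    .seq_nil (exec_headHome hf p hp) ?_⟩
  have h1 := key (f d) 0 (hf d) (Nat.zero_le _)
  rw [update_eq_self] at h1
  refine .seq_nil h1 ?_
  rw [Nat.zero_add]
  split_ifs with h
  · refine .branch_true (show Machine.readInput w _ = _ from (hread _).trans h) ?_
    have h2 := exec_inc (w := w) (r := d) (p := min (f d) (w.length + 1))
      (forall_update_le (r := d) (v := 0) hf (Nat.zero_le _)) (by simpa using hB) (min_le_right _ _)
    simpa using h2
  · exact .branch_false (fun h' => h ((hread _).symm.trans h')) (.skip _)

end Trans

/-! ### Arithmetic expressions with bounded sums -/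

/-- Arithmetic expressions about an input word and a list of numbers, with bounded sums. -/
inductive Expr where
  | top : Expr
  | wk (e : Expr) : Expr
  | one : Expr
  | len : Expr
  | input (e : Expr) : Expr
  | add (e₁ e₂ : Expr) : Expr
  | sub (e₁ e₂ : Expr) : Expr
  | sum (e₁ e₂ : Expr) : Expr

namespace Expr

open Classical in
/-- The value of an expression. -/
noncomputable def eval (w : List Bool) : Expr → List ℕ → ℕ
  | top, env => env.headD 0
  | wk e, env => e.eval w env.tail
  | one, _ => 1
  | len, _ => w.length + 1
  | input e, env => if Machine.readInput w (e.eval w env) = .bit true then 1 else 0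
  | add e₁ e₂, env => e₁.eval w env + e₂.eval w env
  | sub e₁ e₂, env => e₁.eval w env - e₂.eval w env
  | sum e₁ e₂, env => ∑ i ∈ Finset.range (e₁.eval w env), e₂.eval w (i :: env)

/-- A program which stores the value of an expression in register `d`, if the variables are in the
registers `ρ`. Registers above `d` are used as a stack. -/
def compile : Expr → List ℕ → ℕ → RegProg
  | top, [], _ => .skip
  | top, r :: _, d => copy r d (d + 1)
  | wk e, ρ, d => e.compile ρ.tail d
  | one, _, d => .act (.inc d)
  | len, _, d => measure d
  | input e, ρ, d => .seq (e.compile ρ d) (readBit d)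
  | add e₁ e₂, ρ, d => .seq (e₁.compile ρ d) (.seq (e₂.compile ρ (d + 1)) (addTo (d + 1) d))
  | sub e₁ e₂, ρ, d => .seq (e₁.compile ρ d) (.seq (e₂.compile ρ (d + 1)) (subFrom (d + 1) d))
  | sum e₁ e₂, ρ, d => .seq (e₁.compile ρ (d + 1)) (.loop (.nonzero (d + 1))
      (.seq (.act (.dec (d + 1))) (.seq (e₂.compile ((d + 1) :: ρ) (d + 2)) (addTo (d + 2) d))))

theorem det_compile (e : Expr) (ρ : List ℕ) (d : ℕ) : (e.compile ρ d).Det := by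
  induction e generalizing ρ d with
  | top => cases ρ <;> simp [compile, copy, addTo, Det]
  | wk e ih => exact ih _ _
  | one => trivial
  | len => simp [compile, measure, headHome, Det]
  | input e ih => simp [compile, readBit, headHome, Det, ih]
  | add e₁ e₂ ih₁ ih₂ => simp [compile, addTo, Det, ih₁, ih₂]
  | sub e₁ e₂ ih₁ ih₂ => simp [compile, subFrom, Det, ih₁, ih₂]
  | sum e₁ e₂ ih₁ ih₂ => simp [compile, addTo, Det, ih₁, ih₂]

theorem pow_le_of_le {X a b B : ℕ} (h : (X + 2) ^ b ≤ B) (hab : a ≤ b) : (X + 2) ^ a ≤ B :=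
  (Nat.pow_le_pow_right (by omega) hab).trans h

theorem le_pow_succ (X a : ℕ) : X ≤ (X + 2) ^ (a + 1) := by
  have : 1 ≤ (X + 2) ^ a := Nat.one_le_pow _ _ (by omega)
  rw [pow_succ]; nlinarith

theorem pow_add_two_le (X a : ℕ) : (X + 2) ^ (a + 1) + 2 ≤ (X + 2) ^ (a + 2) := by
  have : 1 ≤ (X + 2) ^ a := Nat.one_le_pow _ _ (by omega)
  have h2 : (X + 2) ^ (a + 1) = (X + 2) ^ a * (X + 2) := pow_succ _ _
  have h3 : 2 ≤ (X + 2) ^ (a + 1) := by rw [h2]; nlinarith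
  rw [pow_succ _ (a + 1)]; nlinarith

/-- Composition of bounds: a bound `(X + 2) ^ b` is applied with `X` replaced by the polynomial
bound `(X + 2) ^ (a + 1)` on a summation variable. -/
theorem pow_pow_le (X a b : ℕ) : ((X + 2) ^ (a + 1) + 2) ^ b ≤ (X + 2) ^ ((a + 2) * b) := by
  rw [pow_mul]; exact Nat.pow_le_pow_left (pow_add_two_le X a) _

/-- Values of expressions are polynomially bounded. -/
theorem exists_eval_le (e : Expr) : ∃ c, ∀ (w : List Bool) (X : ℕ) (env : List ℕ),
    w.length + 1 ≤ X → (∀ x ∈ env, x ≤ X) → e.eval w env ≤ (X + 2) ^ (c + 1) := by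
  induction e with
  | top =>
    refine ⟨0, fun w X env hw henv => ?_⟩
    cases env with
    | nil => simp [eval]
    | cons x env =>
      have := henv x (by simp)
      simp only [eval, List.headD_cons, zero_add, pow_one]; omega
  | wk e ih =>
    obtain ⟨c, hc⟩ := ih
    exact ⟨c, fun w X env hw henv => hc w X _ hw fun x hx => henv x (List.mem_of_mem_tail hx)⟩
  | one => exact ⟨0, fun w X env hw henv => by simp [eval]⟩
  | len => exact ⟨0, fun w X env hw henv => by simp only [eval, zero_add, pow_one]; omega⟩
  | input e ih =>
    refine ⟨0, fun w X env hw henv => ?_⟩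
    simp only [eval, zero_add, pow_one]
    split_ifs <;> omega
  | add e₁ e₂ ih₁ ih₂ =>
    obtain ⟨c₁, h₁⟩ := ih₁
    obtain ⟨c₂, h₂⟩ := ih₂
    refine ⟨max c₁ c₂ + 1, fun w X env hw henv => ?_⟩
    have h1 := (h₁ w X env hw henv).trans (pow_le_of_le le_rfl (show c₁ + 1 ≤ max c₁ c₂ + 1 by omega))
    have h2 := (h₂ w X env hw henv).trans (pow_le_of_le le_rfl (show c₂ + 1 ≤ max c₁ c₂ + 1 by omega))
    simp only [eval]
    rw [pow_succ _ (max c₁ c₂ + 1)]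
    nlinarith
  | sub e₁ e₂ ih₁ ih₂ =>
    obtain ⟨c₁, h₁⟩ := ih₁
    exact ⟨c₁, fun w X env hw henv => (Nat.sub_le _ _).trans (h₁ w X env hw henv)⟩
  | sum e₁ e₂ ih₁ ih₂ =>
    obtain ⟨c₁, h₁⟩ := ih₁
    obtain ⟨c₂, h₂⟩ := ih₂
    -- The summation variable is below `(X + 2) ^ (c₁ + 1)`. Each term is bounded with this number
    -- in place of `X`, which gives the product in the exponent; the number of terms gives the
    -- factor with exponent `c₁ + 1`.
    refine ⟨c₁ + (c₁ + 2) * (c₂ + 1), fun w X env hw henv => ?_⟩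
    have h1 := h₁ w X env hw henv
    have hX := le_pow_succ X c₁
    have h2 : ∀ i ∈ Finset.range (e₁.eval w env),
        e₂.eval w (i :: env) ≤ (X + 2) ^ ((c₁ + 2) * (c₂ + 1)) := by
      intro i hi
      rw [Finset.mem_range] at hi
      refine (h₂ w ((X + 2) ^ (c₁ + 1)) (i :: env) (hw.trans hX) ?_).trans (pow_pow_le _ _ _)
      intro x hx
      rcases List.mem_cons.1 hx with rfl | hx
      · omega
      · exact (henv x hx).trans hX
    simp only [eval]
    refine (Finset.sum_le_card_nsmul _ _ _ h2).trans ?_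
    rw [Finset.card_range, smul_eq_mul, show c₁ + (c₁ + 2) * (c₂ + 1) + 1 = (c₁ + 1) + (c₁ + 2) * (c₂ + 1) by ring, pow_add]
    exact Nat.mul_le_mul_right _ h1

theorem map_update_of_lt {ρ : List ℕ} {d r : ℕ} (f : ℕ → ℕ) (v : ℕ) (hρ : ∀ r ∈ ρ, r < d)
    (hr : d ≤ r) : ρ.map (update f r v) = ρ.map f :=
  List.map_congr_left fun x hx => update_of_ne (by have := hρ x hx; omega) _ _

/-- Expressions are evaluated with polynomially bounded registers. -/
theorem exists_trans_compile (e : Expr) : ∃ c, ∀ (w : List Bool) (X B : ℕ) (ρ : List ℕ) (d : ℕ)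
    (f : ℕ → ℕ), w.length + 1 ≤ X → (∀ r, f r ≤ B) → (∀ r ∈ ρ, r < d) → (∀ r ∈ ρ, f r ≤ X) →
    (∀ r, d ≤ r → f r = 0) → (X + 2) ^ c ≤ B →
    Trans w B (e.compile ρ d) f [] (update f d (e.eval w (ρ.map f))) := by
  induction e with
  | top =>
    refine ⟨0, fun w X B ρ d f hw hf hρ hX hd hB => ?_⟩
    cases ρ with
    | nil =>
      simp only [compile, eval, List.map_nil, List.headD_nil]
      rw [← hd d le_rfl, update_eq_self]
      exact Trans.skip
    | cons r ρ =>
      have := hρ r (by simp)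
      exact trans_copy hf (by omega) (by omega) (by omega) (hd _ le_rfl) (hd _ (by omega))
  | wk e ih =>
    obtain ⟨c, hc⟩ := ih
    refine ⟨c, fun w X B ρ d f hw hf hρ hX hd hB => ?_⟩
    have := hc w X B ρ.tail d f hw hf (fun r hr => hρ r (List.mem_of_mem_tail hr))
      (fun r hr => hX r (List.mem_of_mem_tail hr)) hd hB
    rwa [List.map_tail] at this
  | one =>
    refine ⟨0, fun w X B ρ d f hw hf hρ hX hd hB => ?_⟩
    refine (Trans.inc hf (r := d) ?_).congr ?_
    · rw [hd d le_rfl]; simpa using hB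
    · rw [hd d le_rfl]; rfl
  | len =>
    refine ⟨1, fun w X B ρ d f hw hf hρ hX hd hB => ?_⟩
    exact trans_measure hf (hd d le_rfl) (by rw [pow_one] at hB; omega)
  | input e ih =>
    obtain ⟨c, hc⟩ := ih
    obtain ⟨v, hv⟩ := e.exists_eval_le
    refine ⟨c + (v + 1), fun w X B ρ d f hw hf hρ hX hd hB => ?_⟩
    have hval := (hv w X (ρ.map f) hw (by simpa using hX)).trans (pow_le_of_le hB (by omega))
    have h1 := hc w X B ρ d f hw hf hρ hX hd (pow_le_of_le hB (by omega))
    have hB1 : 1 ≤ B := (Nat.one_le_pow _ _ (by omega)).trans hB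
    classical
    refine h1.seq_nil ((trans_readBit (forall_update_le hf hval) d hB1).congr ?_)
    simp only [update_self, update_idem, eval]
  | add e₁ e₂ ih₁ ih₂ =>
    obtain ⟨c₁, h₁⟩ := ih₁
    obtain ⟨c₂, h₂⟩ := ih₂
    obtain ⟨v₁, hv₁⟩ := e₁.exists_eval_le
    obtain ⟨v₂, hv₂⟩ := e₂.exists_eval_le
    obtain ⟨v, hv⟩ := (add e₁ e₂).exists_eval_le
    refine ⟨c₁ + c₂ + v₁ + v₂ + v + 1, fun w X B ρ d f hw hf hρ hX hd hB => ?_⟩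
    have henv : ∀ x ∈ ρ.map f, x ≤ X := by simpa using hX
    have b₁ := (hv₁ w X (ρ.map f) hw henv).trans (pow_le_of_le hB (by omega))
    have b₂ := (hv₂ w X (ρ.map f) hw henv).trans (pow_le_of_le hB (by omega))
    have b := (hv w X (ρ.map f) hw henv).trans (pow_le_of_le hB (by omega))
    have t₁ := h₁ w X B ρ d f hw hf hρ hX hd (pow_le_of_le hB (by omega))
    have f₁ := forall_update_le (r := d) hf b₁
    have t₂ := h₂ w X B ρ (d + 1) _ hw f₁ (fun r hr => (hρ r hr).trans (by omega))
      (fun r hr => by rw [update_of_ne (hρ r hr).ne]; exact hX r hr)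
      (fun r hr => by rw [update_of_ne (by omega)]; exact hd r (by omega))
      (pow_le_of_le hB (by omega))
    rw [map_update_of_lt f _ hρ le_rfl] at t₂
    refine t₁.seq_nil (t₂.seq_nil ((trans_addTo (forall_update_le f₁ b₂) (by omega) ?_).congr ?_))
    · simpa [eval] using b
    · have := hd (d + 1) (by omega)
      funext x
      simp only [update_apply, eval]
      split_ifs <;> first | omega | simp_all
  | sub e₁ e₂ ih₁ ih₂ =>
    obtain ⟨c₁, h₁⟩ := ih₁
    obtain ⟨c₂, h₂⟩ := ih₂
    obtain ⟨v₁, hv₁⟩ := e₁.exists_eval_le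
    obtain ⟨v₂, hv₂⟩ := e₂.exists_eval_le
    refine ⟨c₁ + c₂ + v₁ + v₂ + 1, fun w X B ρ d f hw hf hρ hX hd hB => ?_⟩
    have henv : ∀ x ∈ ρ.map f, x ≤ X := by simpa using hX
    have b₁ := (hv₁ w X (ρ.map f) hw henv).trans (pow_le_of_le hB (by omega))
    have b₂ := (hv₂ w X (ρ.map f) hw henv).trans (pow_le_of_le hB (by omega))
    have t₁ := h₁ w X B ρ d f hw hf hρ hX hd (pow_le_of_le hB (by omega))
    have f₁ := forall_update_le (r := d) hf b₁
    have t₂ := h₂ w X B ρ (d + 1) _ hw f₁ (fun r hr => (hρ r hr).trans (by omega))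
      (fun r hr => by rw [update_of_ne (hρ r hr).ne]; exact hX r hr)
      (fun r hr => by rw [update_of_ne (by omega)]; exact hd r (by omega))
      (pow_le_of_le hB (by omega))
    rw [map_update_of_lt f _ hρ le_rfl] at t₂
    refine t₁.seq_nil (t₂.seq_nil ((trans_subFrom (forall_update_le f₁ b₂) (by omega)).congr ?_))
    have := hd (d + 1) (by omega)
    funext x
    simp only [update_apply, eval]
    split_ifs <;> first | omega | simp_all
  | sum e₁ e₂ ih₁ ih₂ =>
    obtain ⟨c₁, h₁⟩ := ih₁
    obtain ⟨c₂, h₂⟩ := ih₂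
    obtain ⟨v₁, hv₁⟩ := e₁.exists_eval_le
    obtain ⟨v₂, hv₂⟩ := e₂.exists_eval_le
    obtain ⟨v, hv⟩ := (sum e₁ e₂).exists_eval_le
    refine ⟨c₁ + (v₁ + 2) * c₂ + v₁ + (v₁ + 2) * (v₂ + 1) + v + 1,
      fun w X B ρ d f hw hf hρ hX hd hB => ?_⟩
    have henv : ∀ x ∈ ρ.map f, x ≤ X := by simpa using hX
    have a₁ := hv₁ w X (ρ.map f) hw henv
    have b₁ := a₁.trans (pow_le_of_le hB (by omega))
    have b := (hv w X (ρ.map f) hw henv).trans (pow_le_of_le hB (by omega))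
    have hXX := le_pow_succ X v₁
    have t₁ := h₁ w X B ρ (d + 1) f hw hf (fun r hr => (hρ r hr).trans (by omega)) hX
      (fun r hr => hd r (by omega)) (pow_le_of_le hB (by omega))
    simp only [compile, eval] at b ⊢
    set n := e₁.eval w (ρ.map f) with hn
    set g : ℕ → ℕ := fun i => e₂.eval w (i :: ρ.map f) with hg
    change ∑ i ∈ Finset.range n, g i ≤ B at b
    change Trans w B _ f [] (update f d (∑ i ∈ Finset.range n, g i))
    have hsum : ∀ i, ∑ j ∈ Finset.Ico i n, g j ≤ B := fun i => le_trans
      (Finset.sum_le_sum_of_subset (by rw [Finset.range_eq_Ico]; exact Finset.Ico_subset_Ico_left (Nat.zero_le _))) b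
    have hF : ∀ i ≤ n, ∀ x, update (update f (d + 1) i) d (∑ j ∈ Finset.Ico i n, g j) x ≤ B :=
      fun i hi => forall_update_le (forall_update_le hf (hi.trans b₁)) (hsum i)
    have hd0 := hd d le_rfl
    have hd1 := hd (d + 1) (by omega)
    have hd2 := hd (d + 2) (by omega)
    -- Register `d + 1` is at once the loop counter and the summation variable. It is decremented
    -- before the body runs, so it takes the values `n - 1, …, 0`, and when it contains `i` at the
    -- loop test, register `d` holds the terms with index at least `i`.
    have loop := Trans.countdown_nil (w := w) (B := B) (r := d + 1)
      (P := .seq (.act (.dec (d + 1))) (.seq (e₂.compile ((d + 1) :: ρ) (d + 2)) (addTo (d + 2) d)))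
      (fun i => update (update f (d + 1) i) d (∑ j ∈ Finset.Ico i n, g j)) n
      (fun i hi => by simp) (fun i hi => ?_)
    · have e1 : update (update f (d + 1) n) d (∑ j ∈ Finset.Ico n n, g j) = update f (d + 1) n := by
        rw [Finset.Ico_self, Finset.sum_empty]
        refine update_eq_self_iff.2 ?_
        rw [update_of_ne (by omega), hd0]
      have e2 : update f (d + 1) 0 = f := update_eq_self_iff.2 hd1.symm
      simp only [e1, e2, ← Finset.range_eq_Ico] at loop
      exact t₁.seq_nil loop
    · have f₁ := hF (i + 1) hi
      have f₂ : ∀ x, update (update f (d + 1) i) d (∑ j ∈ Finset.Ico (i + 1) n, g j) x ≤ B :=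
        forall_update_le (forall_update_le hf (hi.le.trans b₁)) (hsum _)
      have t₂ := h₂ w ((X + 2) ^ (v₁ + 1)) B ((d + 1) :: ρ) (d + 2) _ (hw.trans hXX) f₂
        (fun r hr => by
          rcases List.mem_cons.1 hr with rfl | hr
          · omega
          · exact (hρ r hr).trans (by omega))
        (fun r hr => by
          rcases List.mem_cons.1 hr with rfl | hr
          · simp only [update_of_ne (show d + 1 ≠ d by omega), update_self]; omega
          · have := hρ r hr
            rw [update_of_ne (by omega), update_of_ne (by omega)]
            exact (hX r hr).trans hXX)
        (fun r hr => by rw [update_of_ne (by omega), update_of_ne (by omega)]; exact hd r (by omega))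
        ((pow_pow_le _ _ _).trans (pow_le_of_le hB (by omega)))
      rw [List.map_cons, map_update_of_lt _ _ hρ le_rfl, map_update_of_lt _ _ hρ (by omega),
        update_of_ne (show d + 1 ≠ d by omega), update_self] at t₂
      have hgi : e₂.eval w (i :: ρ.map f) = g i := rfl
      rw [hgi] at t₂
      have hIco : ∑ j ∈ Finset.Ico i n, g j = ∑ j ∈ Finset.Ico (i + 1) n, g j + g i := by
        rw [Finset.sum_eq_sum_Ico_succ_bot hi, add_comm]
      have hgB : g i ≤ B := by have := hsum i; omega
      refine ((Trans.dec f₁ (d + 1)).congr ?_).seq_nil (t₂.seq_nil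
        ((trans_addTo (forall_update_le f₂ hgB) (by omega) ?_).congr ?_))
      · funext x
        simp only [update_apply]
        split_ifs <;> omega
      · simp only [update_self, update_of_ne (show d ≠ d + 2 by omega)]
        rw [← hIco]; exact hsum i
      · rw [hIco]
        funext x
        simp only [update_apply]
        split_ifs <;> first | omega | simp_all

end Expr

end CayleyNL

/-! ### Logarithmic-space functions given by expressions -/

namespace CayleyNL

open Prog Function

/-- Expressions are bounded in terms of `X = n + 1`, the largest head position, and register
programs in terms of `n + 2`. Doubling the exponent converts one bound into the other. -/
theorem add_three_pow_le (n a c : ℕ) (h : 2 * a ≤ c) : (n + 1 + 2) ^ a ≤ (n + 2) ^ c := by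
  have h1 : n + 1 + 2 ≤ (n + 2) ^ 2 := by nlinarith
  exact (Nat.pow_le_pow_left h1 a).trans
    ((pow_mul _ _ _).symm.le.trans (Nat.pow_le_pow_right (by omega) h))

/-- Functions given by expressions for the length and for the bits of the result are computable in
logarithmic space. -/
theorem logSpaceComputable_of_expr (eL eb : Expr) (f : List Bool → List Bool)
    (hf : ∀ w, f w = (List.range (eL.eval w [])).map fun i => decide (eb.eval w [i] ≠ 0)) :
    LogSpaceComputable f := by
  obtain ⟨cL, hcL⟩ := eL.exists_trans_compile
  obtain ⟨cb, hcb⟩ := eb.exists_trans_compile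
  obtain ⟨vL, hvL⟩ := eL.exists_eval_le
  obtain ⟨vb, hvb⟩ := eb.exists_eval_le
  have hdL := eL.det_compile [] 0
  have hdb := eb.det_compile [1] 2
  refine RegProg.logSpaceComputable (P := .seq (eL.compile [] 0) (.loop (.nonzero 0)
    (.seq (.act (.dec 0)) (.seq (eb.compile [1] 2) (.seq
      (.branch (.nonzero 2) (.seq (clear 2) (.act (.out true))) (.act (.out false)))
      (.act (.inc 1))))))) (by simp [Det, clear, hdL, hdb]) f
    (2 * (cL + (vL + 2) * cb + (vL + 2) * (vb + 1) + (vL + 1))) fun w => ?_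
  -- The index of an output bit can be as large as `(w.length + 1 + 2) ^ (vL + 1)`. By
  -- `Expr.pow_pow_le` this multiplies the exponents needed for `eb` by `vL + 2`; the factor two
  -- comes from `add_three_pow_le`.
  set B := (w.length + 2) ^ (2 * (cL + (vL + 2) * cb + (vL + 2) * (vb + 1) + (vL + 1))) with hB
  have h1 := hcL w (w.length + 1) B [] 0 (fun _ => 0) le_rfl (fun _ => Nat.zero_le _) (by simp)
    (by simp) (by simp) (add_three_pow_le _ _ _ (by nlinarith))
  have hLX := hvL w (w.length + 1) [] le_rfl (by simp)
  have hLB := hLX.trans (add_three_pow_le _ _ (2 * (cL + (vL + 2) * cb + (vL + 2) * (vb + 1) +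
    (vL + 1))) (by nlinarith))
  rw [List.map_nil] at h1
  rw [hf]
  set n := eL.eval w [] with hn
  have hF : ∀ i ≤ n, ∀ x, update (update (fun _ => 0) 0 i) 1 (n - i) x ≤ B := fun i hi =>
    forall_update_le (forall_update_le (fun _ => Nat.zero_le _) (hi.trans hLB))
      ((Nat.sub_le _ _).trans hLB)
  -- Register 0 counts the bits still to be written, register 1 is the index of the next one, and
  -- register 2 receives its value. With `i` bits left, the remaining output has the indices from `n
  -- - i` on.
  have loop := Trans.countdown (w := w) (B := B) (r := 0)
    (P := .seq (.act (.dec 0)) (.seq (eb.compile [1] 2) (.seq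
      (.branch (.nonzero 2) (.seq (clear 2) (.act (.out true))) (.act (.out false)))
      (.act (.inc 1)))))
    (fun i => update (update (fun _ => 0) 0 i) 1 (n - i))
    (fun i => (List.range' (n - i) i).map fun i => decide (eb.eval w [i] ≠ 0)) n
    (by simp) (by simp) (fun i hi => ⟨[decide (eb.eval w [n - (i + 1)] ≠ 0)], ?_, ?_⟩)
  · have e1 : update (update (fun _ => 0) 0 n) 1 (n - n) = update (fun _ => 0) 0 n :=
      update_eq_self_iff.2 (by simp)
    simp only [e1] at loop
    rw [Nat.sub_self, ← List.range_eq_range'] at loop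
    obtain ⟨p, -, hp⟩ := (h1.seq_nil loop) 0 (Nat.zero_le _)
    exact ⟨_, hp⟩
  · set j := n - (i + 1) with hj
    have f₁ := hF (i + 1) hi
    have f₂ : ∀ x, update (update (fun _ => 0) 0 i) 1 j x ≤ B :=
      forall_update_le (forall_update_le (fun _ => Nat.zero_le _) (hi.le.trans hLB)) (by omega)
    have hXX := Expr.le_pow_succ (w.length + 1) vL
    have henv : ∀ r ∈ [1], update (update (fun _ => 0) 0 i) 1 j r ≤
        (w.length + 1 + 2) ^ (vL + 1) := by
      simp; omega
    have t₂ := hcb w ((w.length + 1 + 2) ^ (vL + 1)) B [1] 2 _ hXX f₂ (by simp) henv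
      (fun r hr => by rw [update_of_ne (by omega), update_of_ne (by omega)])
      ((Expr.pow_pow_le _ _ _).trans (add_three_pow_le _ _ _ (by nlinarith)))
    have hv := (hvb w ((w.length + 1 + 2) ^ (vL + 1)) [j] hXX (by simp; omega)).trans
      ((Expr.pow_pow_le _ _ _).trans (add_three_pow_le _ _ (2 * (cL + (vL + 2) * cb +
        (vL + 2) * (vb + 1) + (vL + 1))) (by nlinarith)))
    simp only [List.map_cons, List.map_nil, update_self] at t₂
    have t₃ : Trans w B (.branch (.nonzero 2) (.seq (clear 2) (.act (.out true)))
        (.act (.out false))) (update (update (update (fun _ => 0) 0 i) 1 j) 2 (eb.eval w [j]))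
        [decide (eb.eval w [j] ≠ 0)] (update (update (fun _ => 0) 0 i) 1 j) := by
      by_cases h0 : eb.eval w [j] = 0
      · refine Trans.branch_false (by simp [h0]) ?_
        rw [h0, update_eq_self_iff.2 (by simp)]
        simpa using Trans.out f₂ false
      · refine Trans.branch_true (by simp [h0]) (((trans_clear (forall_update_le f₂ hv) 2).congr
          (f'' := update (update (fun _ => 0) 0 i) 1 j) ?_).seq_nil ?_)
        · rw [update_idem, update_eq_self_iff.2 (by simp)]
        · simpa [h0] using Trans.out f₂ true
    have t₄ := (Trans.inc (w := w) f₂ (r := 1) (by simp; omega))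
    have := ((Trans.dec (w := w) f₁ 0).congr (f'' := update (update (fun _ => 0) 0 i) 1 j) (by
      funext x
      simp only [update_apply]
      split_ifs <;> first | omega | simp_all)).seq_nil (t₂.seq_nil (t₃.seq t₄))
    rw [List.append_nil] at this
    refine this.congr ?_
    rw [update_self, update_idem, hj, show n - (i + 1) + 1 = n - i by omega]
  · rw [show n - i = n - (i + 1) + 1 by omega]
    simp [List.range'_succ]

/-! ### Guessing numbers and graph reachability -/

section Nondeterministic

variable {w : List Bool} {B : ℕ}

theorem Trans.wlp {P : RegProg} {f f' : ℕ → ℕ} {o : List Bool} (h : Trans w B P f o f')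
    (hd : P.Det) {Q : RegState → Prop} {p : ℕ} (hp : p ≤ w.length + 1)
    (hQ : ∀ p' ≤ w.length + 1, Q ⟨f', p'⟩) : wlp (regSem w B) P Q ⟨f, p⟩ := by
  obtain ⟨p', hp', h1⟩ := h p hp
  exact wlp_of_exec h1 hd (hQ p' hp')

/-- Store a number in register `r` which is at most the length of the input plus one. -/
def guess (r : ℕ) : RegProg :=
  .seq headHome (.loop .notRightEnd (.seq (.act .right) (.choice .skip (.act (.inc r)))))

/-- The head crosses the input and each step may increment the register. The value `v` is produced
by incrementing during the first `v` steps, so the register holds the minimum of `v` and the head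
position. -/
theorem trans_guess {f : ℕ → ℕ} (hf : ∀ r, f r ≤ B) {r : ℕ} (hr : f r = 0)
    (hB : w.length + 1 ≤ B) {v : ℕ} (hv : v ≤ w.length + 1) :
    Trans w B (guess r) f [] (update f r v) := by
  have key : ∀ i ≤ w.length + 1, Exec (regSem w B)
      (.loop .notRightEnd (.seq (.act .right) (.choice .skip (.act (.inc r)))))
      ⟨update f r (min (w.length + 1 - i) v), w.length + 1 - i⟩ [] ⟨update f r v, w.length + 1⟩ := by
    intro i
    induction i with
    | zero =>
      intro _
      rw [Nat.sub_zero, min_eq_right hv]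
      exact .loop_false fun h => by simpa using readInput_ne_rightEnd.1 h
    | succ i ih =>
      intro hi
      have hle : ∀ x, update f r (min (w.length + 1 - (i + 1)) v) x ≤ B :=
        forall_update_le hf (by omega)
      have h1 := exec_right (w := w) (p := w.length + 1 - (i + 1)) hle
      rw [min_eq_left (by omega : w.length + 1 - (i + 1) + 1 ≤ w.length + 1),
        show w.length + 1 - (i + 1) + 1 = w.length + 1 - i by omega] at h1
      refine .loop_true (o := []) (readInput_ne_rightEnd.2 (show w.length + 1 - (i + 1) ≤ _ by omega))
        (.seq_nil h1 ?_) (ih (by omega))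
      rcases le_or_gt v (w.length + 1 - (i + 1)) with h | h
      · rw [min_eq_right h, min_eq_right (by omega)]
        exact .choice_left (.skip _)
      · have h2 := exec_inc (w := w) (r := r) (p := w.length + 1 - i) hle
          (by rw [update_self]; omega) (by omega)
        rw [update_self, update_idem, show min (w.length + 1 - (i + 1)) v + 1 =
          min (w.length + 1 - i) v by omega] at h2
        exact .choice_right h2
  refine fun p hp => ⟨w.length + 1, le_rfl, .seq_nil (exec_headHome hf p hp) ?_⟩
  have := key (w.length + 1) le_rfl
  rwa [Nat.sub_self, Nat.zero_min, update_eq_self_iff.2 hr.symm] at this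

/-- Whatever choices are made, the register never exceeds the head position. -/
theorem wlp_guess {f : ℕ → ℕ} (hf : ∀ r, f r ≤ B) {r : ℕ} (hr : f r = 0)
    (hB : w.length + 1 ≤ B) {Q : RegState → Prop} {p : ℕ} (hp : p ≤ w.length + 1)
    (hQ : ∀ v ≤ w.length + 1, ∀ p ≤ w.length + 1, Q ⟨update f r v, p⟩) :
    wlp (regSem w B) (guess r) Q ⟨f, p⟩ := by
  refine wlp_of_exec (exec_headHome hf p hp) (by simp [headHome, Det])
    ⟨fun s => ∃ v p, s = ⟨update f r v, p⟩ ∧ v ≤ p ∧ p ≤ w.length + 1,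
      ⟨0, 0, by rw [update_eq_self_iff.2 hr.symm], le_rfl, Nat.zero_le _⟩, ?_⟩
  rintro _ ⟨v, p, rfl, hvp, hp⟩
  refine ⟨fun ht => ?_, fun _ => hQ v (hvp.trans hp) p hp⟩
  have hp' : p ≤ w.length := readInput_ne_rightEnd.1 ht
  have hle : ∀ x, update f r v x ≤ B := forall_update_le hf (by omega)
  refine wlp_of_exec (exec_right hle) trivial ?_
  rw [min_eq_left (by omega)]
  refine ⟨⟨v, p + 1, rfl, by omega, by omega⟩, ?_⟩
  refine wlp_of_exec (exec_inc hle (by rw [update_self]; omega) (by omega)) trivial ?_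
  exact ⟨v + 1, p + 1, by simp, by omega, by omega⟩

/-- Continue only if the value of an expression is not zero. -/
def assume (e : Expr) (ρ : List ℕ) (d : ℕ) : RegProg :=
  .seq (e.compile ρ d) (.branch (.nonzero d) (clear d) .fail)

/-- The two halves are completeness and soundness of the test: a nonzero value lets the program pass
with all registers restored, and a zero value leads to `fail`, where nothing has to be shown. -/
theorem exists_assume (e : Expr) : ∃ c, ∀ (w : List Bool) (X B : ℕ) (ρ : List ℕ) (d : ℕ)
    (f : ℕ → ℕ), w.length + 1 ≤ X → (∀ r, f r ≤ B) → (∀ r ∈ ρ, r < d) → (∀ r ∈ ρ, f r ≤ X) →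
    (∀ r, d ≤ r → f r = 0) → (X + 2) ^ c ≤ B →
    (e.eval w (ρ.map f) ≠ 0 → Trans w B (assume e ρ d) f [] f) ∧
    ∀ (Q : RegState → Prop) (p : ℕ), p ≤ w.length + 1 →
      (e.eval w (ρ.map f) ≠ 0 → ∀ p ≤ w.length + 1, Q ⟨f, p⟩) →
      wlp (regSem w B) (assume e ρ d) Q ⟨f, p⟩ := by
  obtain ⟨c, hc⟩ := e.exists_trans_compile
  obtain ⟨v, hv⟩ := e.exists_eval_le
  refine ⟨c + (v + 1), fun w X B ρ d f hw hf hρ hX hd hB => ?_⟩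
  have h := hc w X B ρ d f hw hf hρ hX hd (Expr.pow_le_of_le hB (by omega))
  have hvB := (hv w X (ρ.map f) hw (by simpa using hX)).trans (Expr.pow_le_of_le hB (by omega))
  have hclear := trans_clear (w := w) (forall_update_le (r := d) hf hvB) d
  rw [update_idem, show update f d 0 = f from update_eq_self_iff.2 (hd d le_rfl).symm] at hclear
  refine ⟨fun h0 => h.seq_nil (Trans.branch_true (by simpa using h0) hclear), ?_⟩
  intro Q p hp hQ
  refine h.wlp (e.det_compile ρ d) hp fun p' hp' => ⟨fun ht => ?_, fun _ => trivial⟩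
  have h0 : e.eval w (ρ.map f) ≠ 0 := by simpa [regSem] using ht
  exact hclear.wlp (by simp [clear, Det]) hp' (hQ h0)

/-- The registers of the reachability program. -/
def searchRegs (x y t : ℕ) : ℕ → ℕ
  | 0 => x
  | 1 => y
  | 2 => t
  | _ => 0

theorem update_searchRegs_zero (x y t v : ℕ) :
    update (searchRegs x y t) 0 v = searchRegs v y t := by
  funext r; rcases r with _ | _ | _ | r <;> simp [searchRegs]

theorem update_searchRegs_one (x y t v : ℕ) :
    update (searchRegs x y t) 1 v = searchRegs x v t := by
  funext r; rcases r with _ | _ | _ | r <;> simp [searchRegs]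

theorem update_searchRegs_two (x y t v : ℕ) :
    update (searchRegs x y t) 2 v = searchRegs x y v := by
  funext r; rcases r with _ | _ | _ | r <;> simp [searchRegs]

theorem searchRegs_le {x y t : ℕ} (hx : x ≤ B) (hy : y ≤ B) (ht : t ≤ B) (r : ℕ) :
    searchRegs x y t r ≤ B := by
  rcases r with _ | _ | _ | r <;> simp [searchRegs, hx, hy, ht]

theorem searchRegs_eq_zero {x y t : ℕ} (r : ℕ) (hr : 3 ≤ r) : searchRegs x y t r = 0 := by
  obtain ⟨r, rfl⟩ := Nat.exists_eq_add_of_le' hr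
  rfl

end Nondeterministic

/-- Reachability in graphs on `{0, …, n + 1}` which are given by expressions is in `NL`. -/
theorem reachability_mem_NL (start edge final : Expr) :
    {w : List Bool | ∃ x y, x ≤ w.length + 1 ∧ start.eval w [x] ≠ 0 ∧
      Relation.ReflTransGen (fun x y => y ≤ w.length + 1 ∧ edge.eval w [y, x] ≠ 0) x y ∧
      final.eval w [y] ≠ 0} ∈ NL := by
  obtain ⟨c₁, h₁⟩ := exists_assume start
  obtain ⟨c₂, h₂⟩ := exists_assume edge
  obtain ⟨c₃, h₃⟩ := exists_assume final
  -- Register 0 holds the current vertex, register 1 a guessed successor, and register 2 is a flag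
  -- that is cleared when the search decides to stop. Unbounded searches are harmless because only
  -- space is restricted.
  refine RegProg.mem_NL (.seq (guess 0) (.seq (assume start [0] 3) (.seq (.act (.inc 2)) (.seq
    (.loop (.nonzero 2) (.choice (.act (.dec 2)) (.seq (guess 1) (.seq (assume edge [1, 0] 3)
      (.seq (clear 0) (addTo 1 0)))))) (assume final [0] 3))))) _
    (2 * (c₁ + c₂ + c₃ + 1)) (fun w => ?_) fun w => ?_
  all_goals
    set B := (w.length + 2) ^ (2 * (c₁ + c₂ + c₃ + 1)) with hB
    have hB₁ := add_three_pow_le w.length c₁ (2 * (c₁ + c₂ + c₃ + 1)) (by omega)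
    have hB₂ := add_three_pow_le w.length c₂ (2 * (c₁ + c₂ + c₃ + 1)) (by omega)
    have hB₃ := add_three_pow_le w.length c₃ (2 * (c₁ + c₂ + c₃ + 1)) (by omega)
    have hB₄ := add_three_pow_le w.length 1 (2 * (c₁ + c₂ + c₃ + 1)) (by omega)
    rw [← hB] at hB₁ hB₂ hB₃ hB₄
    rw [pow_one] at hB₄
    have hinit : (fun _ => 0 : ℕ → ℕ) = searchRegs 0 0 0 := by
      funext r; rcases r with _ | _ | _ | r <;> rfl
    rw [hinit]
    have le {x y t : ℕ} (hx : x ≤ w.length + 1) (hy : y ≤ w.length + 1) (ht : t ≤ 1) :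
        ∀ r, searchRegs x y t r ≤ B := searchRegs_le (by omega) (by omega) (by omega)
    have a₁ {x : ℕ} (hx : x ≤ w.length + 1) := h₁ w (w.length + 1) B [0] 3 (searchRegs x 0 0) le_rfl
      (le hx (Nat.zero_le _) zero_le_one) (by simp) (by simpa [searchRegs] using hx)
      searchRegs_eq_zero hB₁
    have a₂ {x y t : ℕ} (hx : x ≤ w.length + 1) (hy : y ≤ w.length + 1) (ht : t ≤ 1) :=
      h₂ w (w.length + 1) B [1, 0] 3 (searchRegs x y t) le_rfl
      (le hx hy ht) (by simp) (by simpa [searchRegs] using ⟨hy, hx⟩)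
      searchRegs_eq_zero hB₂
    have a₃ {x : ℕ} (hx : x ≤ w.length + 1) := h₃ w (w.length + 1) B [0] 3 (searchRegs x 0 0) le_rfl
      (le hx (Nat.zero_le _) zero_le_one) (by simp) (by simpa [searchRegs] using hx)
      searchRegs_eq_zero hB₃
    have g₁ {x : ℕ} : Trans w B (.act (.inc 2)) (searchRegs x 0 0) [] (searchRegs x 0 1) ∨
        w.length + 1 < x := by
      rcases le_or_gt x (w.length + 1) with hx | hx
      · exact .inl ((Trans.inc (le hx (Nat.zero_le _) zero_le_one) (r := 2)
          (by simp only [searchRegs]; omega)).congr (by rw [update_searchRegs_two]; rfl))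
      · exact .inr hx
    have g₂ {x t : ℕ} (hx : x ≤ w.length + 1) (ht : t ≤ 1) : Trans w B (.act (.dec 2))
        (searchRegs x 0 t) [] (searchRegs x 0 (t - 1)) :=
      (Trans.dec (le hx (Nat.zero_le _) ht) 2).congr (by rw [update_searchRegs_two]; rfl)
    have g₃ {x y t : ℕ} (hx : x ≤ w.length + 1) (hy : y ≤ w.length + 1) (ht : t ≤ 1) :
        Trans w B (.seq (clear 0) (addTo 1 0)) (searchRegs x y t) [] (searchRegs y 0 t) := by
      refine ((trans_clear (le hx hy ht) 0).congr (update_searchRegs_zero _ _ _ _)).seq_nil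
        ((trans_addTo (le (Nat.zero_le _) hy ht) (by omega) ?_).congr ?_)
      · simp only [searchRegs]; omega
      · rw [update_searchRegs_one, update_searchRegs_zero]
        simp [searchRegs]
  · refine wlp_guess (le (Nat.zero_le _) (Nat.zero_le _) zero_le_one) rfl (by omega)
      (Nat.zero_le _) fun x hx p hp => ?_
    rw [update_searchRegs_zero]
    refine (a₁ hx).2 _ p hp fun hstart p hp => ?_
    refine (g₁.resolve_right hx.not_gt).wlp trivial hp fun p hp => ?_
    -- Loop invariant: the current vertex is reachable from the guessed start.
    refine ⟨fun s => ∃ y t p, s = ⟨searchRegs y 0 t, p⟩ ∧ y ≤ w.length + 1 ∧ t ≤ 1 ∧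
      p ≤ w.length + 1 ∧ Relation.ReflTransGen
        (fun x y => y ≤ w.length + 1 ∧ edge.eval w [y, x] ≠ 0) x y,
      ⟨x, 1, p, rfl, hx, le_rfl, hp, .refl⟩, ?_⟩
    rintro _ ⟨y, t, p, rfl, hy, ht, hp, hxy⟩
    refine ⟨fun _ => ⟨(g₂ hy ht).wlp trivial hp fun p hp =>
      ⟨y, t - 1, p, rfl, hy, by omega, hp, hxy⟩, ?_⟩, fun ht0 => ?_⟩
    · refine wlp_guess (le hy (Nat.zero_le _) ht) rfl (by omega) hp fun z hz p hp => ?_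
      rw [update_searchRegs_one]
      refine (a₂ hy hz ht).2 _ p hp fun hedge p hp => ?_
      refine (g₃ hy hz ht).wlp (by simp [clear, addTo, Det]) hp fun p hp => ?_
      exact ⟨z, t, p, rfl, hz, ht, hp, hxy.tail ⟨hz, hedge⟩⟩
    · obtain rfl : t = 0 := by simpa [regSem, searchRegs] using ht0
      exact (a₃ hy).2 _ p hp fun hfinal p hp => ⟨x, y, hx, hstart, hxy, hfinal⟩
  · rintro ⟨x, y, hx, hstart, hxy, hfinal⟩
    have hy : y ≤ w.length + 1 := by
      rcases hxy.cases_tail with rfl | ⟨_, -, h, -⟩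
      exacts [hx, h]
    have loop : Trans w B (.loop (.nonzero 2) (.choice (.act (.dec 2)) (.seq (guess 1)
        (.seq (assume edge [1, 0] 3) (.seq (clear 0) (addTo 1 0))))))
        (searchRegs x 0 1) [] (searchRegs y 0 0) := by
      clear hstart
      induction hxy using Relation.ReflTransGen.head_induction_on with
      | refl =>
        exact Trans.loop_true (by simp [searchRegs]) (g₂ hx le_rfl).choice_left
          (Trans.loop_false rfl)
      | @head x z hxz hzy ih =>
        refine Trans.loop_true (by simp [searchRegs]) (Trans.choice_right ?_) (ih hxz.1)
        refine ((trans_guess (le hx (Nat.zero_le _) le_rfl) rfl (by omega) hxz.1).congr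
          (update_searchRegs_one _ _ _ _)).seq_nil ?_
        exact ((a₂ hx hxz.1 le_rfl).1 hxz.2).seq_nil (g₃ hx hxz.1 le_rfl)
    have all := ((trans_guess (w := w) (v := x) (le (Nat.zero_le _) (Nat.zero_le _) zero_le_one)
      (r := 0) rfl (by omega) hx).congr (update_searchRegs_zero _ _ _ _)).seq_nil
      (((a₁ hx).1 hstart).seq_nil ((g₁.resolve_right hx.not_gt).seq_nil
        (loop.seq_nil ((a₃ hy).1 hfinal))))
    obtain ⟨p, -, hp⟩ := all 0 (Nat.zero_le _)
    exact ⟨_, _, hp⟩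

end CayleyNL

namespace CayleyNL

/-! ### Functions definable by expressions -/

/-- Types of tuples which consist of an input word and some numbers. -/
class Context (Γ : Type) where
  word : Γ → List Bool
  vars : Γ → List ℕ

instance : Context (List Bool) := ⟨id, fun _ => []⟩

instance {Γ : Type} [Context Γ] : Context (Γ × ℕ) :=
  ⟨fun γ => Context.word γ.1, fun γ => γ.2 :: Context.vars γ.1⟩

/-- A numerical function which is given by an expression. -/
def Definable {Γ : Type} [Context Γ] (g : Γ → ℕ) : Prop :=
  ∃ e : Expr, ∀ γ, e.eval (Context.word γ) (Context.vars γ) = g γ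

open Classical in
/-- A predicate which is given by an expression. -/
def DefinablePred {Γ : Type} [Context Γ] (p : Γ → Prop) : Prop :=
  Definable fun γ => if p γ then 1 else 0

variable {Γ : Type} [Context Γ]

namespace Definable

theorem of_eq {g h : Γ → ℕ} (hg : Definable g) (e : ∀ γ, g γ = h γ) : Definable h :=
  (funext e : g = h) ▸ hg

theorem var : Definable fun γ : Γ × ℕ => γ.2 := ⟨.top, fun _ => rfl⟩

theorem wk {g : Γ → ℕ} (hg : Definable g) : Definable fun γ : Γ × ℕ => g γ.1 := by
  obtain ⟨e, he⟩ := hg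
  exact ⟨.wk e, fun γ => he γ.1⟩

theorem length : Definable fun γ : Γ => (Context.word γ).length + 1 := ⟨.len, fun _ => rfl⟩

theorem add {g h : Γ → ℕ} (hg : Definable g) (hh : Definable h) :
    Definable fun γ => g γ + h γ := by
  obtain ⟨e, he⟩ := hg
  obtain ⟨d, hd⟩ := hh
  exact ⟨.add e d, fun γ => by rw [Expr.eval, he, hd]⟩

theorem sub {g h : Γ → ℕ} (hg : Definable g) (hh : Definable h) :
    Definable fun γ => g γ - h γ := by
  obtain ⟨e, he⟩ := hg
  obtain ⟨d, hd⟩ := hh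
  exact ⟨.sub e d, fun γ => by rw [Expr.eval, he, hd]⟩

theorem const (c : ℕ) : Definable fun _ : Γ => c := by
  have one : Definable fun _ : Γ => 1 := ⟨.one, fun _ => rfl⟩
  induction c with
  | zero => exact one.sub one
  | succ c ih => exact ih.add one

theorem sum {g : Γ → ℕ} {h : Γ → ℕ → ℕ} (hg : Definable g)
    (hh : Definable fun γ : Γ × ℕ => h γ.1 γ.2) :
    Definable fun γ => ∑ i ∈ Finset.range (g γ), h γ i := by
  obtain ⟨e, he⟩ := hg
  obtain ⟨d, hd⟩ := hh
  exact ⟨.sum e d, fun γ => by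
    rw [Expr.eval, he]; exact Finset.sum_congr rfl fun i _ => hd (γ, i)⟩

/-- Multiplication is a bounded sum with constant terms. -/
theorem mul {g h : Γ → ℕ} (hg : Definable g) (hh : Definable h) :
    Definable fun γ => g γ * h γ :=
  (hg.sum (h := fun γ _ => h γ) hh.wk).of_eq fun γ => by simp

theorem pow {g : Γ → ℕ} (hg : Definable g) (c : ℕ) : Definable fun γ => g γ ^ c := by
  induction c with
  | zero => exact (const 1).of_eq fun γ => by simp
  | succ c ih => exact (ih.mul hg).of_eq fun γ => by rw [pow_succ]

end Definable

namespace DefinablePred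

open Definable

theorem of_iff {p q : Γ → Prop} (hp : DefinablePred p) (e : ∀ γ, p γ ↔ q γ) : DefinablePred q :=
  (funext fun γ => propext (e γ) : p = q) ▸ hp

theorem le {g h : Γ → ℕ} (hg : Definable g) (hh : Definable h) :
    DefinablePred fun γ => g γ ≤ h γ :=
  ((const 1).sub (hg.sub hh)).of_eq fun γ => by split_ifs <;> omega

theorem lt {g h : Γ → ℕ} (hg : Definable g) (hh : Definable h) :
    DefinablePred fun γ => g γ < h γ := le (hg.add (const 1)) hh

theorem not {p : Γ → Prop} (hp : DefinablePred p) : DefinablePred fun γ => ¬ p γ :=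
  ((const 1).sub hp).of_eq fun γ => by by_cases h : p γ <;> simp [h]

theorem and {p q : Γ → Prop} (hp : DefinablePred p) (hq : DefinablePred q) :
    DefinablePred fun γ => p γ ∧ q γ :=
  (Definable.mul hp hq).of_eq fun γ => by
    by_cases h : p γ <;> by_cases h' : q γ <;> simp [h, h']

theorem or {p q : Γ → Prop} (hp : DefinablePred p) (hq : DefinablePred q) :
    DefinablePred fun γ => p γ ∨ q γ :=
  (hp.not.and hq.not).not.of_iff fun γ => by tauto

theorem imp {p q : Γ → Prop} (hp : DefinablePred p) (hq : DefinablePred q) :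
    DefinablePred fun γ => p γ → q γ :=
  (hp.not.or hq).of_iff fun γ => by tauto

theorem iff {p q : Γ → Prop} (hp : DefinablePred p) (hq : DefinablePred q) :
    DefinablePred fun γ => (p γ ↔ q γ) :=
  ((hp.imp hq).and (hq.imp hp)).of_iff fun γ => by tauto

theorem eq {g h : Γ → ℕ} (hg : Definable g) (hh : Definable h) :
    DefinablePred fun γ => g γ = h γ :=
  ((le hg hh).and (le hh hg)).of_iff fun γ => by omega

theorem const (p : Prop) : DefinablePred fun _ : Γ => p := by
  by_cases h : p
  · exact (Definable.const 1).of_eq fun γ => by simp [h]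
  · exact (Definable.const 0).of_eq fun γ => by simp [h]

/-- A bounded existential quantifier says that the sum of the indicators is positive. -/
theorem exists_lt {g : Γ → ℕ} {p : Γ → ℕ → Prop} (hg : Definable g)
    (hp : DefinablePred fun γ : Γ × ℕ => p γ.1 γ.2) :
    DefinablePred fun γ => ∃ i < g γ, p γ i := by
  classical
  refine (lt (Definable.const 0) (hg.sum (h := fun γ i => if p γ i then 1 else 0) ?_)).of_iff ?_
  · exact Definable.of_eq hp fun γ => by congr
  · intro γ
    simp only [Finset.sum_pos_iff, Finset.mem_range]
    refine exists_congr fun i => and_congr_right fun _ => ?_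
    by_cases h : p γ i <;> simp [h]

theorem forall_lt {g : Γ → ℕ} {p : Γ → ℕ → Prop} (hg : Definable g)
    (hp : DefinablePred fun γ : Γ × ℕ => p γ.1 γ.2) :
    DefinablePred fun γ => ∀ i < g γ, p γ i :=
  (exists_lt (p := fun γ i => ¬ p γ i) hg hp.not).not.of_iff fun γ => by push Not; rfl

theorem exists_mem_finset {α : Type} (s : Finset α) {p : α → Γ → Prop}
    (hp : ∀ a, DefinablePred (p a)) : DefinablePred fun γ => ∃ a ∈ s, p a γ := by
  classical
  induction s using Finset.induction_on with
  | empty => exact (const False).of_iff fun γ => by simp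
  | insert a s _ ih => exact ((hp a).or ih).of_iff fun γ => by simp

theorem exists_mem {α : Type} {s : Set α} (hs : s.Finite) {p : α → Γ → Prop}
    (hp : ∀ a, DefinablePred (p a)) : DefinablePred fun γ => ∃ a ∈ s, p a γ :=
  (exists_mem_finset hs.toFinset hp).of_iff fun γ => by simp

theorem exists_finite {α : Type} [Finite α] {p : α → Γ → Prop}
    (hp : ∀ a, DefinablePred (p a)) : DefinablePred fun γ => ∃ a, p a γ :=
  (exists_mem Set.finite_univ hp).of_iff fun γ => by simp

theorem forall_finite {α : Type} [Finite α] {p : α → Γ → Prop}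
    (hp : ∀ a, DefinablePred (p a)) : DefinablePred fun γ => ∀ a, p a γ :=
  (exists_finite fun a => (hp a).not).not.of_iff fun γ => by push Not; rfl

theorem input {g : Γ → ℕ} (hg : Definable g) :
    DefinablePred fun γ => Machine.readInput (Context.word γ) (g γ) = .bit true := by
  obtain ⟨e, he⟩ := hg
  exact ⟨.input e, fun γ => by rw [Expr.eval, he]⟩

theorem getElem {g : Γ → ℕ} (hg : Definable g) :
    DefinablePred fun γ => (Context.word γ)[g γ]? = some true :=
  (input (hg.add (Definable.const 1))).of_iff fun γ => by
    simp only [Machine.readInput]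
    split <;> simp_all

theorem readInput {g : Γ → ℕ} (hg : Definable g) (a : InputSym) :
    DefinablePred fun γ => Machine.readInput (Context.word γ) (g γ) = a := by
  have hl : DefinablePred fun γ => Machine.readInput (Context.word γ) (g γ) = .leftEnd :=
    (eq hg (Definable.const 0)).of_iff fun γ => by
      simpa using (readInput_ne_leftEnd (w := Context.word γ) (p := g γ)).symm.not
  have hr : DefinablePred fun γ => Machine.readInput (Context.word γ) (g γ) = .rightEnd :=
    (le Definable.length hg).of_iff fun γ => by
      have := (readInput_ne_rightEnd (w := Context.word γ) (p := g γ)).symm.not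
      rw [not_le, ne_eq, not_not] at this
      exact this
  match a with
  | .leftEnd => exact hl
  | .rightEnd => exact hr
  | .bit true => exact input hg
  | .bit false =>
    refine ((hl.not.and hr.not).and (input hg).not).of_iff fun γ => ?_
    generalize Machine.readInput (Context.word γ) (g γ) = x
    cases x with
    | bit b => cases b <;> simp
    | _ => simp

end DefinablePred

namespace Definable

theorem ite {p : Γ → Prop} {g h : Γ → ℕ} (hp : DefinablePred p) (hg : Definable g)
    (hh : Definable h) [DecidablePred p] : Definable fun γ => if p γ then g γ else h γ :=
  ((mul hp hg).add (mul hp.not hh)).of_eq fun γ => by by_cases h : p γ <;> simp [h]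

theorem card_filter {g : Γ → ℕ} {p : Γ → ℕ → Prop} (hg : Definable g)
    (hp : DefinablePred fun γ : Γ × ℕ => p γ.1 γ.2) [∀ γ, DecidablePred (p γ)] :
    Definable fun γ => ((Finset.range (g γ)).filter (p γ)).card := by
  refine (hg.sum (h := fun γ i => if p γ i then 1 else 0) ?_).of_eq ?_
  · exact Definable.of_eq hp fun γ => by congr
  · intro γ; rw [Finset.card_filter]

/-- The quotient counts the positive multiples of `h γ` up to `g γ`. The condition `0 < h γ`
produces the value zero for division by zero. -/
theorem div {g h : Γ → ℕ} (hg : Definable g) (hh : Definable h) :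
    Definable fun γ => g γ / h γ := by
  have := card_filter (p := fun γ i => 0 < h γ ∧ (i + 1) * h γ ≤ g γ) hg
    ((DefinablePred.lt (const 0) hh.wk).and
      (DefinablePred.le ((var.add (const 1)).mul hh.wk) hg.wk))
  refine this.of_eq fun γ => ?_
  rcases Nat.eq_zero_or_pos (h γ) with h0 | h0
  · simp [h0]
  · rw [← Finset.card_range (g γ / h γ)]
    congr 1
    ext i
    rw [Finset.mem_filter, Finset.mem_range, Finset.mem_range, ← Nat.le_div_iff_mul_le h0]
    have := Nat.div_le_self (g γ) (h γ)
    omega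

theorem mod {g h : Γ → ℕ} (hg : Definable g) (hh : Definable h) :
    Definable fun γ => g γ % h γ :=
  (hg.sub (hh.mul (hg.div hh))).of_eq fun _ => (Nat.mod_eq_sub _ _).symm

end Definable

/-! ### Powers of two, binary lengths and binary digits -/

/-- A positive number is a power of two exactly if it has no odd prime divisor. The right-hand side
says this with bounded quantifiers, so no exponential function has to be defined. -/
theorem exists_eq_two_pow_iff (q : ℕ) :
    (∃ j, q = 2 ^ j) ↔ q ≠ 0 ∧ ∀ d < q + 1, q % d = 0 → d = 1 ∨ d % 2 = 0 := by
  constructor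
  · rintro ⟨j, rfl⟩
    refine ⟨by positivity, fun d _ hd => ?_⟩
    obtain ⟨i, -, rfl⟩ := (Nat.dvd_prime_pow Nat.prime_two).1 (Nat.dvd_of_mod_eq_zero hd)
    cases i with
    | zero => exact .inl rfl
    | succ i => right; rw [pow_succ]; omega
  · rintro ⟨h0, h⟩
    rcases Nat.eq_two_pow_or_exists_odd_prime_and_dvd q with hq | ⟨p, hp, hpq, hodd⟩
    · exact hq
    · rcases h p (Nat.lt_succ_of_le (Nat.le_of_dvd (by omega) hpq)) (Nat.mod_eq_zero_of_dvd hpq)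
        with h1 | h1
      · exact absurd h1 hp.one_lt.ne'
      · rw [Nat.odd_iff] at hodd; omega

-- The powers of two below `n` are those with exponent below `⌈log₂ n⌉`; counting them makes the
-- logarithm definable.
open Classical in
theorem card_two_pow_lt (n : ℕ) :
    ((Finset.range n).filter fun q => ∃ j, q = 2 ^ j).card = Nat.clog 2 n := by
  rw [← Finset.card_range (Nat.clog 2 n),
    ← Finset.card_image_of_injective (Finset.range (Nat.clog 2 n)) (Nat.pow_right_injective le_rfl)]
  congr 1
  ext q
  simp only [Finset.mem_filter, Finset.mem_range, Finset.mem_image]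
  constructor
  · rintro ⟨h, j, rfl⟩
    exact ⟨j, (Nat.lt_clog_iff_pow_lt (by norm_num)).2 h, rfl⟩
  · rintro ⟨j, h, rfl⟩
    exact ⟨(Nat.lt_clog_iff_pow_lt (by norm_num)).1 h, j, rfl⟩

theorem DefinablePred.two_pow {g : Γ → ℕ} (hg : Definable g) :
    DefinablePred fun γ => ∃ j, g γ = 2 ^ j := by
  refine (((eq hg (.const 0)).not).and
    (forall_lt (p := fun γ d => g γ % d = 0 → d = 1 ∨ d % 2 = 0) (hg.add (.const 1)) ?_)).of_iff
    fun γ => (exists_eq_two_pow_iff _).symm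
  exact (eq (hg.wk.mod .var) (.const 0)).imp
    ((eq .var (.const 1)).or (eq (Definable.var.mod (.const 2)) (.const 0)))

theorem Definable.clog {g : Γ → ℕ} (hg : Definable g) : Definable fun γ => Nat.clog 2 (g γ) := by
  classical
  exact (hg.card_filter (p := fun _ q => ∃ j, q = 2 ^ j) (DefinablePred.two_pow .var)).of_eq
    fun _ => by rw [← card_two_pow_lt]

/-- The number `2 ^ h γ` is described as the power of two whose logarithm is `h γ`. A search up to
`g γ` suffices, since the bit is zero if this power is larger. -/
theorem DefinablePred.testBit {g h : Γ → ℕ} (hg : Definable g) (hh : Definable h) :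
    DefinablePred fun γ => (g γ).testBit (h γ) = true := by
  refine (exists_lt (p := fun γ q => ((∃ j, q = 2 ^ j) ∧ Nat.clog 2 q = h γ) ∧ g γ / q % 2 = 1)
    (hg.add (.const 1)) (((two_pow .var).and (eq Definable.var.clog hh.wk)).and
      (eq ((hg.wk.div .var).mod (.const 2)) (.const 1)))).of_iff fun γ => ?_
  rw [Nat.testBit_eq_decide_div_mod_eq, decide_eq_true_iff]
  constructor
  · rintro ⟨_, -, ⟨⟨j, rfl⟩, hj⟩, h⟩
    rw [Nat.clog_pow _ _ (by norm_num)] at hj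
    rwa [← hj]
  · intro hb
    refine ⟨2 ^ h γ, ?_, ⟨⟨_, rfl⟩, Nat.clog_pow _ _ (by norm_num)⟩, hb⟩
    by_contra hlt
    rw [Nat.div_eq_of_lt (by omega)] at hb
    omega

open Classical in
/-- Functions with definable length and definable bits are computable in logarithmic space. -/
theorem LogSpaceComputable.of_definable {len : List Bool → ℕ} {bit : List Bool → ℕ → Prop}
    (hlen : Definable len) (hbit : DefinablePred fun γ : List Bool × ℕ => bit γ.1 γ.2) :
    LogSpaceComputable fun w => (List.range (len w)).map fun i => decide (bit w i) := by
  obtain ⟨eL, hL⟩ := hlen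
  obtain ⟨eb, hb⟩ := hbit
  refine logSpaceComputable_of_expr eL eb _ fun w => ?_
  have h1 : eL.eval w [] = len w := hL w
  rw [h1]
  refine List.map_congr_left fun i _ => ?_
  have h2 : eb.eval w [i] = if bit w i then 1 else 0 := hb (w, i)
  rw [h2]
  by_cases h : bit w i <;> simp [h]

/-- Reachability in definable graphs on `{0, …, n + 1}` is in `NL`. -/
theorem reachability_mem_NL_of_definable {start final : List Bool → ℕ → Prop}
    {edge : List Bool → ℕ → ℕ → Prop}
    (hs : DefinablePred fun γ : List Bool × ℕ => start γ.1 γ.2)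
    (he : DefinablePred fun γ : (List Bool × ℕ) × ℕ => edge γ.1.1 γ.1.2 γ.2)
    (hf : DefinablePred fun γ : List Bool × ℕ => final γ.1 γ.2) :
    {w : List Bool | ∃ x y, x ≤ w.length + 1 ∧ start w x ∧
      Relation.ReflTransGen (fun x y => y ≤ w.length + 1 ∧ edge w x y) x y ∧ final w y} ∈ NL := by
  obtain ⟨es, hs⟩ := hs
  obtain ⟨ee, he⟩ := he
  obtain ⟨ef, hf⟩ := hf
  convert reachability_mem_NL es ee ef using 3 with w
  have h1 : ∀ x, es.eval w [x] ≠ 0 ↔ start w x := fun x => by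
    have := hs (w, x)
    change es.eval w [x] = _ at this
    rw [this]; simp
  have h2 : ∀ x y, ee.eval w [y, x] ≠ 0 ↔ edge w x y := fun x y => by
    have := he ((w, x), y)
    change ee.eval w [y, x] = _ at this
    rw [this]; simp
  have h3 : ∀ x, ef.eval w [x] ≠ 0 ↔ final w x := fun x => by
    have := hf (w, x)
    change ef.eval w [x] = _ at this
    rw [this]; simp
  simp only [h1, h2, h3]

end CayleyNL

namespace CayleyNL

/-! ### The encoding of instances -/

theorem length_flatMap_const {α β : Type} {l : List α} {f : α → List β} {c : ℕ}
    (h : ∀ a ∈ l, (f a).length = c) : (l.flatMap f).length = l.length * c := by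
  rw [List.length_flatMap, List.map_congr_left h]; simp

theorem getElem?_flatMap_const {α β : Type} {l : List α} {f : α → List β} {c : ℕ}
    (h : ∀ a ∈ l, (f a).length = c) {i b : ℕ} (hi : i < l.length) (hb : b < c) :
    (l.flatMap f)[i * c + b]? = (f l[i])[b]? := by
  induction l generalizing i with
  | nil => simp at hi
  | cons a l ih =>
    have ha : (f a).length = c := h a (by simp)
    rw [List.flatMap_cons]
    cases i with
    | zero => rw [List.getElem?_append_left (by omega)]; simp
    | succ i =>
      rw [Nat.succ_mul, List.getElem?_append_right (by omega), ha,
        show i * c + c + b - c = i * c + b by omega,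
        ih (fun a ha => h a (by simp [ha])) (by simpa using hi)]
      rfl

theorem length_encodeElement {N : ℕ} (i : Fin N) : (encodeElement i).length = Nat.clog 2 N := by
  simp [encodeElement]

theorem getElem?_encodeElement {N : ℕ} (i : Fin N) {b : ℕ} (hb : b < Nat.clog 2 N) :
    (encodeElement i)[b]? = some (Nat.testBit i b) := by
  simp [encodeElement, hb]

namespace MembershipInstance

variable {V : (S : Type) → [Semigroup S] → Prop} (I : MembershipInstance V)

/-- The multiplication table part of the encoding. -/
def table : List Bool :=
  (List.finRange I.N).flatMap fun i => (List.finRange I.N).flatMap fun j =>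
    encodeElement (I.num (I.num.symm i * I.num.symm j))

theorem length_row (i : Fin I.N) : ((List.finRange I.N).flatMap fun j =>
    encodeElement (I.num (I.num.symm i * I.num.symm j))).length = I.N * Nat.clog 2 I.N := by
  rw [length_flatMap_const fun _ _ => length_encodeElement _, List.length_finRange]

theorem length_table : I.table.length = I.N * I.N * Nat.clog 2 I.N := by
  rw [table, length_flatMap_const fun _ _ => I.length_row _, List.length_finRange, mul_assoc]

theorem encode_eq : I.encode = I.table ++ ((List.finRange I.N).map
    (fun i => (@decide (I.num.symm i ∈ I.X) (Classical.propDecidable _))) ++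
      encodeElement (I.num I.t)) := by
  rw [← List.append_assoc]; rfl

theorem length_encode :
    I.encode.length = I.N * I.N * Nat.clog 2 I.N + I.N + Nat.clog 2 I.N := by
  rw [encode_eq, List.length_append, List.length_append, length_table, List.length_map,
    List.length_finRange, length_encodeElement, add_assoc]

theorem encode_table (i j : Fin I.N) {b : ℕ} (hb : b < Nat.clog 2 I.N) :
    I.encode[(i * I.N + j) * Nat.clog 2 I.N + b]? =
      some (Nat.testBit (I.num (I.num.symm i * I.num.symm j)) b) := by
  have hN : (i * I.N + j : ℕ) + 1 ≤ I.N * I.N := by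
    have := i.2
    have := j.2
    nlinarith
  have hlt : ((i * I.N + j) * Nat.clog 2 I.N + b : ℕ) < I.table.length := by
    rw [length_table]
    have := Nat.mul_le_mul_right (Nat.clog 2 I.N) hN
    rw [Nat.succ_mul] at this
    omega
  have hjb : (j * Nat.clog 2 I.N + b : ℕ) < I.N * Nat.clog 2 I.N := by
    have := Nat.mul_le_mul_right (Nat.clog 2 I.N) (Nat.succ_le_of_lt j.2)
    rw [Nat.succ_mul] at this
    omega
  rw [encode_eq, List.getElem?_append_left hlt, table,
    show ((i * I.N + j) * Nat.clog 2 I.N + b : ℕ) =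
      i * (I.N * Nat.clog 2 I.N) + (j * Nat.clog 2 I.N + b) by ring,
    getElem?_flatMap_const (fun _ _ => I.length_row _) (by simp) hjb,
    getElem?_flatMap_const (fun _ _ => length_encodeElement _) (by simp) hb,
    getElem?_encodeElement _ hb]
  simp

open Classical in
theorem encode_generator (i : Fin I.N) :
    I.encode[I.N * I.N * Nat.clog 2 I.N + i]? = some (decide (I.num.symm i ∈ I.X)) := by
  rw [encode_eq, List.getElem?_append_right (by rw [length_table]; omega), length_table,
    Nat.add_sub_cancel_left, List.getElem?_append_left (by simp)]
  simp

theorem encode_target {b : ℕ} (hb : b < Nat.clog 2 I.N) :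
    I.encode[I.N * I.N * Nat.clog 2 I.N + I.N + b]? = some (Nat.testBit (I.num I.t) b) := by
  rw [encode_eq, List.getElem?_append_right (by rw [length_table]; omega), length_table,
    List.getElem?_append_right (by simp; omega), List.length_map, List.length_finRange,
    show ∀ x, x + I.N + b - x - I.N = b by omega, getElem?_encodeElement _ hb]

end MembershipInstance

/-! ### Membership in `NL` -/

open Classical in
/-- The order of the semigroup, computed from the length of the input. -/
noncomputable def order (w : List Bool) : ℕ :=
  ∑ i ∈ Finset.range (w.length + 1),
    if i * i * Nat.clog 2 i + i + Nat.clog 2 i = w.length then i else 0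

/-- The length of an encoding is strictly increasing in the order, so the order can be recovered
from the length alone and only one term of the sum survives. -/
theorem order_encode {V : (S : Type) → [Semigroup S] → Prop} (I : MembershipInstance V) :
    order I.encode = I.N := by
  have mono : StrictMono fun i => i * i * Nat.clog 2 i + i + Nat.clog 2 i := by
    refine strictMono_nat_of_lt_succ fun i => ?_
    have h1 : Nat.clog 2 i ≤ Nat.clog 2 (i + 1) := Nat.clog_mono_right _ (by omega)
    have h2 : i * i * Nat.clog 2 i ≤ (i + 1) * (i + 1) * Nat.clog 2 (i + 1) :=
      Nat.mul_le_mul (Nat.mul_le_mul (by omega) (by omega)) h1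
    omega
  rw [order, I.length_encode, Finset.sum_eq_single I.N]
  · simp
  · intro i _ hi
    rw [if_neg fun h => hi (mono.injective h)]
  · intro h
    exact absurd (Finset.mem_range.2 (by omega)) h

/-- Element `x` is a generator. -/
def IsGenerator (w : List Bool) (x : ℕ) : Prop :=
  x < order w ∧ w[order w * order w * Nat.clog 2 (order w) + x]? = some true

/-- Element `y` is the product of `x` and a generator. -/
def IsSuccessor (w : List Bool) (x y : ℕ) : Prop :=
  y < order w ∧ ∃ z < order w, IsGenerator w z ∧ ∀ b < Nat.clog 2 (order w),
    (y.testBit b = true ↔ w[(x * order w + z) * Nat.clog 2 (order w) + b]? = some true)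

/-- Element `y` is the target. -/
def IsTarget (w : List Bool) (y : ℕ) : Prop :=
  ∀ b < Nat.clog 2 (order w), (y.testBit b = true ↔
    w[order w * order w * Nat.clog 2 (order w) + order w + b]? = some true)

section

open Definable

theorem definable_order : Definable order := by
  classical
  refine Definable.sum (h := fun w i => if i * i * Nat.clog 2 i + i + Nat.clog 2 i = w.length
    then i else 0) (Definable.length (Γ := List Bool)) (Definable.ite (DefinablePred.eq
    (((var.mul var).mul var.clog).add var |>.add var.clog) ?_) var (const 0))
  exact ((length (Γ := List Bool × ℕ)).sub (const 1)).of_eq fun γ => rfl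

theorem definable_isGenerator {Γ : Type} [Context Γ] {g : Γ → ℕ} (hg : Definable g)
    (ho : Definable fun γ : Γ => order (Context.word γ)) :
    DefinablePred fun γ => IsGenerator (Context.word γ) (g γ) :=
  (DefinablePred.lt hg ho).and (DefinablePred.getElem (((ho.mul ho).mul ho.clog).add hg))

theorem definable_isSuccessor :
    DefinablePred fun γ : (List Bool × ℕ) × ℕ => IsSuccessor γ.1.1 γ.1.2 γ.2 := by
  have ho := definable_order.wk.wk
  refine (DefinablePred.lt var ho).and (DefinablePred.exists_lt
    (p := fun γ z => IsGenerator γ.1.1 z ∧ ∀ b < Nat.clog 2 (order γ.1.1), (γ.2.testBit b = true ↔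
      γ.1.1[(γ.1.2 * order γ.1.1 + z) * Nat.clog 2 (order γ.1.1) + b]? = some true)) ho
    ((definable_isGenerator (Γ := ((List Bool × ℕ) × ℕ) × ℕ) var ho.wk).and
      (DefinablePred.forall_lt (p := fun γ b => (γ.1.2.testBit b = true ↔
      γ.1.1.1[(γ.1.1.2 * order γ.1.1.1 + γ.2) * Nat.clog 2 (order γ.1.1.1) + b]? = some true))
      ho.wk.clog ?_)))
  refine (DefinablePred.testBit var.wk.wk var).iff ?_
  exact DefinablePred.getElem (Γ := (((List Bool × ℕ) × ℕ) × ℕ) × ℕ)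
    ((((var.wk.wk.wk.mul ho.wk.wk).add var.wk).mul ho.wk.wk.clog).add var)

theorem definable_isTarget : DefinablePred fun γ : List Bool × ℕ => IsTarget γ.1 γ.2 := by
  have ho := definable_order.wk
  refine DefinablePred.forall_lt (p := fun γ b => (γ.2.testBit b = true ↔
    γ.1[order γ.1 * order γ.1 * Nat.clog 2 (order γ.1) + order γ.1 + b]? = some true)) ho.clog
    ((DefinablePred.testBit var.wk var).iff ?_)
  exact DefinablePred.getElem (Γ := (List Bool × ℕ) × ℕ)
    ((((ho.wk.mul ho.wk).mul ho.wk.clog).add ho.wk).add var)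

end

/-- For a product `x * y`, walk to `x`, multiply by the generator at which the walk to `y` starts,
then follow that walk multiplied by `x` on the left. -/
theorem mem_closure_iff_reflTransGen {S : Type} [Semigroup S] {X : Set S} {t : S} :
    t ∈ Subsemigroup.closure X ↔
      ∃ a ∈ X, Relation.ReflTransGen (fun a b => ∃ g ∈ X, b = a * g) a t := by
  constructor
  · intro h
    induction h using Subsemigroup.closure_induction with
    | mem x hx => exact ⟨x, hx, .refl⟩
    | mul x y _ _ ihx ihy =>
      obtain ⟨a, ha, hx⟩ := ihx
      obtain ⟨b, hb, hy⟩ := ihy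
      refine ⟨a, ha, (hx.tail ⟨b, hb, rfl⟩).trans (hy.lift (x * ·) ?_)⟩
      rintro c _ ⟨g, hg, rfl⟩
      exact ⟨g, hg, (mul_assoc _ _ _).symm⟩
  · rintro ⟨a, ha, h⟩
    induction h with
    | refl => exact Subsemigroup.subset_closure ha
    | tail _ h ih =>
      obtain ⟨g, hg, rfl⟩ := h
      exact mul_mem ih (Subsemigroup.subset_closure hg)

theorem eq_of_testBit_eq_of_lt {N x y : ℕ} (hx : x < N) (hy : y < N)
    (h : ∀ b < Nat.clog 2 N, x.testBit b = y.testBit b) : x = y := by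
  refine Nat.eq_of_testBit_eq fun b => ?_
  rcases lt_or_ge b (Nat.clog 2 N) with hb | hb
  · exact h b hb
  · have hN : N ≤ 2 ^ b := (Nat.le_pow_clog (by norm_num) N).trans
      (Nat.pow_le_pow_right (by norm_num) hb)
    rw [Nat.testBit_lt_two_pow (hx.trans_le hN), Nat.testBit_lt_two_pow (hy.trans_le hN)]

/-- The inputs which are accepted by a search through the products of generators. -/
def searchLanguage : Set (List Bool) :=
  {w | ∃ x y, x ≤ w.length + 1 ∧ IsGenerator w x ∧
    Relation.ReflTransGen (fun x y => y ≤ w.length + 1 ∧ IsSuccessor w x y) x y ∧ IsTarget w y}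

theorem searchLanguage_mem_NL : searchLanguage ∈ NL :=
  reachability_mem_NL_of_definable
    (definable_isGenerator (Γ := List Bool × ℕ) .var definable_order.wk)
    definable_isSuccessor definable_isTarget

section

variable {V : (S : Type) → [Semigroup S] → Prop} (I : MembershipInstance V)

theorem isGenerator_encode (x : Fin I.N) :
    IsGenerator I.encode x ↔ I.num.symm x ∈ I.X := by
  rw [IsGenerator, order_encode, I.encode_generator]
  simp

theorem isSuccessor_encode (x y : Fin I.N) :
    IsSuccessor I.encode x y ↔ ∃ g ∈ I.X, I.num.symm y = I.num.symm x * g := by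
  rw [IsSuccessor, order_encode]
  constructor
  · rintro ⟨-, z, hz, hg, h⟩
    refine ⟨I.num.symm ⟨z, hz⟩, (isGenerator_encode I ⟨z, hz⟩).1 hg, ?_⟩
    rw [← Equiv.apply_eq_iff_eq I.num, Equiv.apply_symm_apply]
    refine Fin.ext (eq_of_testBit_eq_of_lt y.2 (Fin.is_lt _) fun b hb => ?_)
    have := h b hb
    rw [I.encode_table x ⟨z, hz⟩ hb, Option.some_inj] at this
    exact Bool.eq_iff_iff.2 this
  · rintro ⟨g, hg, h⟩
    refine ⟨y.2, I.num g, Fin.is_lt _, (isGenerator_encode I _).2 (by simpa using hg),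
      fun b hb => ?_⟩
    rw [I.encode_table x (I.num g) hb, Option.some_inj, Equiv.symm_apply_apply, ← h,
      Equiv.apply_symm_apply]

theorem isTarget_encode (y : Fin I.N) : IsTarget I.encode y ↔ I.num.symm y = I.t := by
  rw [IsTarget, order_encode]
  constructor
  · intro h
    rw [← Equiv.apply_eq_iff_eq I.num, Equiv.apply_symm_apply]
    refine Fin.ext (eq_of_testBit_eq_of_lt y.2 (Fin.is_lt _) fun b hb => ?_)
    have := h b hb
    rw [I.encode_target hb, Option.some_inj] at this
    exact Bool.eq_iff_iff.2 this
  · intro h b hb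
    rw [I.encode_target hb, Option.some_inj, ← h, Equiv.apply_symm_apply]

/-- The search graph restricted to the numbers below `I.N` is the right Cayley graph of `X`. Its
bound on vertices is harmless because `I.N` is at most the length of the encoding. -/
theorem encode_mem_searchLanguage : I.encode ∈ searchLanguage ↔ I.t ∈ Subsemigroup.closure I.X := by
  have hlen : I.N ≤ I.encode.length := by rw [I.length_encode]; omega
  rw [mem_closure_iff_reflTransGen]
  constructor
  · rintro ⟨x, y, -, hx, hxy, hy⟩
    have hxN : x < I.N := order_encode I ▸ hx.1
    obtain ⟨hyN, h⟩ : ∃ hy : y < I.N, Relation.ReflTransGen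
        (fun a b => ∃ g ∈ I.X, b = a * g) (I.num.symm ⟨x, hxN⟩) (I.num.symm ⟨y, hy⟩) := by
      clear hy
      induction hxy with
      | refl => exact ⟨hxN, .refl⟩
      | @tail y z _ hyz ih =>
        obtain ⟨hy, ih⟩ := ih
        have hzN : z < I.N := order_encode I ▸ hyz.2.1
        exact ⟨hzN, ih.tail ((isSuccessor_encode I ⟨y, hy⟩ ⟨z, hzN⟩).1 hyz.2)⟩
    rw [(isTarget_encode I ⟨y, hyN⟩).1 hy] at h
    exact ⟨_, (isGenerator_encode I ⟨x, hxN⟩).1 hx, h⟩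
  · rintro ⟨a, ha, h⟩
    refine ⟨I.num a, I.num I.t, by omega, (isGenerator_encode I _).2 (by simpa using ha),
      h.lift (fun a => (I.num a : ℕ)) ?_, (isTarget_encode I _).2 (by simp)⟩
    intro a b hab
    exact ⟨(I.num b).is_lt.le.trans (hlen.trans (Nat.le_succ _)),
      (isSuccessor_encode I _ _).2 (by simpa using hab)⟩

theorem inNL_CSM (V : (S : Type) → [Semigroup S] → Prop) : InNL (CSM V) := by
  refine ⟨searchLanguage, searchLanguage_mem_NL, ?_, ?_⟩
  · rintro _ ⟨I, hI, rfl⟩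
    exact (encode_mem_searchLanguage I).2 hI
  · rw [Set.disjoint_left]
    rintro _ ⟨I, hI, rfl⟩ h
    exact hI ((encode_mem_searchLanguage I).1 h)

end

end CayleyNL

namespace CayleyNL

/-! ### Configurations as numbers -/

/-- The digit in position `j` of a number in base `D`. -/
def digit (D j x : ℕ) : ℕ := x / D ^ j % D

/-- The number with given digits in base `D`. -/
def ofDigitFun {J : ℕ} (D : ℕ) (v : Fin J → ℕ) : ℕ := ∑ j, v j * D ^ (j : ℕ)

section Digits

variable {J D : ℕ} {v : Fin J → ℕ}

theorem ofDigitFun_eq (hv : ∀ j, v j < D) :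
    ofDigitFun D v = finFunctionFinEquiv (fun j => (⟨v j, hv j⟩ : Fin D)) := by
  rw [finFunctionFinEquiv_apply]; rfl

theorem ofDigitFun_lt (hv : ∀ j, v j < D) : ofDigitFun D v < D ^ J := by
  rw [ofDigitFun_eq hv]; exact Fin.is_lt _

theorem digit_ofDigitFun (hv : ∀ j, v j < D) (j : Fin J) : digit D j (ofDigitFun D v) = v j := by
  have := congrArg Fin.val (congrFun
    (finFunctionFinEquiv.symm_apply_apply (fun j => (⟨v j, hv j⟩ : Fin D))) j)
  rw [finFunctionFinEquiv_symm_apply_val, ← ofDigitFun_eq hv] at this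
  exact this

theorem eq_ofDigitFun {x : ℕ} (hx : x < D ^ J) (h : ∀ j : Fin J, digit D j x = v j) :
    x = ofDigitFun D v := by
  have := congrArg Fin.val (finFunctionFinEquiv.apply_symm_apply (⟨x, hx⟩ : Fin (D ^ J)))
  rw [finFunctionFinEquiv_apply] at this
  refine this.symm.trans (Finset.sum_congr rfl fun j _ => ?_)
  rw [finFunctionFinEquiv_symm_apply_val, ← h j]
  rfl

end Digits

namespace ConfigGraph

variable (M : Machine)

/-- One more than the number of work tape symbols. -/
noncomputable def base : ℕ := Nat.card M.Sym + 1

open Classical in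
/-- A number for every work tape symbol, zero for the blank. -/
noncomputable def symCode (s : M.Sym) : ℕ :=
  haveI := M.finite_sym
  if s = M.blank then 0 else (Finite.equivFin M.Sym s : ℕ) + 1

/-- A number for every state. -/
noncomputable def stateCode (q : M.State) : ℕ :=
  haveI := M.finite_state
  (Finite.equivFin M.State q : ℕ)

variable {M}

theorem symCode_blank : symCode M M.blank = 0 := by simp [symCode]

theorem symCode_lt (s : M.Sym) : symCode M s < base M := by
  have := M.finite_sym
  rw [symCode, base]
  split_ifs
  · omega
  · have := (Finite.equivFin M.Sym s).2
    omega

theorem symCode_injective : Function.Injective (symCode M) := by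
  have := M.finite_sym
  intro s s' h
  rw [symCode, symCode] at h
  split_ifs at h with h1 h2 h2
  · rw [h1, h2]
  · exact (Finite.equivFin M.Sym).injective (Fin.ext (by omega))

theorem stateCode_lt (q : M.State) : stateCode M q < Nat.card M.State := by
  have := M.finite_state
  exact (Finite.equivFin M.State q).2

theorem stateCode_injective : Function.Injective (stateCode M) := by
  have := M.finite_state
  exact fun q q' h => (Finite.equivFin M.State).injective (Fin.ext h)

theorem two_le_base : 2 ≤ base M := by
  have := M.finite_sym
  have : Nonempty M.Sym := ⟨M.blank⟩
  have := Nat.card_pos (α := M.Sym)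
  rw [base]; omega

variable (M) in
/-- The content of the first `S` cells of a tape. -/
noncomputable def tapeCode (S : ℕ) (T : ℕ → M.Sym) : ℕ :=
  ofDigitFun (base M) fun j : Fin S => symCode M (T j)

theorem tapeCode_lt (S : ℕ) (T : ℕ → M.Sym) : tapeCode M S T < base M ^ S :=
  ofDigitFun_lt fun _ => symCode_lt _

theorem digit_tapeCode {S : ℕ} (T : ℕ → M.Sym) {h : ℕ} (hh : h < S) :
    tapeCode M S T / base M ^ h % base M = symCode M (T h) :=
  digit_ofDigitFun (v := fun j : Fin S => symCode M (T j)) (fun _ => symCode_lt _) ⟨h, hh⟩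

/-- Writing a symbol changes a single digit. Having both corrections as additions avoids truncated
subtraction and is the form used in `Edge`. -/
theorem tapeCode_update {S : ℕ} (T : ℕ → M.Sym) {h : ℕ} (hh : h < S) (s : M.Sym) :
    tapeCode M S (Function.update T h s) + symCode M (T h) * base M ^ h =
      tapeCode M S T + symCode M s * base M ^ h := by
  simp only [tapeCode, ofDigitFun]
  rw [← Finset.add_sum_erase _ _ (Finset.mem_univ (⟨h, hh⟩ : Fin S)),
    ← Finset.add_sum_erase Finset.univ (fun j : Fin S => symCode M (T j) * base M ^ (j : ℕ))
      (Finset.mem_univ (⟨h, hh⟩ : Fin S))]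
  have : ∀ j ∈ Finset.univ.erase (⟨h, hh⟩ : Fin S),
      symCode M (Function.update T h s j) * base M ^ (j : ℕ) =
        symCode M (T j) * base M ^ (j : ℕ) := by
    intro j hj
    rw [Function.update_of_ne fun e => Finset.ne_of_mem_erase hj (Fin.ext e)]
  rw [Finset.sum_congr rfl this, Function.update_self]
  ring

/-- The effect of a head movement on the power of `β` which stands for the head position. -/
def moveWeight (β : ℕ) : Move → ℕ → ℕ
  | .left, x => if x = 1 then 1 else x / β
  | .stay, x => x
  | .right, x => x * β

/-- A head at cell `h` is represented by `base M ^ h` rather than by `h`. Scanning is then a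
quotient and a remainder, and moving is a multiplication or division by a constant, so no
exponential with variable exponent is needed. -/
theorem moveWeight_pow (m : Move) (h : ℕ) :
    moveWeight (base M) m (base M ^ h) = base M ^ m.apply h := by
  have := two_le_base (M := M)
  cases m with
  | left =>
    cases h with
    | zero => simp [moveWeight, Move.apply]
    | succ h =>
      have h1 : base M ^ (h + 1) ≠ 1 := (Nat.one_lt_pow (by omega) (by omega)).ne'
      rw [moveWeight, if_neg h1, pow_succ, Nat.mul_div_cancel _ (by omega)]
      rfl
  | stay => rfl
  | right => rfl

variable (M) (K : ℕ)

/-- A strict upper bound for all components of a configuration on inputs of length `n`. -/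
noncomputable def radix (n : ℕ) : ℕ :=
  (2 * (n + 1)) ^ (base M * K) + (n + 1) + Nat.card M.State + 1

/-- The number of cells of every work tape that are used. -/
def space (n : ℕ) : ℕ := K * (Nat.log 2 n + 1)

-- With `β = base M`, use `β ≤ 2 ^ β` and `2 ^ (Nat.log 2 n + 1) ≤ 2 * (n + 1)`: a tape of
-- logarithmic length is a number polynomial in `n`.
variable {K} in
theorem base_pow_space_lt (n : ℕ) : base M ^ space K n < radix M K n := by
  have h1 : base M ≤ 2 ^ base M := Nat.lt_two_pow_self.le
  have h2 : 2 ^ (Nat.log 2 n + 1) ≤ 2 * (n + 1) := by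
    rcases Nat.eq_zero_or_pos n with rfl | hn
    · simp
    · have := Nat.pow_log_le_self 2 hn.ne'
      rw [pow_succ]; omega
  have h3 : base M ^ space K n ≤ (2 * (n + 1)) ^ (base M * K) := by
    calc base M ^ space K n ≤ (2 ^ base M) ^ space K n := Nat.pow_le_pow_left h1 _
      _ = (2 ^ (Nat.log 2 n + 1)) ^ (base M * K) := by
        rw [space, ← pow_mul, ← pow_mul]; congr 1; ring
      _ ≤ _ := Nat.pow_le_pow_left h2 _
  rw [radix]; omega

/-- The number of components of a configuration. -/
abbrev dim : ℕ := 2 + M.tapes + M.tapes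

variable {M}

abbrev stateIx : Fin (dim M) := Fin.castAdd _ (Fin.castAdd _ 0)
abbrev posIx : Fin (dim M) := Fin.castAdd _ (Fin.castAdd _ 1)
abbrev tapeIx (i : Fin M.tapes) : Fin (dim M) := Fin.castAdd _ (Fin.natAdd _ i)
abbrev headIx (i : Fin M.tapes) : Fin (dim M) := Fin.natAdd _ i

theorem forall_ix {p : Fin (dim M) → Prop} (hs : p stateIx) (hp : p posIx)
    (ht : ∀ i, p (tapeIx i)) (hh : ∀ i, p (headIx i)) (j : Fin (dim M)) : p j := by
  refine Fin.addCases (fun j => ?_) hh j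
  refine Fin.addCases (fun j => ?_) ht j
  match j with
  | 0 => exact hs
  | 1 => exact hp

/-- The components of a configuration. -/
noncomputable def components (n : ℕ) (c : M.Cfg) : Fin (dim M) → ℕ :=
  Fin.append (Fin.append ![stateCode M c.state, c.inPos]
    fun i => tapeCode M (space K n) (c.tape i)) fun i => base M ^ c.head i

section

variable {K} {n : ℕ} {c : M.Cfg}

@[simp] theorem components_state : components K n c stateIx = stateCode M c.state := by
  simp [components]

@[simp] theorem components_pos : components K n c posIx = c.inPos := by
  simp [components]

@[simp] theorem components_tape (i : Fin M.tapes) :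
    components K n c (tapeIx i) = tapeCode M (space K n) (c.tape i) := by
  simp [components]

@[simp] theorem components_head (i : Fin M.tapes) :
    components K n c (headIx i) = base M ^ c.head i := by
  simp [components]

theorem components_lt (hp : c.inPos ≤ n + 1) (hh : ∀ i, c.head i < space K n) (j : Fin (dim M)) :
    components K n c j < radix M K n := by
  have hb := base_pow_space_lt M (K := K) n
  refine forall_ix (p := fun j => components K n c j < radix M K n) ?_ ?_ (fun i => ?_)
    (fun i => ?_) j
  · rw [components_state]
    have := stateCode_lt c.state
    rw [radix]; omega
  · rw [components_pos, radix]
    have := stateCode_lt c.state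
    omega
  · rw [components_tape]
    exact (tapeCode_lt _ _).trans hb
  · rw [components_head]
    exact (Nat.pow_le_pow_right (by have := two_le_base (M := M); omega) (hh i).le).trans_lt hb

end

/-- The number of a configuration. -/
noncomputable def node (n : ℕ) (c : M.Cfg) : ℕ := ofDigitFun (radix M K n) (components K n c)

variable (M)

/-- The number of nodes of the configuration graph. -/
noncomputable def nodes (n : ℕ) : ℕ := radix M K n ^ dim M

/-- The additional node which is the successor of all accepting configurations. -/
noncomputable def sink : ℕ := Nat.card M.State

/-- The edges of the configuration graph, given the scanned input symbol. -/
def Edge (n : ℕ) (a : InputSym) (x y : ℕ) : Prop :=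
  let d (j : Fin (dim M)) (x : ℕ) : ℕ := digit (radix M K n) j x
  (∃ q s, ∃ act ∈ M.trans q a s, d stateIx x = stateCode M q ∧
    (∀ i, d (tapeIx i) x / d (headIx i) x % base M = symCode M (s i) ∧
      d (tapeIx i) y + symCode M (s i) * d (headIx i) x =
        d (tapeIx i) x + symCode M (act.write i) * d (headIx i) x ∧
      d (headIx i) y = moveWeight (base M) (act.move i) (d (headIx i) x)) ∧
    d stateIx y = stateCode M act.state ∧
    d posIx y = min (act.inMove.apply (d posIx x)) (n + 1)) ∨
  (d stateIx x = stateCode M M.accept ∧ y = sink M)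

/-- The edges of the configuration graph on an input. -/
def Adj (w : List Bool) (x y : ℕ) : Prop :=
  Edge M K w.length (Machine.readInput w (digit (radix M K w.length)
    (posIx : Fin (dim M)) x)) x y

variable {M} {K}

theorem sink_lt_nodes (n : ℕ) : sink M < nodes M K n := by
  have h1 : sink M < radix M K n := by rw [sink, radix]; omega
  exact h1.trans_le (Nat.le_self_pow (by simp [dim]) _)

theorem node_lt_nodes {n : ℕ} {c : M.Cfg} (hp : c.inPos ≤ n + 1)
    (hh : ∀ i, c.head i < space K n) : node K n c < nodes M K n :=
  ofDigitFun_lt (components_lt hp hh)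

theorem digit_node {n : ℕ} {c : M.Cfg} (hp : c.inPos ≤ n + 1)
    (hh : ∀ i, c.head i < space K n) (j : Fin (dim M)) :
    digit (radix M K n) j (node K n c) = components K n c j :=
  digit_ofDigitFun (components_lt hp hh) j

/-- `Nat.card M.State` is not the code of any state, so this digit separates the sink from all
configurations. -/
theorem digit_sink (n : ℕ) :
    digit (radix M K n) (stateIx : Fin (dim M)) (sink M) = sink M := by
  have h1 : sink M < radix M K n := by rw [sink, radix]; omega
  simp [digit, Nat.mod_eq_of_lt h1]

variable {w : List Bool} {c : M.Cfg}

theorem adj_perform (hp : c.inPos ≤ w.length + 1) (hh : ∀ i, c.head i < space K w.length)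
    {act : Action M.State M.Sym M.tapes} (hact : act ∈ c.actions w)
    (hh' : ∀ i, (c.perform w act).head i < space K w.length) :
    Adj M K w (node K w.length c) (node K w.length (c.perform w act)) := by
  have hp' : (c.perform w act).inPos ≤ w.length + 1 := min_le_right _ _
  simp only [Adj, Edge, digit_node hp hh, digit_node hp' hh', components_state, components_pos,
    components_tape, components_head]
  refine .inl ⟨c.state, fun i => c.tape i (c.head i), act, hact, rfl, fun i => ⟨?_, ?_, ?_⟩, rfl, rfl⟩
  · exact digit_tapeCode _ (hh i)
  · exact tapeCode_update _ (hh i) _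
  · exact (moveWeight_pow _ _).symm

theorem adj_sink (hp : c.inPos ≤ w.length + 1) (hh : ∀ i, c.head i < space K w.length)
    (hc : c.state = M.accept) : Adj M K w (node K w.length c) (sink M) :=
  .inr ⟨(digit_node hp hh stateIx).trans (by rw [components_state, hc]), rfl⟩

/-- The equations in `Edge` determine every digit of `y`; the bound on `y` excludes further digits,
so `y` is the number of the successor configuration. -/
theorem exists_of_adj (hp : c.inPos ≤ w.length + 1) (hh : ∀ i, c.head i < space K w.length)
    {y : ℕ} (hy : y < nodes M K w.length) (h : Adj M K w (node K w.length c) y) :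
    (∃ act ∈ c.actions w, y = node K w.length (c.perform w act)) ∨ c.state = M.accept := by
  simp only [Adj, Edge, digit_node hp hh, components_state, components_pos,
    components_tape, components_head] at h
  rcases h with ⟨q, s, act, hact, hq, htape, hstate, hpos⟩ | ⟨h, -⟩
  · obtain rfl := stateCode_injective hq
    have hs : s = fun i => c.tape i (c.head i) := by
      funext i
      have := (htape i).1
      rw [digit_tapeCode _ (hh i)] at this
      exact (symCode_injective this).symm
    subst hs
    refine .inl ⟨act, hact, eq_ofDigitFun hy ?_⟩
    refine forall_ix ?_ ?_ (fun i => ?_) (fun i => ?_)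
    · rw [hstate, components_state]; rfl
    · rw [hpos, components_pos]; rfl
    · have h1 := (htape i).2.1
      have h2 := tapeCode_update (c.tape i) (hh i) (act.write i)
      rw [components_tape]
      exact Nat.add_right_cancel (h1.trans h2.symm)
    · rw [(htape i).2.2, components_head, moveWeight_pow]; rfl
  · exact .inr (stateCode_injective h)

/-- The edges between the nodes. -/
def GraphAdj (M : Machine) (K : ℕ) (w : List Bool) (x y : Fin (nodes M K w.length)) : Prop :=
  Adj M K w x y

theorem run_inPos_le {o : List Bool} (h : M.Run w M.init o c) : c.inPos ≤ w.length + 1 := by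
  generalize hc : M.init = c₀ at h
  cases h with
  | refl => subst hc; exact Nat.zero_le _
  | step => exact min_le_right _ _

/-- Some nodes do not represent configurations within the space bound, and their edges are
meaningless. They do no harm: until an accepting configuration has been met, a path from the initial
node visits only configurations that the machine reaches. -/
theorem accepts_iff (hM : ∀ o c, M.Run w M.init o c → ∀ i, c.head i < space K w.length)
    {x y : Fin (nodes M K w.length)} (hx : (x : ℕ) = node K w.length M.init)
    (hy : (y : ℕ) = sink M) :
    M.Accepts w ↔ Relation.TransGen (GraphAdj M K w) x y := by
  constructor
  · rintro ⟨o, c, hr, hc⟩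
    have key : ∀ {o c} (h : M.Run w M.init o c), Relation.ReflTransGen (GraphAdj M K w) x
        ⟨node K w.length c, node_lt_nodes (run_inPos_le h) (hM o c h)⟩ := by
      intro o c h
      have : ∀ c₀, c₀ = M.init → M.Run w c₀ o c → ∃ hlt : node K w.length c < nodes M K w.length,
          Relation.ReflTransGen (GraphAdj M K w) x ⟨node K w.length c, hlt⟩ := by
        intro c₀ hc₀ h
        induction h with
        | refl =>
          subst hc₀
          have hlt : node K w.length M.init < nodes M K w.length := hx.symm.trans_lt x.2
          have e : x = ⟨_, hlt⟩ := Fin.ext hx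
          exact ⟨hlt, Eq.subst (motive := fun z => Relation.ReflTransGen (GraphAdj M K w) x z) e
            .refl⟩
        | @step c' o h a ha ih =>
          subst hc₀
          have hs := h.step a ha
          obtain ⟨hlt, hpath⟩ := ih h
          refine ⟨node_lt_nodes (run_inPos_le hs) (hM _ _ hs), hpath.tail ?_⟩
          exact adj_perform (run_inPos_le h) (hM _ _ h) ha (hM _ _ hs)
      exact (this _ rfl h).2
    refine Relation.TransGen.tail' (key hr) ?_
    show Adj M K w _ _
    rw [hy]
    exact adj_sink (run_inPos_le hr) (hM _ _ hr) hc
  · intro h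
    -- Once an accepting configuration has been met, the claim holds by its first alternative and
    -- nothing is asserted about `z`.
    have key : ∀ z : Fin (nodes M K w.length), Relation.ReflTransGen (GraphAdj M K w) x z →
        M.Accepts w ∨ ∃ o c, M.Run w M.init o c ∧ (z : ℕ) = node K w.length c := by
      intro z hz
      induction hz with
      | refl => exact .inr ⟨[], M.init, .refl _, hx⟩
      | @tail y z _ hyz ih =>
        rcases ih with ih | ⟨o, c, hr, hc⟩
        · exact .inl ih
        · have hyz' : Adj M K w y z := hyz
          rw [hc] at hyz'
          rcases exists_of_adj (run_inPos_le hr) (hM _ _ hr) z.2 hyz' with ⟨a, ha, hz⟩ | hacc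
          · exact .inr ⟨_, _, hr.step a ha, hz⟩
          · exact .inl ⟨o, c, hr, hacc⟩
    rcases key y h.to_reflTransGen with h | ⟨o, c, hr, hc⟩
    · exact h
    -- The sink would be the number of a configuration, but its state digit is not a state code.
    · exfalso
      have h1 := digit_sink (M := M) (K := K) w.length
      rw [← hy, hc, digit_node (run_inPos_le hr) (hM _ _ hr), components_state, ← hc, hy] at h1
      have := stateCode_lt c.state
      rw [sink] at h1
      omega

end ConfigGraph

end CayleyNL

namespace CayleyNL

/-! ### Definability of the configuration graph -/

namespace ConfigGraph

open Definable

instance : Finite InputSym := by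
  refine Finite.of_surjective (fun x : Option (Option Bool) => match x with
    | none => InputSym.leftEnd
    | some none => .rightEnd
    | some (some b) => .bit b) fun a => ?_
  cases a with
  | leftEnd => exact ⟨none, rfl⟩
  | rightEnd => exact ⟨some none, rfl⟩
  | bit b => exact ⟨some (some b), rfl⟩

variable {Γ : Type} [Context Γ] (M : Machine) (K : ℕ)

theorem definable_radix : Definable fun γ : Γ => radix M K (Context.word γ).length :=
  (((((const 2).mul length).pow (base M * K)).add length).add
    (const (Nat.card M.State))).add (const 1)

theorem definable_nodes : Definable fun γ : Γ => nodes M K (Context.word γ).length :=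
  (definable_radix M K).pow _

variable {M K}

theorem definable_digit {g : Γ → ℕ} (hg : Definable g) (j : ℕ) :
    Definable fun γ => digit (radix M K (Context.word γ).length) j (g γ) :=
  (hg.div ((definable_radix M K).pow j)).mod (definable_radix M K)

theorem definable_moveWeight {g : Γ → ℕ} (hg : Definable g) (β : ℕ) (m : Move) :
    Definable fun γ => moveWeight β m (g γ) := by
  cases m with
  | left => exact Definable.ite (DefinablePred.eq hg (const 1)) (const 1) (hg.div (const β))
  | stay => exact hg
  | right => exact hg.mul (const β)

theorem definable_move {g : Γ → ℕ} (hg : Definable g) (m : Move) :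
    Definable fun γ => m.apply (g γ) := by
  cases m with
  | left => exact hg.sub (const 1)
  | stay => exact hg
  | right => exact hg.add (const 1)

theorem definable_min {g h : Γ → ℕ} (hg : Definable g) (hh : Definable h) :
    Definable fun γ => min (g γ) (h γ) :=
  (Definable.ite (DefinablePred.le hg hh) hg hh).of_eq fun γ => by rw [min_def]

/-- States, scanned symbols, tapes and actions range over fixed finite sets, so these quantifiers
unfold into finite Boolean combinations with constants depending on `M` only. -/
theorem definable_edge {g h : Γ → ℕ} (hg : Definable g) (hh : Definable h) (a : InputSym) :
    DefinablePred fun γ => Edge M K (Context.word γ).length a (g γ) (h γ) := by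
  have := M.finite_state
  have := M.finite_sym
  refine DefinablePred.or (.exists_finite fun q => .exists_finite fun s =>
    .exists_mem (M.finite_trans q a s) fun act => ?_) ?_
  · refine .and (.eq (definable_digit hg _) (const _)) (.and (.forall_finite fun i => ?_)
      (.and (.eq (definable_digit hh _) (const _)) (.eq (definable_digit hh _)
        (definable_min (definable_move (definable_digit hg _) _) length))))
    refine .and (.eq (((definable_digit hg _).div (definable_digit hg _)).mod (const _)) (const _))
      (.and (.eq ((definable_digit hh _).add ((const _).mul (definable_digit hg _)))
        ((definable_digit hg _).add ((const _).mul (definable_digit hg _))))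
        (.eq (definable_digit hh _) (definable_moveWeight (definable_digit hg _) _ _)))
  · exact .and (.eq (definable_digit hg _) (const _)) (.eq hh (const _))

theorem definable_adj {g h : Γ → ℕ} (hg : Definable g) (hh : Definable h) :
    DefinablePred fun γ => Adj M K (Context.word γ) (g γ) (h γ) := by
  refine (DefinablePred.exists_finite fun a : InputSym => .and
    (.readInput (definable_digit (M := M) (K := K) hg (posIx : Fin (dim M))) a)
    (definable_edge (M := M) (K := K) hg hh a)).of_iff fun γ => ?_
  simp [Adj]

theorem definable_finsetSum {ι : Type} (s : Finset ι) {g : ι → Γ → ℕ}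
    (hg : ∀ i, Definable (g i)) : Definable fun γ => ∑ i ∈ s, g i γ := by
  classical
  induction s using Finset.induction_on with
  | empty => exact (const 0).of_eq fun γ => by simp
  | insert i s hi ih => exact ((hg i).add ih).of_eq fun γ => by rw [Finset.sum_insert hi]

theorem definable_node_init : Definable fun γ : Γ => node K (Context.word γ).length M.init := by
  change Definable fun γ : Γ => ∑ j : Fin (dim M), components K (Context.word γ).length M.init j *
    radix M K (Context.word γ).length ^ (j : ℕ)
  refine definable_finsetSum _ fun j => Definable.mul ?_ ((definable_radix (Γ := Γ) M K).pow _)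
  refine forall_ix (p := fun j => Definable fun γ : Γ =>
    components K (Context.word γ).length M.init j) ?_ ?_ (fun i => ?_) (fun i => ?_) j
  · simp only [components_state]; exact const _
  · simp only [components_pos]; exact const _
  -- The blank has code zero, so a blank tape has code zero whatever its length.
  · refine (const 0).of_eq fun γ => ?_
    simp [tapeCode, ofDigitFun, Machine.init, symCode_blank]
  · simp only [components_head]; exact const _

end ConfigGraph

/-! ### Brandt semigroups -/

/-- The Brandt semigroup over the trivial group with index set `α`. -/
def Brandt (α : Type) : Type := Option (α × α)

namespace Brandt

variable {α : Type}

open Classical in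
/-- The product of a Brandt semigroup. -/
noncomputable def mul : Brandt α → Brandt α → Brandt α
  | some (a, b), some (c, d) => if b = c then some (a, d) else none
  | some _, none => none
  | none, _ => none

theorem mul_none (s : Brandt α) : mul s none = none := by rcases s with _ | ⟨a, b⟩ <;> rfl

theorem mul_some_some (a b d : α) : mul (some (a, b)) (some (b, d)) = some (a, d) := if_pos rfl

theorem mul_some_some_of_ne {a b c d : α} (h : b ≠ c) : mul (some (a, b)) (some (c, d)) = none :=
  if_neg h

noncomputable instance : Semigroup (Brandt α) where
  mul := mul
  mul_assoc s t u := by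
    change mul (mul s t) u = mul s (mul t u)
    rcases s with _ | ⟨a, b⟩
    · rfl
    rcases t with _ | ⟨c, d⟩
    · rfl
    rcases u with _ | ⟨e, f⟩
    · exact (mul_none _).trans (congrArg (mul (some (a, b))) (mul_none (some (c, d)))).symm
    by_cases h1 : b = c
    · subst h1
      by_cases h2 : d = e
      · subst h2
        exact ((congrArg (mul · _) (mul_some_some a b d)).trans (mul_some_some a d f)).trans
          ((congrArg (mul _) (mul_some_some b d f)).trans (mul_some_some a b f)).symm
      · exact ((congrArg (mul · _) (mul_some_some a b d)).trans (mul_some_some_of_ne h2)).trans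
          (congrArg (mul (some (a, b))) (mul_some_some_of_ne h2)).symm
    · refine (congrArg (mul · _) (mul_some_some_of_ne h1)).trans ?_
      by_cases h2 : d = e
      · subst h2
        exact ((congrArg (mul _) (mul_some_some c d f)).trans (mul_some_some_of_ne h1)).symm
      · exact (congrArg (mul (some (a, b))) (mul_some_some_of_ne h2)).symm

/-- The nonzero element with given indices. -/
def pair (a b : α) : Brandt α := some (a, b)

/-- The zero element. -/
def zero : Brandt α := none

theorem zero_mul (s : Brandt α) : zero * s = zero := rfl

theorem mul_zero (s : Brandt α) : s * zero = zero := by rcases s with _ | ⟨a, b⟩ <;> rfl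

theorem pair_mul_pair (a b d : α) : pair a b * pair b d = pair a d := if_pos rfl

theorem pair_mul_pair_of_ne {a b c d : α} (h : b ≠ c) : pair a b * pair c d = zero := if_neg h

theorem pair_injective {a b c d : α} (h : pair a b = pair c d) : a = c ∧ b = d := by
  have := Option.some.inj h
  exact ⟨congrArg Prod.fst this, congrArg Prod.snd this⟩

theorem pair_ne_zero (a b : α) : pair a b ≠ zero := Option.some_ne_none _

theorem cases (s : Brandt α) : s = zero ∨ ∃ a b, s = pair a b := by
  rcases s with _ | ⟨a, b⟩
  · exact .inl rfl
  · exact .inr ⟨a, b, rfl⟩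

/-- Any pair is obtained from any other: `(c, a)(a, b)(b, d) = (c, d)`. -/
theorem isZeroSimple : IsZeroSimple (Brandt α) := by
  refine ⟨zero, fun s => ⟨zero_mul s, mul_zero s⟩, fun s hs u => ?_⟩
  rcases cases s with rfl | ⟨a, b, rfl⟩
  · exact absurd rfl hs
  rcases cases u with rfl | ⟨c, d, rfl⟩
  · exact ⟨zero, zero, by rw [mul_zero]⟩
  · exact ⟨pair c a, pair b d, by rw [pair_mul_pair, pair_mul_pair]⟩

/-- A product of edges is nonzero only if consecutive edges fit together, and then it records the
two ends of the path. Once zero appears, the product stays zero, so it never yields a pair. -/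
theorem pair_mem_closure_iff (E : α → α → Prop) (a b : α) :
    pair a b ∈ Subsemigroup.closure {s | ∃ x y, E x y ∧ s = pair x y} ↔ Relation.TransGen E a b := by
  constructor
  · have key : ∀ s ∈ Subsemigroup.closure {s | ∃ x y, E x y ∧ s = pair x y},
        ∀ a b, s = pair a b → Relation.TransGen E a b := by
      intro s hs
      induction hs using Subsemigroup.closure_induction with
      | mem s hs =>
        rintro a b rfl
        obtain ⟨x, y, hxy, h⟩ := hs
        obtain ⟨rfl, rfl⟩ := pair_injective h
        exact .single hxy
      | mul s t _ _ ihs iht =>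
        intro a b h
        rcases cases s with rfl | ⟨c, d, rfl⟩
        · exact absurd h.symm (pair_ne_zero _ _)
        rcases cases t with rfl | ⟨e, f, rfl⟩
        · rw [mul_zero] at h
          exact absurd h.symm (pair_ne_zero _ _)
        by_cases hde : d = e
        · subst hde
          rw [pair_mul_pair] at h
          obtain ⟨rfl, rfl⟩ := pair_injective h
          exact (ihs _ _ rfl).trans (iht _ _ rfl)
        · rw [pair_mul_pair_of_ne hde] at h
          exact absurd h.symm (pair_ne_zero _ _)
    exact fun h => key _ h _ _ rfl
  · intro h
    induction h with
    | single h => exact Subsemigroup.subset_closure ⟨_, _, h, rfl⟩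
    | tail _ h ih =>
      rw [← pair_mul_pair]
      exact mul_mem ih (Subsemigroup.subset_closure ⟨_, _, h, rfl⟩)

/-- A numbering in which the zero element comes last. -/
def num (m : ℕ) : Brandt (Fin m) ≃ Fin (m * m + 1) :=
  (Equiv.optionCongr finProdFinEquiv).trans (finSuccEquivLast).symm

instance (m : ℕ) : Finite (Brandt (Fin m)) := Finite.of_equiv _ (num m).symm

theorem num_zero (m : ℕ) : (num m zero : ℕ) = m * m := by
  change ((finSuccEquivLast.symm ((Equiv.optionCongr finProdFinEquiv)
    (none : Option (Fin m × Fin m))) : Fin (m * m + 1)) : ℕ) = m * m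
  simp

theorem num_pair {m : ℕ} (a b : Fin m) : (num m (pair a b) : ℕ) = b + m * a := by
  change ((finSuccEquivLast.symm ((Equiv.optionCongr finProdFinEquiv)
    (some (a, b))) : Fin (m * m + 1)) : ℕ) = _
  simp

/-- The product on numbers. -/
def mulNum (m i j : ℕ) : ℕ :=
  if i < m * m ∧ j < m * m ∧ i % m = j / m then j % m + m * (i / m) else m * m

theorem num_pair_lt {m : ℕ} (a b : Fin m) : (num m (pair a b) : ℕ) < m * m := by
  rw [num_pair]
  have := a.2
  have := b.2
  nlinarith

theorem num_pair_div {m : ℕ} (a b : Fin m) : (num m (pair a b) : ℕ) / m = a := by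
  have := b.2
  rw [num_pair, Nat.add_mul_div_left _ _ (by omega), Nat.div_eq_of_lt this, Nat.zero_add]

theorem num_pair_mod {m : ℕ} (a b : Fin m) : (num m (pair a b) : ℕ) % m = b := by
  rw [num_pair, Nat.add_mul_mod_self_left, Nat.mod_eq_of_lt b.2]

/-- The table is given by arithmetic on the numbers of the factors. This makes it definable and
shows that it depends only on `m`. -/
theorem num_mul {m : ℕ} (s t : Brandt (Fin m)) :
    (num m (s * t) : ℕ) = mulNum m (num m s) (num m t) := by
  rcases cases s with rfl | ⟨a, b, rfl⟩
  · rw [zero_mul, mulNum, num_zero]; simp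
  rcases cases t with rfl | ⟨c, d, rfl⟩
  · rw [mul_zero, mulNum, num_zero]; simp
  have h : (b : ℕ) = c ↔ b = c := Fin.ext_iff.symm
  rw [mulNum, num_pair_mod, num_pair_div, num_pair_mod, num_pair_div]
  by_cases hbc : b = c
  · subst hbc
    rw [pair_mul_pair, num_pair, if_pos ⟨num_pair_lt _ _, num_pair_lt _ _, rfl⟩]
  · rw [pair_mul_pair_of_ne hbc, num_zero, if_neg fun h' => hbc (h.1 h'.2.2)]

end Brandt

/-! ### The reduction -/

namespace MembershipInstance

variable {V : (S : Type) → [Semigroup S] → Prop} (I : MembershipInstance V)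

-- Reduces the identification of an encoding to its three blocks. A position in the table is
-- decomposed into row, column and bit by division with remainder.
open Classical in
theorem encode_eq_map (bit : ℕ → Prop)
    (h₁ : ∀ i j : Fin I.N, ∀ b < Nat.clog 2 I.N, (bit ((i * I.N + j) * Nat.clog 2 I.N + b) ↔
      Nat.testBit (I.num (I.num.symm i * I.num.symm j)) b = true))
    (h₂ : ∀ i : Fin I.N, (bit (I.N * I.N * Nat.clog 2 I.N + i) ↔ I.num.symm i ∈ I.X))
    (h₃ : ∀ b < Nat.clog 2 I.N, (bit (I.N * I.N * Nat.clog 2 I.N + I.N + b) ↔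
      Nat.testBit (I.num I.t) b = true)) :
    I.encode = (List.range (I.N * I.N * Nat.clog 2 I.N + I.N + Nat.clog 2 I.N)).map
      fun i => decide (bit i) := by
  refine List.ext_getElem? fun p => ?_
  rcases lt_or_ge p (I.N * I.N * Nat.clog 2 I.N + I.N + Nat.clog 2 I.N) with hp | hp
  · rw [List.getElem?_map, List.getElem?_range hp, Option.map_some]
    rcases lt_or_ge p (I.N * I.N * Nat.clog 2 I.N) with hp₁ | hp₁
    · have hL : 0 < Nat.clog 2 I.N := by
        rcases Nat.eq_zero_or_pos (Nat.clog 2 I.N) with h | h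
        · rw [h] at hp₁; omega
        · exact h
      have hq : p / Nat.clog 2 I.N < I.N * I.N := Nat.div_lt_of_lt_mul (by rwa [mul_comm] at hp₁)
      have hN : 0 < I.N := by
        rcases Nat.eq_zero_or_pos I.N with h | h
        · rw [h, Nat.zero_mul] at hq; exact absurd hq (Nat.not_lt_zero _)
        · exact h
      have hi : p / Nat.clog 2 I.N / I.N < I.N := Nat.div_lt_of_lt_mul hq
      have hj : p / Nat.clog 2 I.N % I.N < I.N := Nat.mod_lt _ hN
      have hb : p % Nat.clog 2 I.N < Nat.clog 2 I.N := Nat.mod_lt _ hL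
      have e : p = ((p / Nat.clog 2 I.N / I.N) * I.N + p / Nat.clog 2 I.N % I.N) *
          Nat.clog 2 I.N + p % Nat.clog 2 I.N := by
        rw [Nat.div_add_mod', Nat.div_add_mod']
      have h1 := h₁ ⟨_, hi⟩ ⟨_, hj⟩ _ hb
      have h2 := I.encode_table ⟨_, hi⟩ ⟨_, hj⟩ hb
      simp only at h1 h2
      rw [← e] at h1 h2
      rw [h2, Option.some_inj, Bool.eq_iff_iff, decide_eq_true_iff, h1]
    · rcases lt_or_ge p (I.N * I.N * Nat.clog 2 I.N + I.N) with hp₂ | hp₂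
      · obtain ⟨i, rfl⟩ := Nat.exists_eq_add_of_le hp₁
        have h1 := h₂ ⟨i, by omega⟩
        have h2 := I.encode_generator ⟨i, by omega⟩
        simp only at h1 h2
        rw [h2, Option.some_inj, Bool.eq_iff_iff, decide_eq_true_iff, decide_eq_true_iff, h1]
      · obtain ⟨b, rfl⟩ := Nat.exists_eq_add_of_le hp₂
        rw [I.encode_target (by omega), Option.some_inj, Bool.eq_iff_iff, decide_eq_true_iff,
          h₃ b (by omega)]
  · rw [List.getElem?_eq_none (by rw [I.length_encode]; exact hp),
      List.getElem?_eq_none (by simpa using hp)]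

end MembershipInstance

/-- Functions whose result bits depend on at most one input bit are in `AC⁰`. -/
theorem AC0Computable.of_literal {len : ℕ → ℕ} {bit : List Bool → ℕ → Bool} (p : Polynomial ℕ)
    (hp : ∀ n, len n ≤ p.eval n)
    (hbit : ∀ n i, (∃ b, ∀ w : List Bool, w.length = n → bit w i = b) ∨
      ∃ j : Fin n, ∃ b, ∀ w : List Bool, ∀ h : w.length = n,
        bit w i = xor (w.get (j.cast h.symm)) b) :
    AC0Computable fun w => (List.range (len w.length)).map (bit w) := by
  have key : ∀ n i, ∃ l : Wire n 1, ∀ w : List Bool, ∀ h : w.length = n, bit w i =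
      match l with
      | (.inl j, b) => xor (w.get (j.cast h.symm)) b
      | (.inr _, b) => xor true b := by
    intro n i
    rcases hbit n i with ⟨b, hb⟩ | ⟨j, b, hb⟩
    · exact ⟨(.inr 0, !b), fun w h => by rw [hb w h]; simp⟩
    · exact ⟨(.inl j, b), hb⟩
  choose l hl using key
  -- The single gate is an AND without inputs, hence constantly true. It supplies, possibly negated,
  -- the constant output bits.
  refine ⟨fun n => ⟨1, fun _ => true, fun _ => ∅, (List.range (len n)).map (l n)⟩, 1, p + 1,
    fun n => ?_, fun n g hg => ?_, fun w => ?_⟩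
  · simp only [Circuit.size, List.length_map, List.length_range, Polynomial.eval_add,
      Polynomial.eval_one]
    have := hp n
    omega
  · rw [Circuit.gateDepth]; simp
  · rw [Circuit.eval, List.map_map]
    refine List.map_congr_left fun i _ => ?_
    rw [hl w.length i w rfl, Function.comp_apply]
    generalize l w.length i = x
    rcases x with ⟨j | g, b⟩
    · rfl
    · simp only
      rw [Circuit.gateVal]
      simp

/-! ### Complexity and correctness of the reduction -/

section Reduction

open ConfigGraph

variable (M : Machine) (K : ℕ)

/-- The order of the semigroup in the reduction. -/
noncomputable def redOrder (n : ℕ) : ℕ := nodes M K n * nodes M K n + 1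

/-- The length of the result of the reduction. -/
noncomputable def redLength (n : ℕ) : ℕ :=
  redOrder M K n * redOrder M K n * Nat.clog 2 (redOrder M K n) + redOrder M K n +
    Nat.clog 2 (redOrder M K n)

/-- The bits of the result of the reduction. -/
def RedBit (w : List Bool) (p : ℕ) : Prop :=
  let m := nodes M K w.length
  let N := redOrder M K w.length
  let L := Nat.clog 2 N
  if p < N * N * L then
    (Brandt.mulNum m (p / L / N) (p / L % N)).testBit (p % L) = true
  else if p < N * N * L + N then
    p - N * N * L < m * m ∧ Adj M K w ((p - N * N * L) / m) ((p - N * N * L) % m)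
  else (sink M + m * node K w.length M.init).testBit (p - (N * N * L + N)) = true

open Classical in
/-- The reduction. -/
noncomputable def reduction (w : List Bool) : List Bool :=
  (List.range (redLength M K w.length)).map fun p => decide (RedBit M K w p)

theorem DefinablePred.ite {Γ : Type} [Context Γ] {p q r : Γ → Prop} (hp : DefinablePred p)
    (hq : DefinablePred q) (hr : DefinablePred r) [DecidablePred p] :
    DefinablePred fun γ => if p γ then q γ else r γ :=
  ((hp.and hq).or (hp.not.and hr)).of_iff fun γ => by by_cases h : p γ <;> simp [h]

theorem definable_redOrder {Γ : Type} [Context Γ] :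
    Definable fun γ : Γ => redOrder M K (Context.word γ).length :=
  ((definable_nodes M K).mul (definable_nodes M K)).add (.const 1)

theorem definable_redLength : Definable fun w : List Bool => redLength M K w.length := by
  have ho := definable_redOrder (Γ := List Bool) M K
  exact (((ho.mul ho).mul ho.clog).add ho).add ho.clog

theorem definable_redBit :
    DefinablePred fun γ : List Bool × ℕ => RedBit M K γ.1 γ.2 := by
  have ho := definable_redOrder (Γ := List Bool × ℕ) M K
  have hm := definable_nodes (Γ := List Bool × ℕ) M K
  have hv : Definable fun γ : List Bool × ℕ => γ.2 := .var
  have hNNL := (ho.mul ho).mul ho.clog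
  have hsub := hv.sub hNNL
  have hi := (hv.div ho.clog).div ho
  have hj := (hv.div ho.clog).mod ho
  refine .ite (.lt hv hNNL) (.testBit (.ite (.and (.lt hi (hm.mul hm)) (.and (.lt hj (hm.mul hm))
    (.eq (hi.mod hm) (hj.div hm)))) ((hj.mod hm).add (hm.mul (hi.div hm))) (hm.mul hm))
    (hv.mod ho.clog)) (.ite (.lt hv (hNNL.add ho)) (.and (.lt hsub (hm.mul hm))
    (definable_adj (hsub.div hm) (hsub.mod hm))) (.testBit ((Definable.const (sink M)).add
      (hm.mul definable_node_init)) (hv.sub (hNNL.add ho))))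

theorem reduction_logSpaceComputable : LogSpaceComputable (reduction M K) :=
  .of_definable (definable_redLength M K) (definable_redBit M K)

/-- Values of expressions are polynomially bounded. A word of `n` ones serves as a sample input, as
the value depends only on the length. -/
theorem exists_redLength_le : ∃ p : Polynomial ℕ, ∀ n, redLength M K n ≤ p.eval n := by
  obtain ⟨e, he⟩ := definable_redLength M K
  obtain ⟨c, hc⟩ := e.exists_eval_le
  refine ⟨(Polynomial.X + 1 + 2) ^ (c + 1), fun n => ?_⟩
  have h1 := hc (List.replicate n true) (n + 1) [] (by simp) (by simp)
  have h2 : e.eval (List.replicate n true) [] = _ := he (List.replicate n true)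
  rw [h2] at h1
  change redLength M K (List.replicate n true).length ≤ _ at h1
  rw [List.length_replicate] at h1
  simpa using h1

/-- Table and target bits depend only on `n`. A bit of the characteristic vector asks for an edge
between two fixed nodes; the first one fixes the input head position, so at most one input bit
matters. -/
theorem reduction_AC0Computable : AC0Computable (reduction M K) := by
  classical
  obtain ⟨p, hp⟩ := exists_redLength_le M K
  have main := AC0Computable.of_literal (len := redLength M K)
    (bit := fun w i => decide (RedBit M K w i)) p hp fun n i => ?_
  · exact (funext fun _ => rfl : reduction M K = _) ▸ main
  · set m := nodes M K n with hm
    set N := redOrder M K n with hN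
    set L := Nat.clog 2 N with hL
    rcases lt_or_ge i (N * N * L) with h1 | h1
    · refine .inl ⟨decide ((Brandt.mulNum m (i / L / N) (i / L % N)).testBit (i % L) = true), ?_⟩
      rintro w rfl
      simp only [RedBit, ← hN, ← hL, ← hm, if_pos h1]
    rcases lt_or_ge i (N * N * L + N) with h2 | h2
    · by_cases h3 : i - N * N * L < m * m
      · have e : ∀ w : List Bool, w.length = n → (RedBit M K w i ↔
            Edge M K n (Machine.readInput w (digit (radix M K n) (posIx : Fin (dim M))
              ((i - N * N * L) / m))) ((i - N * N * L) / m) ((i - N * N * L) % m)) := by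
          rintro w rfl
          simp only [RedBit, ← hN, ← hL, ← hm, if_neg h1.not_gt, if_pos h2, h3, true_and, Adj]
        generalize digit (radix M K n) (posIx : Fin (dim M)) ((i - N * N * L) / m) = q at e
        rcases q with _ | q
        · exact .inl ⟨decide (Edge M K n .leftEnd ((i - N * N * L) / m) ((i - N * N * L) % m)),
            fun w hw => decide_eq_decide.2 (e w hw)⟩
        rcases lt_or_ge q n with hq | hq
        · have e' : ∀ w : List Bool, ∀ h : w.length = n, (RedBit M K w i ↔
              Edge M K n (.bit (w.get (Fin.cast h.symm ⟨q, hq⟩))) ((i - N * N * L) / m)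
                ((i - N * N * L) % m)) := by
            rintro w rfl
            rw [e w rfl, readInput_succ_of_lt hq]
            rfl
          -- A Boolean function of one variable is a constant or a literal.
          have bool : ∀ φ : Bool → Bool, (∃ b, ∀ x, φ x = b) ∨ ∃ b, ∀ x, φ x = xor x b := by
            decide
          rcases bool fun x => decide (Edge M K n (.bit x) ((i - N * N * L) / m)
            ((i - N * N * L) % m)) with ⟨b, hb⟩ | ⟨b, hb⟩
          · exact .inl ⟨b, fun w hw => (decide_eq_decide.2 (e' w hw)).trans (hb _)⟩
          · exact .inr ⟨⟨q, hq⟩, b, fun w hw => (decide_eq_decide.2 (e' w hw)).trans (hb _)⟩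
        · refine .inl ⟨decide (Edge M K n .rightEnd ((i - N * N * L) / m)
            ((i - N * N * L) % m)), fun w hw => decide_eq_decide.2 ?_⟩
          rw [e w hw, readInput_succ_of_ge (hw ▸ hq)]
      · refine .inl ⟨false, ?_⟩
        rintro w rfl
        simp only [RedBit, ← hN, ← hL, ← hm, if_neg h1.not_gt, if_pos h2, h3, false_and,
          decide_false]
    · refine .inl ⟨decide ((sink M + m * node K n M.init).testBit
        (i - (N * N * L + N)) = true), ?_⟩
      rintro w rfl
      simp only [RedBit, ← hN, ← hL, ← hm, if_neg h1.not_gt, if_neg h2.not_gt]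

variable {M K}

/-- The instance which is computed by the reduction. -/
noncomputable def redInstance {V : (S : Type) → [Semigroup S] → Prop}
    (hV : ∀ (S : Type) [Semigroup S] [Finite S], IsZeroSimple S → V S) (w : List Bool)
    (x y : Fin (nodes M K w.length)) : MembershipInstance V where
  S := Brandt (Fin (nodes M K w.length))
  mem_class := hV _ Brandt.isZeroSimple
  N := redOrder M K w.length
  num := Brandt.num _
  X := {s | ∃ x y, GraphAdj M K w x y ∧ s = Brandt.pair x y}
  t := Brandt.pair x y

theorem encode_redInstance {V : (S : Type) → [Semigroup S] → Prop}
    (hV : ∀ (S : Type) [Semigroup S] [Finite S], IsZeroSimple S → V S) (w : List Bool)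
    {x y : Fin (nodes M K w.length)} (hx : (x : ℕ) = node K w.length M.init)
    (hy : (y : ℕ) = sink M) : (redInstance hV w x y).encode = reduction M K w := by
  refine (redInstance hV w x y).encode_eq_map (RedBit M K w) ?_ ?_ ?_
  · intro i j b hb
    change Fin (nodes M K w.length * nodes M K w.length + 1) at i j
    have hi : (i : ℕ) < redOrder M K w.length := i.2
    have hj : (j : ℕ) < redOrder M K w.length := j.2
    change b < Nat.clog 2 (redOrder M K w.length) at hb
    change RedBit M K w ((i * redOrder M K w.length + j) * Nat.clog 2 (redOrder M K w.length) + b) ↔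
      Nat.testBit (Brandt.num _ ((Brandt.num _).symm i * (Brandt.num _).symm j)) b = true
    rw [Brandt.num_mul, Equiv.apply_symm_apply, Equiv.apply_symm_apply]
    have hN : (i * redOrder M K w.length + j : ℕ) + 1 ≤
        redOrder M K w.length * redOrder M K w.length := by
      nlinarith
    have hlt : ((i * redOrder M K w.length + j) * Nat.clog 2 (redOrder M K w.length) + b : ℕ) <
        redOrder M K w.length * redOrder M K w.length * Nat.clog 2 (redOrder M K w.length) := by
      have := Nat.mul_le_mul_right (Nat.clog 2 (redOrder M K w.length)) hN
      rw [Nat.succ_mul] at this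
      omega
    have e1 : ((i * redOrder M K w.length + j) * Nat.clog 2 (redOrder M K w.length) + b : ℕ) /
        Nat.clog 2 (redOrder M K w.length) = i * redOrder M K w.length + j := by
      rw [add_comm, Nat.add_mul_div_right _ _ (by omega), Nat.div_eq_of_lt hb, Nat.zero_add]
    have e2 : ((i * redOrder M K w.length + j) * Nat.clog 2 (redOrder M K w.length) + b : ℕ) %
        Nat.clog 2 (redOrder M K w.length) = b := by
      rw [add_comm, Nat.add_mul_mod_self_right, Nat.mod_eq_of_lt hb]
    have e3 : (i * redOrder M K w.length + j : ℕ) / redOrder M K w.length = i := by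
      rw [add_comm, Nat.add_mul_div_right _ _ (by omega), Nat.div_eq_of_lt hj,
        Nat.zero_add]
    have e4 : (i * redOrder M K w.length + j : ℕ) % redOrder M K w.length = j := by
      rw [add_comm, Nat.add_mul_mod_self_right, Nat.mod_eq_of_lt hj]
    simp only [RedBit]
    rw [if_pos hlt, e1, e2, e3, e4]
  · intro i
    change Fin (nodes M K w.length * nodes M K w.length + 1) at i
    have hi : (i : ℕ) < redOrder M K w.length := i.2
    change RedBit M K w (redOrder M K w.length * redOrder M K w.length *
      Nat.clog 2 (redOrder M K w.length) + i) ↔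
      ∃ x y, GraphAdj M K w x y ∧ (Brandt.num _).symm i = Brandt.pair x y
    simp only [RedBit]
    rw [if_neg (by omega), if_pos (by omega), Nat.add_sub_cancel_left]
    obtain ⟨s, rfl⟩ := (Brandt.num _).surjective i
    rw [Equiv.symm_apply_apply]
    rcases Brandt.cases s with rfl | ⟨a, b, rfl⟩
    · rw [Brandt.num_zero]
      constructor
      · rintro ⟨h, -⟩
        exact absurd h (lt_irrefl _)
      · rintro ⟨x, y, -, h⟩
        exact absurd h.symm (Brandt.pair_ne_zero _ _)
    · rw [Brandt.num_pair_div, Brandt.num_pair_mod]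
      constructor
      · rintro ⟨-, h⟩
        exact ⟨a, b, h, rfl⟩
      · rintro ⟨x, y, hxy, h⟩
        obtain ⟨rfl, rfl⟩ := Brandt.pair_injective h
        exact ⟨Brandt.num_pair_lt _ _, hxy⟩
  · intro b hb
    change b < Nat.clog 2 (redOrder M K w.length) at hb
    change RedBit M K w (redOrder M K w.length * redOrder M K w.length *
      Nat.clog 2 (redOrder M K w.length) + redOrder M K w.length + b) ↔
      Nat.testBit (Brandt.num _ (Brandt.pair x y)) b = true
    simp only [RedBit]
    rw [if_neg (by omega), if_neg (by omega), Nat.add_sub_cancel_left, Brandt.num_pair, hx, hy]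

/-- The membership problem is hard for `NL` if the reduction is in the class `F`. -/
theorem nlHard_CSM {F : (List Bool → List Bool) → Prop} (hF : ∀ M K, F (reduction M K))
    {V : (S : Type) → [Semigroup S] → Prop}
    (hV : ∀ (S : Type) [Semigroup S] [Finite S], IsZeroSimple S → V S) : NLHard F (CSM V) := by
  rintro A ⟨M, ⟨K, hK⟩, hA⟩
  refine ⟨reduction M K, hF M K, ?_⟩
  have key : ∀ w : List Bool, ∃ I : MembershipInstance V, I.encode = reduction M K w ∧
      (w ∈ A ↔ I.t ∈ Subsemigroup.closure I.X) := by
    intro w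
    have hM : ∀ o c, M.Run w M.init o c → ∀ i, c.head i < space K w.length := hK w
    have hx : node K w.length M.init < nodes M K w.length :=
      node_lt_nodes (Nat.zero_le _) (hM _ _ (.refl _))
    refine ⟨redInstance hV w ⟨_, hx⟩ ⟨_, sink_lt_nodes w.length⟩,
      encode_redInstance hV w rfl rfl, ?_⟩
    rw [hA]
    exact (accepts_iff hM rfl rfl).trans (Brandt.pair_mem_closure_iff _ _ _).symm
  constructor
  · intro w hw
    obtain ⟨I, hI, h⟩ := key w
    exact ⟨I, h.1 hw, hI⟩
  · intro w hw
    obtain ⟨I, hI, h⟩ := key w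
    exact ⟨I, fun h' => hw (h.2 h'), hI⟩

end Reduction

end CayleyNL

/-! ### The main theorem -/

theorem mainTheorem7
    (V : (S : Type) → [Semigroup S] → Prop)
    (hV : ∀ (S : Type) [Semigroup S] [Finite S], CayleyNL.IsZeroSimple S → V S) :
    CayleyNL.NLComplete CayleyNL.AC0Computable (CayleyNL.CSM V) ∧
    CayleyNL.NLComplete CayleyNL.LogSpaceComputable (CayleyNL.CSM V) :=
  ⟨⟨CayleyNL.inNL_CSM V, CayleyNL.nlHard_CSM CayleyNL.reduction_AC0Computable hV⟩,
    ⟨CayleyNL.inNL_CSM V, CayleyNL.nlHard_CSM CayleyNL.reduction_logSpaceComputable hV⟩⟩
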